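/- Let $(M,g)$ be a space-time: a smooth Hausdorff $4$-manifold with a smooth Lorentz metric $g$ of signature $(-,+,+,+)$ and a time orientation given by a smooth timelike vector field. Let $\theta=p_a\,dx^a$ and $\omega=d\theta=dp_a\wedge dx^a$ be the canonical forms on $T^*M$, let $H(x,p)=\tfrac12 g^{ab}p_ap_b$, and let $X_G$ be the geodesic spray, $X_G\lrcorner\,\omega+dH=0$. A lifted null geodesic is an integral curve of $X_G$ (on an open interval) consisting of non-zero covectors $p$ with $g^{ab}p_ap_b=0$ and $p^a=g^{ab}p_b$ future pointing. A Cauchy surface of $M$ is a smoothly embedded spacelike hypersurface $S\subset M$ which every inextendible smooth future directed causal curve meets exactly once. Let $h$ be the Riemannian metric induced on $S$, and let $T^*_1S\subset T^*S$ be the bundle of covectors of $h$-length $1$. To $(x,v)\in T^*_1S$ associate the future pointing null covector $v+n\in T^*_xM$, where $n$ is the future pointing unit timelike conormal of $S$ at $x$ and $v$ is extended by zero on the normal direction of $S$. The contact plane of $T^*_1S$ at a point is the kernel of the restriction of the canonical one-form of $T^*S$ to the tangent space of $T^*_1S$. Let $S_1$ and $S_2$ be any Cauchy surfaces of $M$.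 Then the null geodesic flow defines a map $f_g:T^*_1S_1\to T^*_1S_2$: for each $(x_1,v_1)\in T^*_1S_1$ there is exactly one $(x_2,v_2)\in T^*_1S_2$ such that some lifted null geodesic passes through the covector associated with $(x_1,v_1)$ and through a positive multiple of the covector associated with $(x_2,v_2)$, and $f_g(x_1,v_1)=(x_2,v_2)$. This $f_g$ is a contact mapping: it is a diffeomorphism, and its differential maps the contact plane of $T^*_1S_1$ at each point $q$ onto the contact plane of $T^*_1S_2$ at $f_g(q)$. -/

import Mathlib

open Set Filter Topology
open scoped Manifold ContDiff

noncomputable section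

/-! ## The cotangent bundle and its canonical forms -/

section Cotangent

variable (E : Type*) [NormedAddCommGroup E] [NormedSpace ℝ E]
  (M : Type*) [TopologicalSpace M] [ChartedSpace E M] [IsManifold 𝓘(ℝ, E) ∞ M]

/-- The cotangent bundle `T*M` of a smooth manifold without boundary modelled on `E`;
a point is a pair `⟨x, p⟩` with `p` a covector at `x`. -/
abbrev CotangentBundle : Type _ :=
  Bundle.TotalSpace (E →L[ℝ] ℝ) (fun x : M => TangentSpace 𝓘(ℝ, E) x →L[ℝ] ℝ)

/-- The model with corners of the manifold `T*M`, with model space `E × E*`. -/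
abbrev cotangentModel :
    ModelWithCorners ℝ (E × (E →L[ℝ] ℝ)) (ModelProd E (E →L[ℝ] ℝ)) :=
  𝓘(ℝ, E).prod 𝓘(ℝ, E →L[ℝ] ℝ)

variable {E M}

/-- The canonical one-form `θ = p_a dx^a` on `T*M`:
`θ_q(w) = p(dπ(w))` for `q = (x, p)` and `π : T*M → M` the projection. -/
def canonicalOneForm (q : CotangentBundle E M)
    (w : TangentSpace (cotangentModel E) q) : ℝ :=
  q.2 (mfderiv (cotangentModel E) 𝓘(ℝ, E)
    (fun r : CotangentBundle E M => r.proj) q w)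

/-- The components `(dx^a(w), dp_a(w))` of a tangent vector `w` to `T*M` at `q` in the natural
coordinates `(x^a, p_a)` of `T*M` induced by the preferred chart of `M` at the base point. -/
def naturalComponents (q : CotangentBundle E M)
    (w : TangentSpace (cotangentModel E) q) : E × (E →L[ℝ] ℝ) :=
  mfderiv (cotangentModel E) 𝓘(ℝ, E × (E →L[ℝ] ℝ)) (extChartAt (cotangentModel E) q) q w

/-- The symplectic form `ω = dθ = dp_a ∧ dx^a` on `T*M`, written in natural coordinates. -/
def canonicalTwoForm (q : CotangentBundle E M)
    (v w : TangentSpace (cotangentModel E) q) : ℝ :=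
  (naturalComponents q v).2 (naturalComponents q w).1
    - (naturalComponents q w).2 (naturalComponents q v).1

end Cotangent

/-! ## Space-times -/

section Spacetime

/-- A smooth Lorentz metric, of signature `(-, +, ..., +)`. -/
structure LorentzMetric (E : Type*) [NormedAddCommGroup E] [NormedSpace ℝ E]
    (M : Type*) [TopologicalSpace M] [ChartedSpace E M] [IsManifold 𝓘(ℝ, E) ∞ M] where
  val : ∀ x : M, TangentSpace 𝓘(ℝ, E) x →L[ℝ] TangentSpace 𝓘(ℝ, E) x →L[ℝ] ℝ
  symm : ∀ (x : M) (u v : TangentSpace 𝓘(ℝ, E) x), val x u v = val x v u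
  lorentzian : ∀ x : M, ∃ u : TangentSpace 𝓘(ℝ, E) x, val x u u < 0 ∧
    ∀ w : TangentSpace 𝓘(ℝ, E) x, val x u w = 0 → w ≠ 0 → 0 < val x w w
  contMDiff : ContMDiff 𝓘(ℝ, E) (𝓘(ℝ, E).prod 𝓘(ℝ, E →L[ℝ] E →L[ℝ] ℝ)) ∞
    (fun x => Bundle.TotalSpace.mk' (E →L[ℝ] E →L[ℝ] ℝ)
      (E := fun x : M => TangentSpace 𝓘(ℝ, E) x →L[ℝ] TangentSpace 𝓘(ℝ, E) x →L[ℝ] ℝ)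
      x (val x))

/-- The structure of a space-time on `M`: a Lorentz metric together with a time orientation,
given by a smooth timelike vector field (which is declared to be future pointing). -/
structure SpacetimeStructure (E : Type*) [NormedAddCommGroup E] [NormedSpace ℝ E]
    (M : Type*) [TopologicalSpace M] [ChartedSpace E M] [IsManifold 𝓘(ℝ, E) ∞ M]
    extends LorentzMetric E M where
  timeField : ∀ x : M, TangentSpace 𝓘(ℝ, E) x
  timelike_timeField : ∀ x, val x (timeField x) (timeField x) < 0
  contMDiff_timeField : ContMDiff 𝓘(ℝ, E) 𝓘(ℝ, E).tangent ∞
    (fun x => (⟨x, timeField x⟩ : TangentBundle 𝓘(ℝ, E) M))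

variable {E : Type*} [NormedAddCommGroup E] [NormedSpace ℝ E]
  {M : Type*} [TopologicalSpace M] [ChartedSpace E M] [IsManifold 𝓘(ℝ, E) ∞ M]

/-- The metric at a point is invertible as a map `T_x M → T*_x M` (index lowering). -/
theorem LorentzMetric.isInvertible [FiniteDimensional ℝ E] (g : LorentzMetric E M) (x : M) :
    (g.val x).IsInvertible := by
  have key : ∀ A : E →L[ℝ] E →L[ℝ] ℝ, (∀ v, A v = 0 → v = 0) → A.IsInvertible := by
    intro A hA
    have hinj : Function.Injective (A : E →ₗ[ℝ] E →L[ℝ] ℝ) := by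
      rw [← LinearMap.ker_eq_bot, LinearMap.ker_eq_bot']
      exact hA
    have hdim : Module.finrank ℝ E = Module.finrank ℝ (E →L[ℝ] ℝ) := by
      rw [← (LinearMap.toContinuousLinearMap (𝕜 := ℝ) (E := E) (F' := ℝ)).finrank_eq]
      exact Subspace.dual_finrank_eq.symm
    exact ⟨(LinearMap.linearEquivOfInjective (A : E →ₗ[ℝ] E →L[ℝ] ℝ)
      hinj hdim).toContinuousLinearEquiv, by ext; rfl⟩
  have hinj : ∀ v : TangentSpace 𝓘(ℝ, E) x, g.val x v = 0 → v = 0 := by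
    intro v hv
    by_contra hne
    obtain ⟨u, -, hu⟩ := g.lorentzian x
    have h0 : g.val x u v = 0 := (g.symm x u v).trans (DFunLike.congr_fun hv u)
    have h1 : g.val x v v = 0 := DFunLike.congr_fun hv v
    exact absurd h1 (hu v h0 hne).ne'
  exact key (g.val x) hinj

namespace SpacetimeStructure

variable (g : SpacetimeStructure E M)

/-- A tangent vector is causal and future pointing (in particular it is not zero). -/
def IsFutureCausal (x : M) (v : TangentSpace 𝓘(ℝ, E) x) : Prop :=
  g.val x v v ≤ 0 ∧ g.val x v (g.timeField x) < 0

/-- Raising the index of a covector, `p_a ↦ p^a = g^{ab} p_b`: the inverse of the map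
`v ↦ g(v, ·)`. -/
def sharp (x : M) (p : TangentSpace 𝓘(ℝ, E) x →L[ℝ] ℝ) : TangentSpace 𝓘(ℝ, E) x :=
  (g.val x).inverse p

theorem val_sharp [FiniteDimensional ℝ E] (x : M) (p : TangentSpace 𝓘(ℝ, E) x →L[ℝ] ℝ) :
    g.val x (g.sharp x p) = p :=
  (g.isInvertible x).self_apply_inverse p

/-- The Hamiltonian `H(x, p) = ½ g^{ab} p_a p_b` on `T*M`. -/
def hamiltonian (q : CotangentBundle E M) : ℝ :=
  (1 / 2) * q.2 (g.sharp q.proj q.2)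

/-- The bundle `N'M` of future pointing null covectors (necessarily not zero). -/
def nullBundle : Set (CotangentBundle E M) :=
  {q | q.2 (g.sharp q.proj q.2) = 0 ∧ g.IsFutureCausal q.proj (g.sharp q.proj q.2)}

/-- The value `dH(w)` of the differential of the Hamiltonian on a tangent vector `w` to `T*M`
at `q`. -/
def dHamiltonian (q : CotangentBundle E M) (w : TangentSpace (cotangentModel E) q) : ℝ :=
  mfderiv (cotangentModel E) 𝓘(ℝ, ℝ) g.hamiltonian q w

/-- `X` is the value at `q` of the geodesic spray `X_G`, i.e. `X ⌟ ω + dH = 0` at `q`. -/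
def IsGeodesicSprayAt (q : CotangentBundle E M) (X : TangentSpace (cotangentModel E) q) : Prop :=
  ∀ w : TangentSpace (cotangentModel E) q,
    canonicalTwoForm q X w + g.dHamiltonian q w = 0

/-- `c`, restricted to the open interval `J`, is a null geodesic lifted to the cotangent bundle:
an integral curve of the geodesic spray which lies in `N'M`. -/
structure IsLiftedNullGeodesicOn (c : ℝ → CotangentBundle E M) (J : Set ℝ) : Prop where
  isOpen : IsOpen J
  ordConnected : J.OrdConnected
  mem_nullBundle : ∀ t ∈ J, c t ∈ g.nullBundle
  integral : ∀ t ∈ J, ∃ X : TangentSpace (cotangentModel E) (c t),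
    g.IsGeodesicSprayAt (c t) X ∧
    HasMFDerivAt 𝓘(ℝ, ℝ) (cotangentModel E) c t ((1 : ℝ →L[ℝ] ℝ).smulRight X)

/-- `γ`, restricted to the nonempty open interval `J`, is a smooth future directed causal curve
with neither a future nor a past endpoint. -/
structure IsInextendibleCausalCurveOn (γ : ℝ → M) (J : Set ℝ) : Prop where
  isOpen : IsOpen J
  ordConnected : J.OrdConnected
  nonempty : J.Nonempty
  contMDiffOn : ContMDiffOn 𝓘(ℝ, ℝ) 𝓘(ℝ, E) ∞ γ J
  causal : ∀ t ∈ J, g.IsFutureCausal (γ t) (mfderiv 𝓘(ℝ, ℝ) 𝓘(ℝ, E) γ t (1 : ℝ))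
  no_future_endpoint : ¬ ∃ x : M, Tendsto (fun t : J => γ t) atTop (𝓝 x)
  no_past_endpoint : ¬ ∃ x : M, Tendsto (fun t : J => γ t) atBot (𝓝 x)

end SpacetimeStructure

end Spacetime

/-! ## Cauchy surfaces and their cotangent sphere bundles -/

section CauchySurface

variable {E : Type*} [NormedAddCommGroup E] [NormedSpace ℝ E]
  {M : Type*} [TopologicalSpace M] [ChartedSpace E M] [IsManifold 𝓘(ℝ, E) ∞ M]
  {F : Type*} [NormedAddCommGroup F] [NormedSpace ℝ F]
  {S : Type*} [TopologicalSpace S] [ChartedSpace F S] [IsManifold 𝓘(ℝ, F) ∞ S]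

namespace SpacetimeStructure

variable (g : SpacetimeStructure E M)

/-- The metric `h = ι^* g` induced on `S` by a map `ι : S → M`. -/
def inducedMetric (ι : S → M) (x : S) (u v : TangentSpace 𝓘(ℝ, F) x) : ℝ :=
  g.val (ι x) (mfderiv 𝓘(ℝ, F) 𝓘(ℝ, E) ι x u) (mfderiv 𝓘(ℝ, F) 𝓘(ℝ, E) ι x v)

/-- `ι : S → M` exhibits `S` as a smooth (spacelike) Cauchy surface: `ι` is a smooth embedding
whose induced metric is Riemannian (so that `ι` is an immersion), and every inextendible causal
curve of `M` meets the image of `ι` exactly once. The hypersurface condition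
`dim S + 1 = dim M` is imposed by the choice of the model spaces. -/
structure IsCauchySurface (ι : S → M) : Prop where
  contMDiff : ContMDiff 𝓘(ℝ, F) 𝓘(ℝ, E) ∞ ι
  isEmbedding : IsEmbedding ι
  spacelike : ∀ (x : S) (u : TangentSpace 𝓘(ℝ, F) x), u ≠ 0 → 0 < g.inducedMetric ι x u u
  existsUnique_meets : ∀ (γ : ℝ → M) (J : Set ℝ), g.IsInextendibleCausalCurveOn γ J →
    ∃! t, t ∈ J ∧ γ t ∈ range ι

/-- The cotangent sphere bundle `T*_1 S`, as a subset of `T*S`: the covectors of unit length for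
the metric `h` induced on `S`, i.e. those of the form `h(u, ·)` with `h(u, u) = 1`. -/
def cosphereBundle (ι : S → M) : Set (CotangentBundle F S) :=
  {q | ∃ u : TangentSpace 𝓘(ℝ, F) q.proj,
    (∀ v, q.2 v = g.inducedMetric ι q.proj u v) ∧ g.inducedMetric ι q.proj u u = 1}

/-- `n` is the future pointing unit timelike conormal of `S` at `x`. -/
def IsUnitFutureConormal (ι : S → M) (x : S) (n : TangentSpace 𝓘(ℝ, E) (ι x) →L[ℝ] ℝ) : Prop :=
  (∀ u : TangentSpace 𝓘(ℝ, F) x, n (mfderiv 𝓘(ℝ, F) 𝓘(ℝ, E) ι x u) = 0) ∧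
  n (g.sharp (ι x) n) = -1 ∧
  g.IsFutureCausal (ι x) (g.sharp (ι x) n)

/-- `p` is the covector of `M` associated with the covector `q` of `S`:
the sum `p = v + n` of the future pointing unit conormal `n` of `S` and of the covector `v` of `M`
which is zero on the normal direction `n^a` of `S` and restricts to `q` on the tangent
space of `S`. -/
def IsNullLift (ι : S → M) (q : CotangentBundle F S)
    (p : TangentSpace 𝓘(ℝ, E) (ι q.proj) →L[ℝ] ℝ) : Prop :=
  ∃ n v : TangentSpace 𝓘(ℝ, E) (ι q.proj) →L[ℝ] ℝ,
    g.IsUnitFutureConormal (F := F) ι q.proj n ∧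
    v (g.sharp (ι q.proj) n) = 0 ∧
    (∀ u : TangentSpace 𝓘(ℝ, F) q.proj, v (mfderiv 𝓘(ℝ, F) 𝓘(ℝ, E) ι q.proj u) = q.2 u) ∧
    p = v + n

/-- The null geodesic through `q₁ ∈ T*_1 S₁` meets `S₂` with (unit) cotangent `q₂ ∈ T*_1 S₂`.
The covectors of a lifted null geodesic are compared with those of `T*_1 S₂` up to
multiplication by a positive number. -/
def GeodesicRelated {S₁ S₂ : Type*}
    [TopologicalSpace S₁] [ChartedSpace F S₁] [IsManifold 𝓘(ℝ, F) ∞ S₁]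
    [TopologicalSpace S₂] [ChartedSpace F S₂] [IsManifold 𝓘(ℝ, F) ∞ S₂]
    (ι₁ : S₁ → M) (ι₂ : S₂ → M)
    (q₁ : CotangentBundle F S₁) (q₂ : CotangentBundle F S₂) : Prop :=
  ∃ (p₁ : TangentSpace 𝓘(ℝ, E) (ι₁ q₁.proj) →L[ℝ] ℝ)
    (p₂ : TangentSpace 𝓘(ℝ, E) (ι₂ q₂.proj) →L[ℝ] ℝ)
    (c : ℝ → CotangentBundle E M) (J : Set ℝ) (t₁ t₂ a : ℝ),
    g.IsNullLift ι₁ q₁ p₁ ∧ g.IsNullLift ι₂ q₂ p₂ ∧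
    g.IsLiftedNullGeodesicOn c J ∧ t₁ ∈ J ∧ t₂ ∈ J ∧ 0 < a ∧
    c t₁ = ⟨ι₁ q₁.proj, p₁⟩ ∧ c t₂ = ⟨ι₂ q₂.proj, a • p₂⟩

end SpacetimeStructure

end CauchySurface

/-! ## Contact mappings between submanifolds of cotangent bundles -/

section Contact

variable {F : Type*} [NormedAddCommGroup F] [NormedSpace ℝ F]
  {S : Type*} [TopologicalSpace S] [ChartedSpace F S] [IsManifold 𝓘(ℝ, F) ∞ S]
  {S' : Type*} [TopologicalSpace S'] [ChartedSpace F S'] [IsManifold 𝓘(ℝ, F) ∞ S']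

/-- The tangent space at `q` of a submanifold `A` of `T*S`: the velocities at `q` of the smooth
curves in `A`. -/
def submanifoldTangent (A : Set (CotangentBundle F S)) (q : CotangentBundle F S) :
    Set (TangentSpace (cotangentModel F) q) :=
  {w | ∃ c : ℝ → CotangentBundle F S,
    ContMDiffAt 𝓘(ℝ, ℝ) (cotangentModel F) ∞ c 0 ∧ (∀ᶠ t in 𝓝 0, c t ∈ A) ∧ c 0 = q ∧
    HasMFDerivAt 𝓘(ℝ, ℝ) (cotangentModel F) c 0 ((1 : ℝ →L[ℝ] ℝ).smulRight w)}

/-- The contact plane at `q` of a submanifold `A` of `T*S`: the kernel, in the tangent space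
of `A`, of the restriction to `A` of the canonical one-form of `T*S`. -/
def contactPlane (A : Set (CotangentBundle F S)) (q : CotangentBundle F S) :
    Set (TangentSpace (cotangentModel F) q) :=
  {w | w ∈ submanifoldTangent A q ∧ canonicalOneForm q w = 0}

/-- `Φ` is a smooth extension, near the point `q` of `A`, of the map `f` between the subsets
`A` of `T*S` and `B` of `T*S'`. -/
def IsSmoothExtensionAt {A : Set (CotangentBundle F S)} {B : Set (CotangentBundle F S')}
    (f : A → B) (q : A) (Φ : CotangentBundle F S → CotangentBundle F S') : Prop :=
  ContMDiffAt (cotangentModel F) (cotangentModel F) ∞ Φ (q : CotangentBundle F S) ∧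
  ∀ᶠ r in 𝓝 (q : CotangentBundle F S), ∀ hr : r ∈ A, Φ r = f ⟨r, hr⟩

/-- A map between submanifolds is smooth if locally it is the restriction of a smooth map. -/
def IsSmoothBetween {A : Set (CotangentBundle F S)} {B : Set (CotangentBundle F S')}
    (f : A → B) : Prop :=
  ∀ q : A, ∃ Φ, IsSmoothExtensionAt f q Φ

/-- A contact mapping between the submanifolds `A` and `B`: a diffeomorphism whose
differential (computed by means of any local smooth extension) maps the contact plane at each point
onto the contact plane at the image point. -/
structure IsContactMapping {A : Set (CotangentBundle F S)} {B : Set (CotangentBundle F S')}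
    (f : A ≃ B) : Prop where
  smooth : IsSmoothBetween f
  smooth_symm : IsSmoothBetween f.symm
  map_contactPlane : ∀ (q : A) (Φ : CotangentBundle F S → CotangentBundle F S'),
    IsSmoothExtensionAt f q Φ →
    mfderiv (cotangentModel F) (cotangentModel F) Φ (q : CotangentBundle F S) ''
      contactPlane A (q : CotangentBundle F S) = contactPlane B (Φ q)

end Contact

end

open Set Filter Topology
open scoped Manifold ContDiff

set_option maxSynthPendingDepth 3
set_option linter.unusedSectionVars false

/-! Adding the unit conormal identifies the unit covectors of a spacelike hypersurface with the
future null covectors above it up to positive scaling (`exists_isNullLift`,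
`exists_pos_smul_isNullLift`, `isNullLift_smul_unique`). A maximal null geodesic projects to an
inextendible causal curve, so it meets each Cauchy surface exactly once. Since geodesics can be
reversed and rescaled, the resulting relation between the two cosphere bundles is a bijection
(`exists_equiv_geodesicRelated`).

Inextendibility (`isInextendibleCausalCurveOn_geodesicFlow`) requires an estimate. Suppose the
projected curve converged to a point. In a small chart there, a linear time function `ℓ` controls
the size of null vectors. The geodesic equation is quadratic in the momentum, so the rate `w` of `ℓ`
along the curve satisfies `|w'| ≤ C w²`. As `ℓ` itself stays bounded, `w` stays bounded above and
away from zero (`bounds_of_abs_deriv_le_mul_sq`, `exists_nhds_null_bound`). The lifted curve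
therefore lives for bounded time in a compact set, and the flow box at a cluster point extends it
past the end of its maximal interval.

Smoothness has three ingredients: the null lift is smooth because it solves an equation with
invertible derivative (`exists_contMDiffAt_nullLift`); the geodesic flow is smooth on its whole
domain (`isFlowRegularAt`, resting on `exists_contDiffOn_localFlow`); the arrival at the second
surface is smooth because null directions are transversal to a spacelike hypersurface
(`exists_contMDiffAt_projection`).

For the contact property, let `θ` be the canonical one-form and `X` the spray. The Lie derivative of
`θ` along `X` is `dH`, which vanishes on vectors tangent to the level `H = 0`, and `θ(X) = 2H = 0`
there. So the flow preserves `θ` along curves of null covectors, even when the flow time varies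
along the curve (`coordSpray_flow_preserves_oneForm`). On the first surface the null lift restricts
to the given covector; on the second the transported covector restricts to `a > 0` times the unit
covector (`oneFormVelocity_eq_of_restrict`). Hence the correspondence multiplies the one-form by
`1/a` along curves (`exists_extension_geodesicRelated`) and matches the kernels, in both directions
(`isContactMapping_of_exists_extension`). -/

/-! ## Smooth dependence of solutions of ordinary differential equations on initial data -/

section Nemytskii

variable {K : Type*} [TopologicalSpace K] [CompactSpace K]

/-- Pointwise application of operator-valued continuous functions. -/
noncomputable def ContinuousMap.pointwiseApply (K : Type*) [TopologicalSpace K] [CompactSpace K]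
    (E F : Type*) [NormedAddCommGroup E] [NormedSpace ℝ E]
    [NormedAddCommGroup F] [NormedSpace ℝ F] :
    C(K, E →L[ℝ] F) →L[ℝ] C(K, E) →L[ℝ] C(K, F) :=
  LinearMap.mkContinuous₂
    (LinearMap.mk₂ ℝ
      (fun (A : C(K, E →L[ℝ] F)) (h : C(K, E)) => (⟨fun t => A t (h t), by fun_prop⟩ : C(K, F)))
      (fun A B h => by ext; simp) (fun c A h => by ext; simp)
      (fun A h k => by ext; simp) (fun c A h => by ext; simp)) 1
    (fun A h => by
      rw [one_mul]
      refine (ContinuousMap.norm_le _ (by positivity)).2 fun t => ?_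
      exact ((A t).le_opNorm _).trans
        (mul_le_mul (A.norm_coe_le_norm t) (h.norm_coe_le_norm t) (by positivity)
          (by positivity)))

/-- The mean value inequality at each point of `K` bounds the remainder by the oscillation of `f'`
near `u t`. Compactness of `K` makes this oscillation small uniformly in `t`. -/
theorem ContinuousMap.hasFDerivAt_comp {E F : Type*} [NormedAddCommGroup E] [NormedSpace ℝ E]
    [NormedAddCommGroup F] [NormedSpace ℝ F] (f : C(E, F)) (f' : C(E, E →L[ℝ] F))
    (hf : ∀ x, HasFDerivAt f (f' x) x) (u : C(K, E)) :
    HasFDerivAt (fun v : C(K, E) => f.comp v)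
      (ContinuousMap.pointwiseApply K E F (f'.comp u)) u := by
  rw [hasFDerivAt_iff_isLittleO_nhds_zero, Asymptotics.isLittleO_iff]
  intro ε hε
  have h1 : ∀ᶠ y : E in 𝓝 0, ∀ t ∈ (univ : Set K), ‖f' (u t + y) - f' (u t)‖ < ε := by
    refine IsCompact.eventually_forall_of_forall_eventually isCompact_univ fun t _ => ?_
    have hc : Continuous fun z : E × K => ‖f' (u z.2 + z.1) - f' (u z.2)‖ := by fun_prop
    have := hc.tendsto (0, t)
    simp only [add_zero, sub_self, norm_zero] at this
    exact this.eventually (gt_mem_nhds hε)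
  obtain ⟨δ, hδ, hball⟩ := Metric.eventually_nhds_iff.1 h1
  filter_upwards [Metric.ball_mem_nhds (0 : C(K, E)) hδ] with h hh
  rw [ContinuousMap.norm_le _ (by positivity)]
  intro t
  have hht : ‖h t‖ < δ := (h.norm_coe_le_norm t).trans_lt (by simpa using hh)
  have key := (convex_ball (u t) δ).norm_image_sub_le_of_norm_hasFDerivWithin_le'
    (f := f) (f' := f') (φ := f' (u t)) (C := ε) (x := u t) (y := u t + h t)
    (fun x _ => (hf x).hasFDerivWithinAt)
    (fun x hx => by
      have := hball (y := x - u t) (by simpa [dist_eq_norm] using hx) t (mem_univ t)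
      rw [add_sub_cancel] at this
      exact this.le)
    (by simpa using hδ) (by simpa using hht)
  simp only [add_sub_cancel_left] at key
  refine le_trans ?_ (key.trans (mul_le_mul_of_nonneg_left (h.norm_coe_le_norm t) hε.le))
  exact le_of_eq rfl

/-- The derivative is again a superposition operator, that of `f'`, followed by a continuous linear
map. The induction therefore varies the target space, and `E` and `F` share a universe so that `E
→L[ℝ] F` is again an admissible target. -/
theorem ContinuousMap.contDiff_comp_nat.{u} {E : Type u} [NormedAddCommGroup E] [NormedSpace ℝ E]
    (n : ℕ) : ∀ {F : Type u} [NormedAddCommGroup F] [NormedSpace ℝ F] (f : C(E, F)),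
      ContDiff ℝ n f → ContDiff ℝ n (fun v : C(K, E) => f.comp v) := by
  induction n with
  | zero =>
    intro F _ _ f _
    exact contDiff_zero.2 (ContinuousMap.continuous_postcomp f)
  | succ n ih =>
    intro F _ _ f hf
    obtain ⟨f', hf', hd⟩ := contDiff_succ_iff_hasFDerivAt.1 hf
    refine contDiff_succ_iff_hasFDerivAt.2
      ⟨fun u => ContinuousMap.pointwiseApply K E F
        ((⟨f', hf'.continuous⟩ : C(E, E →L[ℝ] F)).comp u), ?_, fun u => ?_⟩
    · exact (ContinuousMap.pointwiseApply K E F).contDiff.comp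
        (ih (⟨f', hf'.continuous⟩ : C(E, E →L[ℝ] F)) hf')
    · exact ContinuousMap.hasFDerivAt_comp f ⟨f', hf'.continuous⟩ hd u

theorem ContinuousMap.contDiff_comp {E : Type*} [NormedAddCommGroup E] [NormedSpace ℝ E]
    (f : C(E, E)) (hf : ContDiff ℝ ∞ f) :
    ContDiff ℝ ∞ (fun v : C(K, E) => f.comp v) :=
  contDiff_infty.2 fun n => ContinuousMap.contDiff_comp_nat n f (contDiff_infty.1 hf n)

end Nemytskii

/-! ### The integral operator of the Picard equation -/

section Integral

variable {W : Type*} [NormedAddCommGroup W] [NormedSpace ℝ W] [CompleteSpace W]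

/-- The primitive vanishing at `0`, as an operator on continuous functions on `[-1, 1]`. -/
noncomputable def primitiveOp (W : Type*) [NormedAddCommGroup W] [NormedSpace ℝ W]
    [CompleteSpace W] : C(Icc (-1 : ℝ) 1, W) →L[ℝ] C(Icc (-1 : ℝ) 1, W) :=
  LinearMap.mkContinuous
    { toFun := fun u => ⟨fun s => ∫ r in (0 : ℝ)..s, IccExtend (by norm_num) u r,
        (intervalIntegral.continuous_primitive
          (fun a b => (u.continuous.Icc_extend' (h := by norm_num)).intervalIntegrable a b) 0).comp
            continuous_subtype_val⟩
      map_add' := fun u v => by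
        ext s
        exact intervalIntegral.integral_add
          ((u.continuous.Icc_extend' (h := by norm_num)).intervalIntegrable _ _)
          ((v.continuous.Icc_extend' (h := by norm_num)).intervalIntegrable _ _)
      map_smul' := fun c u => by
        ext s
        exact intervalIntegral.integral_smul c _ } 1
    (fun u => by
      rw [one_mul, ContinuousMap.norm_le _ (norm_nonneg _)]
      intro s
      refine (intervalIntegral.norm_integral_le_of_norm_le_const (C := ‖u‖)
        fun r _ => u.norm_coe_le_norm _).trans ?_
      have : |(s : ℝ) - 0| ≤ 1 := by
        rw [sub_zero, abs_le]; exact s.2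
      exact mul_le_of_le_one_right (norm_nonneg _) this)

theorem primitiveOp_apply (u : C(Icc (-1 : ℝ) 1, W)) (s : Icc (-1 : ℝ) 1) :
    primitiveOp W u s = ∫ r in (0 : ℝ)..s, IccExtend (by norm_num : (-1 : ℝ) ≤ 1) u r := rfl

end Integral

/-! ### Smooth local flows from the inverse function theorem on path space -/

section LocalFlow

variable {W : Type*} [NormedAddCommGroup W] [NormedSpace ℝ W] [CompleteSpace W]

/-- The continuous map `r ↦ u (s r)` for `s` in `[-1, 1]`. -/
def rescaleCurve (u : C(Icc (-1 : ℝ) 1, W)) (s : Icc (-1 : ℝ) 1) : C(Icc (-1 : ℝ) 1, W) :=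
  u.comp ⟨fun r => ⟨s * r, by
    have h1 := abs_le.2 s.2
    have h2 := abs_le.2 r.2
    rw [mem_Icc, ← abs_le, abs_mul]
    exact mul_le_one₀ h1 (abs_nonneg _) h2⟩, by fun_prop⟩

/-- The substitution `a ↦ s a`. It shows that a solution of the Picard equation of duration `t`, run
at speed `s`, solves the equation of duration `s t`. -/
theorem rescaleCurve_integral (u : C(Icc (-1 : ℝ) 1, W)) (s r : Icc (-1 : ℝ) 1) (f : C(W, W)) :
    (s : ℝ) • primitiveOp W (f.comp (rescaleCurve u s)) r
      = ∫ a in (0 : ℝ)..(s * r), IccExtend (by norm_num : (-1 : ℝ) ≤ 1) (f.comp u) a := by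
  have := intervalIntegral.smul_integral_comp_mul_left (a := 0) (b := r)
    (fun a => IccExtend (by norm_num : (-1 : ℝ) ≤ 1) (f.comp u) a) (s : ℝ)
  rw [mul_zero] at this
  rw [← this, primitiveOp_apply]
  congr 1
  refine intervalIntegral.integral_congr fun a ha => ?_
  have ha' : a ∈ Icc (-1 : ℝ) 1 := by
    rw [uIcc, mem_Icc] at ha
    have := r.2.1; have := r.2.2
    constructor
    · refine le_trans ?_ ha.1
      simp [r.2.1]
    · refine ha.2.trans ?_
      simp [r.2.2]
  have hsa : (s : ℝ) * a ∈ Icc (-1 : ℝ) 1 := by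
    have h1 := abs_le.2 s.2
    have h2 := abs_le.2 ha'
    rw [mem_Icc, ← abs_le, abs_mul]
    exact mul_le_one₀ h1 (abs_nonneg _) h2
  rw [IccExtend_of_mem _ _ ha', IccExtend_of_mem _ _ hsa]
  rfl

/-- A globally defined smooth vector field has a smooth local flow. -/
theorem exists_contDiffOn_localFlow (f : W → W) (hf : ContDiff ℝ ∞ f) (x₀ : W) :
    ∃ φ : W × ℝ → W, ∃ U : Set W, IsOpen U ∧ x₀ ∈ U ∧ ∃ ε > 0,
      ContDiffOn ℝ ∞ φ (U ×ˢ Ioo (-ε) ε) ∧ (∀ x ∈ U, φ (x, 0) = x) ∧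
      ∀ x ∈ U, ∀ t ∈ Ioo (-ε) ε, HasDerivAt (fun s => φ (x, s)) (f (φ (x, t))) t := by
  set fC : C(W, W) := ⟨f, hf.continuous⟩ with hfC
  let C := C(Icc (-1 : ℝ) 1, W)
  let cst : W →L[ℝ] C := ContinuousLinearMap.const ℝ (Icc (-1 : ℝ) 1)
  -- With time rescaled to `[-1, 1]`, the duration `t` is a parameter of the Picard equation `u = x
  -- + t ∫ f(u)`. Its solutions are the points that `G` sends to `((x, t), 0)`.
  let G : (W × ℝ) × C → (W × ℝ) × C := fun a =>
    (a.1, a.2 - cst a.1.1 - a.1.2 • primitiveOp W (fC.comp a.2))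
  have hNem : ContDiff ℝ ∞ (fun v : C => fC.comp v) := ContinuousMap.contDiff_comp fC hf
  have hG : ContDiff ℝ ∞ G := by
    refine contDiff_fst.prodMk ((contDiff_snd.sub (cst.contDiff.comp
      (contDiff_fst.comp contDiff_fst))).sub ((contDiff_snd.comp contDiff_fst).smul ?_))
    exact (primitiveOp W).contDiff.comp (hNem.comp contDiff_snd)
  let a₀ : (W × ℝ) × C := ((x₀, 0), cst x₀)
  let k : C := primitiveOp W (fC.comp (cst x₀))
  let π₁ : (W × ℝ) × C →L[ℝ] W × ℝ := ContinuousLinearMap.fst ℝ (W × ℝ) C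
  let π₂ : (W × ℝ) × C →L[ℝ] C := ContinuousLinearMap.snd ℝ (W × ℝ) C
  let m : (W × ℝ) × C →L[ℝ] C :=
    cst.comp ((ContinuousLinearMap.fst ℝ W ℝ).comp π₁)
      + ((ContinuousLinearMap.snd ℝ W ℝ).comp π₁).smulRight k
  -- At `t = 0` the derivative of the integral term in the curve variable disappears, so the
  -- derivative of `G` is a shear with an explicit inverse.
  let e : ((W × ℝ) × C) ≃L[ℝ] ((W × ℝ) × C) := ContinuousLinearEquiv.equivOfInverse
    (π₁.prod (π₂ - m)) (π₁.prod (π₂ + m))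
    (fun z => by
      refine Prod.ext rfl ?_
      change (z.2 - m z) + m z = z.2
      abel)
    (fun z => by
      refine Prod.ext rfl ?_
      change (z.2 + m z) - m z = z.2
      abel)
  have hGd : HasFDerivAt G (e : ((W × ℝ) × C) →L[ℝ] ((W × ℝ) × C)) a₀ := by
    have h2 : HasFDerivAt (fun a : (W × ℝ) × C => primitiveOp W (fC.comp a.2))
        (fderiv ℝ (fun a : (W × ℝ) × C => primitiveOp W (fC.comp a.2)) a₀) a₀ := by
      apply DifferentiableAt.hasFDerivAt
      exact (((primitiveOp W).contDiff.comp (hNem.comp contDiff_snd)).differentiable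
        (by simp)).differentiableAt
    have h3 : HasFDerivAt (fun a : (W × ℝ) × C => a.1.2)
        ((ContinuousLinearMap.snd ℝ W ℝ).comp π₁) a₀ :=
      ((ContinuousLinearMap.snd ℝ W ℝ).comp π₁).hasFDerivAt
    have h4 : HasFDerivAt (fun a : (W × ℝ) × C => cst a.1.1)
        (cst.comp ((ContinuousLinearMap.fst ℝ W ℝ).comp π₁)) a₀ :=
      (cst.comp ((ContinuousLinearMap.fst ℝ W ℝ).comp π₁)).hasFDerivAt
    have h5 := (π₁.hasFDerivAt (x := a₀)).prodMk
      (((π₂.hasFDerivAt (x := a₀)).sub h4).sub (h3.smul h2))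
    refine h5.congr_fderiv ?_
    ext z
    all_goals simp [e, m, π₁, π₂, a₀, k]
  let Φ := hG.contDiffAt.toOpenPartialHomeomorph G hGd (by simp)
  have ha₀s : a₀ ∈ Φ.source := ContDiffAt.mem_toOpenPartialHomeomorph_source _ hGd (by simp)
  have hΦG : ∀ a, Φ a = G a := fun a => rfl
  have hGa₀ : G a₀ = ((x₀, 0), 0) := by
    simp [G, a₀]
  -- invertibility of the derivative is an open condition
  have hinv : ∀ᶠ a in 𝓝 a₀, fderiv ℝ G a ∈
      range ((↑) : (((W × ℝ) × C) ≃L[ℝ] ((W × ℝ) × C)) → _) := by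
    have hc : Continuous (fderiv ℝ G) := hG.continuous_fderiv (by simp)
    refine hc.continuousAt.eventually_mem ?_
    rw [hGd.fderiv]
    exact ContinuousLinearEquiv.nhds e
  obtain ⟨δ, hδ, hB⟩ := Metric.eventually_nhds_iff_ball.1
    ((Φ.open_source.eventually_mem ha₀s).and hinv)
  have hsymm : ∀ᶠ b in 𝓝 (((x₀, 0), 0) : (W × ℝ) × C), b ∈ Φ.target ∧ Φ.symm b ∈ Metric.ball a₀ δ := by
    have ht : ((x₀, 0), 0) ∈ Φ.target := by
      rw [← hGa₀]; exact Φ.map_source ha₀s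
    refine (Φ.open_target.eventually_mem ht).and ?_
    have hcont := Φ.continuousAt_symm ht
    refine hcont.eventually_mem ?_
    have : Φ.symm ((x₀, 0), 0) = a₀ := by
      rw [← hGa₀]; exact Φ.left_inv ha₀s
    rw [this]
    exact Metric.ball_mem_nhds _ hδ
  have hsymm' : ∀ᶠ b in 𝓝 ((x₀, 0) : W × ℝ),
      (b, (0 : C)) ∈ Φ.target ∧ Φ.symm (b, (0 : C)) ∈ Metric.ball a₀ δ := by
    have : Tendsto (fun b : W × ℝ => (b, (0 : C))) (𝓝 (x₀, 0)) (𝓝 ((x₀, 0), 0)) :=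
      (Continuous.prodMk_left (0 : C)).tendsto _
    exact this.eventually hsymm
  obtain ⟨η, hη, hV⟩ := Metric.eventually_nhds_iff_ball.1 hsymm'
  set δ' := min δ η with hδ'
  have hδ'pos : 0 < δ' := lt_min hδ hη
  let u : W × ℝ → C := fun b => (Φ.symm (b, (0 : C))).2
  have hmemV : ∀ x ∈ Metric.ball x₀ δ', ∀ t : ℝ, |t| < δ' → (x, t) ∈ Metric.ball (x₀, (0 : ℝ)) η := by
    intro x hx t ht
    rw [Metric.mem_ball, Prod.dist_eq]
    refine max_lt ?_ ?_
    · exact (Metric.mem_ball.1 hx).trans_le (min_le_right _ _)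
    · rw [Real.dist_eq, sub_zero]; exact ht.trans_le (min_le_right _ _)
  have hsol : ∀ b ∈ Metric.ball (x₀, (0 : ℝ)) η,
      Φ.symm (b, (0 : C)) = (b, u b) ∧ G (b, u b) = (b, 0) := by
    intro b hb
    have h1 : G (Φ.symm (b, (0 : C))) = (b, 0) := Φ.right_inv (hV b hb).1
    have h2 : (Φ.symm (b, (0 : C))).1 = b := congrArg Prod.fst h1
    have h3 : Φ.symm (b, (0 : C)) = (b, u b) := Prod.ext h2 rfl
    exact ⟨h3, by rw [← h3]; exact h1⟩
  have heq : ∀ x t, (x, t) ∈ Metric.ball (x₀, (0 : ℝ)) η →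
      ∀ r, u (x, t) r = x + t • primitiveOp W (fC.comp (u (x, t))) r := by
    intro x t hb r
    have h1 := congrArg Prod.snd (hsol _ hb).2
    have h2 := DFunLike.congr_fun h1 r
    have h3 : u (x, t) r - x - t • primitiveOp W (fC.comp (u (x, t))) r = 0 := h2
    rw [sub_sub, sub_eq_zero] at h3
    exact h3
  have huball : ∀ b ∈ Metric.ball (x₀, (0 : ℝ)) η, u b ∈ Metric.ball (cst x₀) δ := by
    intro b hb
    have := (hV b hb).2
    rw [Metric.mem_ball, Prod.dist_eq] at this
    exact (le_max_right _ _).trans_lt this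
  -- The rescaled curve solves the equation of duration `s t` and is still close to `cst x₀`, so
  -- local injectivity of `G` identifies it with the chosen solution. Curves of different durations
  -- are thus pieces of one trajectory.
  have huniq : ∀ x ∈ Metric.ball x₀ δ', ∀ t : ℝ, |t| < δ' → ∀ s : Icc (-1 : ℝ) 1,
      u (x, s * t) = rescaleCurve (u (x, t)) s := by
    intro x hx t ht s
    have hst : |(s : ℝ) * t| < δ' := by
      rw [abs_mul]
      exact (mul_le_of_le_one_left (abs_nonneg _) (abs_le.2 s.2)).trans_lt ht
    have hb := hmemV x hx t ht
    have hb' := hmemV x hx _ hst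
    have hmem : (((x, (s : ℝ) * t), rescaleCurve (u (x, t)) s) : (W × ℝ) × C) ∈ Metric.ball a₀ δ := by
      rw [Metric.mem_ball, Prod.dist_eq, Prod.dist_eq]
      refine max_lt (max_lt ?_ ?_) ?_
      · exact (Metric.mem_ball.1 hx).trans_le (min_le_left _ _)
      · simp only [a₀, Real.dist_eq, sub_zero]
        exact hst.trans_le (min_le_left _ _)
      · rw [ContinuousMap.dist_lt_iff hδ]
        intro r
        exact (ContinuousMap.dist_lt_iff hδ).1 (huball _ hb) _
    have hmem2 : (((x, (s : ℝ) * t), u (x, s * t)) : (W × ℝ) × C) ∈ Metric.ball a₀ δ := by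
      rw [← (hsol _ hb').1]; exact (hV _ hb').2
    have hGeq : G ((x, (s : ℝ) * t), rescaleCurve (u (x, t)) s) = G ((x, (s : ℝ) * t), u (x, s * t)) := by
      rw [(hsol _ hb').2]
      refine Prod.ext rfl ?_
      ext r
      change rescaleCurve (u (x, t)) s r - x
        - ((s : ℝ) * t) • primitiveOp W (fC.comp (rescaleCurve (u (x, t)) s)) r = 0
      rw [mul_comm, mul_smul, rescaleCurve_integral, sub_sub, sub_eq_zero]
      exact heq x t hb _
    have := Φ.injOn (hB _ hmem).1 (hB _ hmem2).1 hGeq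
    exact (congrArg Prod.snd this).symm
  have husm : ∀ b ∈ Metric.ball (x₀, (0 : ℝ)) η, ContDiffAt ℝ ∞ u b := by
    intro b hb
    have h1 := (hV b hb)
    obtain ⟨e', he'⟩ := (hB _ h1.2).2
    have h2 : HasFDerivAt Φ (e' : ((W × ℝ) × C) →L[ℝ] ((W × ℝ) × C)) (Φ.symm (b, (0 : C))) := by
      have : e' = fderiv ℝ G (Φ.symm (b, (0 : C))) := he'
      rw [this]
      exact (hG.differentiable (by simp)).differentiableAt.hasFDerivAt
    have h3 := Φ.contDiffAt_symm h1.1 h2 (hG.contDiffAt (x := Φ.symm (b, (0 : C))))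
    have h4 : ContDiffAt ℝ ∞ (fun b : W × ℝ => (b, (0 : C))) b :=
      (contDiff_id.prodMk contDiff_const).contDiffAt
    exact contDiff_snd.contDiffAt.comp b (ContDiffAt.comp b h3 h4)
  let one : Icc (-1 : ℝ) 1 := ⟨1, by norm_num⟩
  let φ : W × ℝ → W := fun b => u b one
  have hφ : ∀ x ∈ Metric.ball x₀ δ', ∀ t : ℝ, |t| < δ' → ∀ s : Icc (-1 : ℝ) 1,
      φ (x, s * t) = u (x, t) s := by
    intro x hx t ht s
    change u (x, s * t) one = _
    rw [huniq x hx t ht s]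
    change u (x, t) ⟨(s : ℝ) * 1, _⟩ = _
    congr 1
    ext
    exact mul_one _
  refine ⟨φ, Metric.ball x₀ δ', Metric.isOpen_ball, Metric.mem_ball_self hδ'pos, δ' / 2,
    half_pos hδ'pos, ?_, ?_, ?_⟩
  · rintro ⟨x, t⟩ ⟨hx, ht⟩
    have hb := hmemV x hx t ((abs_lt.2 ht).trans (half_lt_self hδ'pos))
    exact ((ContinuousMap.evalCLM ℝ one : C →L[ℝ] W).contDiff.contDiffAt.comp _
      (husm _ hb)).contDiffWithinAt
  · intro x hx
    have := hφ x hx 0 (by simpa using hδ'pos) one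
    rw [mul_zero] at this
    rw [this, heq x 0 (hmemV x hx 0 (by simpa using hδ'pos)), zero_smul, add_zero]
  · intro x hx t ht
    -- A single curve, of duration `τ`, covers all times in `(-τ, τ)`. It satisfies an integral
    -- equation, which is differentiated by the fundamental theorem of calculus.
    set τ := δ' / 2 with hτ
    have hτpos : 0 < τ := half_pos hδ'pos
    have hτlt : |τ| < δ' := by rw [abs_of_pos hτpos]; exact half_lt_self hδ'pos
    have hb := hmemV x hx τ hτlt
    let w : ℝ → W := IccExtend (by norm_num : (-1 : ℝ) ≤ 1) (fC.comp (u (x, τ)))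
    have hw : Continuous w := (fC.comp (u (x, τ))).continuous.Icc_extend'
    have hdiv : ∀ s ∈ Ioo (-τ) τ, s / τ ∈ Icc (-1 : ℝ) 1 := by
      intro s hs
      rw [mem_Icc, ← abs_le, abs_div, abs_of_pos hτpos, div_le_one hτpos]
      exact (abs_lt.2 hs).le
    have hφτ : ∀ s (hs : s ∈ Ioo (-τ) τ), φ (x, s) = u (x, τ) ⟨s / τ, hdiv s hs⟩ := by
      intro s hs
      rw [← hφ x hx τ hτlt]
      congr 2
      exact (div_mul_cancel₀ s hτpos.ne').symm
    have hloc : (fun s => φ (x, s)) =ᶠ[𝓝 t] fun s => x + τ • ∫ r in (0 : ℝ)..(s / τ), w r := by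
      filter_upwards [isOpen_Ioo.mem_nhds ht] with s hs
      rw [hφτ s hs, heq x τ hb]
      rfl
    have hd1 : HasDerivAt (fun s => ∫ r in (0 : ℝ)..s, w r) (w (t / τ)) (t / τ) :=
      intervalIntegral.integral_hasDerivAt_right (hw.intervalIntegrable _ _)
        (hw.stronglyMeasurableAtFilter _ _) hw.continuousAt
    have hd2 : HasDerivAt (fun s : ℝ => s / τ) (1 / τ) t := (hasDerivAt_id t).div_const τ
    have hd3 := ((hd1.scomp t hd2).const_smul τ).const_add x
    refine (hd3.congr_of_eventuallyEq hloc).congr_deriv ?_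
    rw [smul_smul, mul_one_div_cancel hτpos.ne', one_smul, hφτ t ht]
    change IccExtend _ _ _ = _
    rw [IccExtend_of_mem _ _ (hdiv t ht)]
    rfl

/-- A smooth vector field on an open set has a smooth local flow. -/
theorem exists_contDiffOn_localFlow_of_isOpen [FiniteDimensional ℝ W] {Ω : Set W} (hΩ : IsOpen Ω)
    {f : W → W} (hf : ContDiffOn ℝ ∞ f Ω) {x₀ : W} (hx₀ : x₀ ∈ Ω) :
    ∃ φ : W × ℝ → W, ∃ U : Set W, IsOpen U ∧ x₀ ∈ U ∧ U ⊆ Ω ∧ ∃ ε > 0,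
      ContDiffOn ℝ ∞ φ (U ×ˢ Ioo (-ε) ε) ∧ (∀ x ∈ U, φ (x, 0) = x) ∧
      (∀ x ∈ U, ∀ t ∈ Ioo (-ε) ε, φ (x, t) ∈ Ω) ∧
      ∀ x ∈ U, ∀ t ∈ Ioo (-ε) ε, HasDerivAt (fun s => φ (x, s)) (f (φ (x, t))) t := by
  obtain ⟨r, hr, hrΩ⟩ := Metric.isOpen_iff.1 hΩ x₀ hx₀
  -- The cutoff makes the field global without changing it on the ball of radius `r / 4`. Initial
  -- points and times are later shrunk so that trajectories do not leave that ball.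
  let χ : ContDiffBump x₀ := ⟨r / 4, r / 2, by positivity, by linarith⟩
  let f' : W → W := fun x => χ x • f x
  have hf' : ContDiff ℝ ∞ f' := by
    rw [contDiff_iff_contDiffAt]
    intro x
    by_cases hx : x ∈ Metric.ball x₀ r
    · exact χ.contDiff.contDiffAt.smul (hf.contDiffAt (hΩ.mem_nhds (hrΩ hx)))
    · have hx' : x ∉ tsupport χ := by
        rw [χ.tsupport_eq]
        intro h
        have h1 : dist x x₀ ≤ r / 2 := Metric.mem_closedBall.1 h
        exact hx (Metric.mem_ball.2 (h1.trans_lt (by linarith)))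
      have h0 : f' =ᶠ[𝓝 x] fun _ => 0 := by
        filter_upwards [(isClosed_tsupport χ).isOpen_compl.mem_nhds hx'] with y hy
        simp [f', image_eq_zero_of_notMem_tsupport hy]
      exact contDiffAt_const.congr_of_eventuallyEq h0
  have hff' : ∀ x ∈ Metric.ball x₀ (r / 4), f' x = f x := by
    intro x hx
    simp only [f']
    rw [χ.one_of_mem_closedBall (Metric.ball_subset_closedBall hx), one_smul]
  obtain ⟨φ, U, hU, hxU, ε, hε, hsm, h0, hd⟩ := exists_contDiffOn_localFlow f' hf' x₀
  have hmem : (x₀, (0 : ℝ)) ∈ U ×ˢ Ioo (-ε) ε := ⟨hxU, by simpa using hε⟩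
  have hcont : ContinuousAt φ (x₀, 0) :=
    (hsm.continuousOn).continuousAt ((hU.prod isOpen_Ioo).mem_nhds hmem)
  have hev : ∀ᶠ b in 𝓝 (x₀, (0 : ℝ)), b ∈ U ×ˢ Ioo (-ε) ε ∧ φ b ∈ Metric.ball x₀ (r / 4) := by
    refine ((hU.prod isOpen_Ioo).eventually_mem hmem).and (hcont.eventually_mem ?_)
    rw [h0 _ hxU]
    exact Metric.ball_mem_nhds _ (by positivity)
  obtain ⟨η, hη, hball⟩ := Metric.eventually_nhds_iff_ball.1 hev
  have hb : ∀ x ∈ Metric.ball x₀ η, ∀ t ∈ Ioo (-η) η, (x, t) ∈ Metric.ball (x₀, (0 : ℝ)) η := by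
    intro x hx t ht
    rw [Metric.mem_ball, Prod.dist_eq]
    refine max_lt hx ?_
    rw [Real.dist_eq, sub_zero]
    exact abs_lt.2 ht
  have h4 : Metric.ball x₀ (r / 4) ⊆ Ω := (Metric.ball_subset_ball (by linarith)).trans hrΩ
  refine ⟨φ, Metric.ball x₀ η ∩ Ω, Metric.isOpen_ball.inter hΩ, ⟨Metric.mem_ball_self hη, hx₀⟩,
    inter_subset_right, η, hη, ?_, ?_, ?_, ?_⟩
  · refine hsm.mono ?_
    rintro ⟨x, t⟩ ⟨hx, ht⟩
    exact (hball _ (hb x hx.1 t ht)).1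
  · intro x hx
    exact h0 x (hball _ (hb x hx.1 0 (by simpa using hη))).1.1
  · intro x hx t ht
    exact h4 (hball _ (hb x hx.1 t ht)).2
  · intro x hx t ht
    have h5 := hball _ (hb x hx.1 t ht)
    have := hd x h5.1.1 t h5.1.2
    rwa [hff' _ h5.2] at this

end LocalFlow

/-! ## Linear algebra of Lorentzian forms -/

section LorentzAlgebra

variable {E : Type*} [NormedAddCommGroup E] [NormedSpace ℝ E]

/-- A symmetric bilinear form of signature `(-, +, ..., +)`. -/
def IsLorentzForm (B : E →L[ℝ] E →L[ℝ] ℝ) : Prop :=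
  (∀ u v, B u v = B v u) ∧ ∃ u, B u u < 0 ∧ ∀ w, B u w = 0 → w ≠ 0 → 0 < B w w

variable {B : E →L[ℝ] E →L[ℝ] ℝ}

/-- If `v` and `T` were orthogonal, the form would be nonpositive on their span. That span meets the
hyperplane orthogonal to `u`, on which the form is positive definite, in a nonzero vector. -/
theorem IsLorentzForm.ne_zero_of_causal_of_timelike (hB : IsLorentzForm B) {v T : E}
    (hT : B T T < 0) (hv : B v v ≤ 0) (hv0 : v ≠ 0) : B v T ≠ 0 := by
  intro h
  obtain ⟨hs, u, hu, hpos⟩ := hB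
  have hvT : B T v = 0 := by rw [hs, h]
  have hlin : ∀ a b : ℝ, B (a • v + b • T) (a • v + b • T) = a ^ 2 * B v v + b ^ 2 * B T T := by
    intro a b
    simp only [map_add, map_smul, add_apply, smul_apply, smul_eq_mul, h, hvT]
    ring
  by_cases hTu : B u T = 0
  · exact absurd (hpos T hTu (by rintro rfl; simp at hT)) (by linarith)
  · have hw : B u ((B u T) • v + (-(B u v)) • T) = 0 := by
      simp only [map_add, map_smul, smul_eq_mul]; ring
    have hle : B ((B u T) • v + (-(B u v)) • T) ((B u T) • v + (-(B u v)) • T) ≤ 0 := by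
      rw [hlin]
      nlinarith [sq_nonneg (B u T), sq_nonneg (-(B u v))]
    have h0 : (B u T) • v + (-(B u v)) • T = 0 := by
      by_contra hne
      exact absurd (hpos _ hw hne) (by linarith)
    have h1 : B ((B u T) • v + (-(B u v)) • T) T = 0 := by rw [h0]; simp
    simp only [map_add, map_smul, add_apply, smul_apply, smul_eq_mul, h, mul_zero, zero_add] at h1
    have h2 : -(B u v) = 0 := by
      rcases mul_eq_zero.1 h1 with h2 | h2
      · exact h2
      · exact absurd h2 hT.ne
    rw [h2, zero_smul, add_zero] at h0
    rcases smul_eq_zero.1 h0 with h3 | h3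
    · exact hTu h3
    · exact hv0 h3

/-- If `B v w ≥ 0`, then subtracting from `v` the positive multiple of `w` that makes it orthogonal
to `T` keeps it timelike. A timelike vector cannot be orthogonal to `T`. -/
theorem IsLorentzForm.neg_of_future (hB : IsLorentzForm B) {v w T : E}
    (hT : B T T < 0) (hv : B v v ≤ 0) (hvT : B v T < 0) (hw : B w w < 0) (hwT : B w T < 0) :
    B v w < 0 := by
  by_contra! hc
  have hs := hB.1
  set c := B v T / B w T with hcdef
  have hcpos : 0 < c := div_pos_of_neg_of_neg hvT hwT
  have hz : B (v - c • w) T = 0 := by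
    simp only [map_sub, map_smul, sub_apply, smul_apply, smul_eq_mul, hcdef]
    rw [div_mul_cancel₀ _ hwT.ne, sub_self]
  have hzz : B (v - c • w) (v - c • w) < 0 := by
    simp only [map_sub, map_smul, sub_apply, smul_apply, smul_eq_mul]
    rw [hs w v]
    nlinarith [mul_pos hcpos hcpos, mul_nonneg hcpos.le hc,
      mul_neg_of_pos_of_neg (mul_pos hcpos hcpos) hw]
  exact hB.ne_zero_of_causal_of_timelike hT hzz.le (by rintro h; rw [h] at hzz; simp at hzz) hz

variable {F : Type*} [NormedAddCommGroup F] [NormedSpace ℝ F] [FiniteDimensional ℝ E]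
  [FiniteDimensional ℝ F]

/-- The map `(u, c) ↦ A u + c n` is injective, as pairing with `A u` isolates the positive term `B
(A u) (A u)`; the dimensions agree. Nothing is assumed about the sign of `B n n`. -/
theorem exists_eq_add_smul_of_orthogonal {A : F →L[ℝ] E}
    (hA : ∀ u, u ≠ 0 → 0 < B (A u) (A u)) (hdim : Module.finrank ℝ F + 1 = Module.finrank ℝ E)
    {n : E} (hn0 : n ≠ 0) (hn : ∀ u, B n (A u) = 0) (e : E) : ∃ u, ∃ c : ℝ, e = A u + c • n := by
  let L : F × ℝ →ₗ[ℝ] E :=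
    (A : F →ₗ[ℝ] E).comp (LinearMap.fst ℝ F ℝ) + (LinearMap.snd ℝ F ℝ).smulRight n
  have hLi : Function.Injective L := by
    rw [← LinearMap.ker_eq_bot, LinearMap.ker_eq_bot']
    rintro ⟨u, c⟩ h
    have h1 : A u + c • n = 0 := h
    have h2 : B (A u + c • n) (A u) = 0 := by rw [h1]; simp
    simp only [map_add, map_smul, add_apply, smul_apply, smul_eq_mul, hn, mul_zero, add_zero] at h2
    have hu : u = 0 := by
      by_contra hne
      exact (hA u hne).ne' h2
    subst hu
    rw [map_zero, zero_add] at h1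
    rcases smul_eq_zero.1 h1 with h3 | h3
    · rw [h3]; rfl
    · exact absurd h3 hn0
  have hLs : Function.Surjective L :=
    (LinearMap.injective_iff_surjective_of_finrank_eq_finrank (by simpa using hdim)).1 hLi
  obtain ⟨⟨u, c⟩, h⟩ := hLs e
  exact ⟨u, c, h.symm⟩

/-- A dimension count gives a nonzero vector `m` orthogonal to the hyperplane. It is timelike, since
otherwise decomposing `T` along the hyperplane and `m` would give `B T T ≥ 0`. The sign of the
normalized vector is fixed by pairing with `T`. -/
theorem IsLorentzForm.exists_unit_normal (hB : IsLorentzForm B) {A : F →L[ℝ] E}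
    (hA : ∀ u, u ≠ 0 → 0 < B (A u) (A u)) (hdim : Module.finrank ℝ F + 1 = Module.finrank ℝ E)
    {T : E} (hT : B T T < 0) :
    ∃ n : E, (∀ u, B n (A u) = 0) ∧ B n n = -1 ∧ B n T < 0 := by
  have hs := hB.1
  let L : E →ₗ[ℝ] (Module.Dual ℝ F) :=
    { toFun := fun e => ((B e).comp A : F →L[ℝ] ℝ)
      map_add' := fun a b => by ext; simp
      map_smul' := fun a b => by ext; simp }
  have hker : LinearMap.ker L ≠ ⊥ := by
    intro h
    have := LinearMap.finrank_le_finrank_of_injective (LinearMap.ker_eq_bot.1 h)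
    rw [Subspace.dual_finrank_eq] at this
    omega
  obtain ⟨m, hm, hm0⟩ := (Submodule.ne_bot_iff _).1 hker
  have hmA : ∀ u, B m (A u) = 0 := fun u => LinearMap.congr_fun (LinearMap.mem_ker.1 hm) u
  have hmm : B m m < 0 := by
    by_contra! hc
    obtain ⟨u, c, hTe⟩ := exists_eq_add_smul_of_orthogonal hA hdim hm0 hmA T
    have h1 : B T T = B (A u) (A u) + c ^ 2 * B m m := by
      rw [hTe]
      simp only [map_add, map_smul, add_apply, smul_apply, smul_eq_mul, hmA, hs (A u) m]
      ring
    have h2 : 0 ≤ B (A u) (A u) := by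
      rcases eq_or_ne u 0 with rfl | hu
      · simp
      · exact (hA u hu).le
    nlinarith [mul_nonneg (sq_nonneg c) hc]
  have hmT := hB.ne_zero_of_causal_of_timelike hT hmm.le hm0
  set r := Real.sqrt (-(B m m)) with hr
  have hrpos : 0 < r := Real.sqrt_pos.2 (by linarith)
  have hrr : r * r = -(B m m) := Real.mul_self_sqrt (by linarith)
  have key : ∀ ε : ℝ, ε * ε = 1 → ε * B m T < 0 →
      ∃ n : E, (∀ u, B n (A u) = 0) ∧ B n n = -1 ∧ B n T < 0 := by
    intro ε hε hεT
    refine ⟨(ε * r⁻¹) • m, fun u => ?_, ?_, ?_⟩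
    · simp [hmA]
    · simp only [map_smul, smul_apply, smul_eq_mul]
      have : B m m = -(r * r) := by linarith
      rw [this]
      field_simp
      linarith
    · simp only [map_smul, smul_apply, smul_eq_mul]
      have : ε * r⁻¹ * B m T = r⁻¹ * (ε * B m T) := by ring
      rw [this]
      exact mul_neg_of_pos_of_neg (inv_pos.2 hrpos) hεT
  rcases lt_or_gt_of_ne hmT with h | h
  · exact key 1 (by norm_num) (by linarith)
  · exact key (-1) (by norm_num) (by linarith)

theorem unit_normal_unique {A : F →L[ℝ] E}
    (hA : ∀ u, u ≠ 0 → 0 < B (A u) (A u)) (hdim : Module.finrank ℝ F + 1 = Module.finrank ℝ E)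
    {T : E} {n m : E} (hn : ∀ u, B n (A u) = 0) (hnn : B n n = -1)
    (hnT : B n T < 0) (hm : ∀ u, B m (A u) = 0) (hmm : B m m = -1) (hmT : B m T < 0) : m = n := by
  have hn0 : n ≠ 0 := by rintro rfl; simp at hnn
  obtain ⟨u, c, he⟩ := exists_eq_add_smul_of_orthogonal hA hdim hn0 hn m
  have h1 : B m (A u) = B (A u) (A u) := by
    rw [he]
    simp only [map_add, map_smul, add_apply, smul_apply, smul_eq_mul, hn]
    ring
  rw [hm] at h1
  have hu : u = 0 := by
    by_contra hne
    exact (hA u hne).ne h1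
  rw [hu, map_zero, zero_add] at he
  subst he
  simp only [map_smul, smul_apply, smul_eq_mul, hnn] at hmm hmT
  have hc : c = 1 := by
    have : (c - 1) * (c + 1) = 0 := by linarith
    rcases mul_eq_zero.1 this with h | h
    · linarith
    · have : c = -1 := by linarith
      subst this
      linarith
  rw [hc, one_smul]

end LorentzAlgebra

/-! ## Hamiltonian vector fields in coordinates -/

section CoordinateHamiltonian

variable {E : Type*} [NormedAddCommGroup E] [NormedSpace ℝ E]

/-- The Hamiltonian `½ g^{ab}(x) p_a p_b` of an inverse metric `Q` given in coordinates. -/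
noncomputable def coordHamiltonian (Q : E → (E →L[ℝ] ℝ) →L[ℝ] E) (z : E × (E →L[ℝ] ℝ)) : ℝ :=
  (1 / 2) * z.2 (Q z.1 z.2)

/-- The Hamiltonian vector field `(∂H/∂p, -∂H/∂x)` of `coordHamiltonian`. -/
noncomputable def coordSpray (Q : E → (E →L[ℝ] ℝ) →L[ℝ] E) (z : E × (E →L[ℝ] ℝ)) :
    E × (E →L[ℝ] ℝ) :=
  (Q z.1 z.2, -((1 / 2 : ℝ) • (z.2.comp ((fderiv ℝ Q z.1).flip z.2))))

variable {Q : E → (E →L[ℝ] ℝ) →L[ℝ] E}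

theorem coordSpray_snd_apply (z : E × (E →L[ℝ] ℝ)) (e : E) :
    (coordSpray Q z).2 e = -((1 / 2) * z.2 (fderiv ℝ Q z.1 e z.2)) := by
  simp [coordSpray]

/-- Homogeneity of a Hamiltonian quadratic in the momentum. It is the source of the affine
reparametrization of geodesics. -/
theorem coordSpray_smul (a : ℝ) (x : E) (p : E →L[ℝ] ℝ) :
    coordSpray Q (x, a • p) = (a • (coordSpray Q (x, p)).1, (a * a) • (coordSpray Q (x, p)).2) := by
  refine Prod.ext ?_ ?_
  · simp [coordSpray]
  · ext e
    simp only [coordSpray_snd_apply, smul_apply, map_smul, smul_eq_mul]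
    ring

theorem contDiffOn_coordSpray {Ω : Set E} (hΩ : IsOpen Ω) (hQ : ContDiffOn ℝ ∞ Q Ω) :
    ContDiffOn ℝ ∞ (coordSpray Q) (Ω ×ˢ univ) := by
  have hQ1 : ContDiffOn ℝ ∞ (fun z : E × (E →L[ℝ] ℝ) => Q z.1) (Ω ×ˢ univ) :=
    hQ.comp contDiff_fst.contDiffOn fun z hz => hz.1
  have hQ2 : ContDiffOn ℝ ∞ (fun z : E × (E →L[ℝ] ℝ) => (fderiv ℝ Q z.1).flip) (Ω ×ˢ univ) := by
    have h1 : ContDiffOn ℝ ∞ (fderiv ℝ Q) Ω := hQ.fderiv_of_isOpen hΩ (by simp)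
    have h2 : ContDiffOn ℝ ∞ (fun z : E × (E →L[ℝ] ℝ) => fderiv ℝ Q z.1) (Ω ×ˢ univ) :=
      h1.comp contDiff_fst.contDiffOn fun z hz => hz.1
    exact ((ContinuousLinearMap.flipₗᵢ ℝ E (E →L[ℝ] ℝ) E).contDiff.comp_contDiffOn h2)
  refine (hQ1.clm_apply contDiff_snd.contDiffOn).prodMk ?_
  exact ((contDiff_snd.contDiffOn.clm_comp (hQ2.clm_apply contDiff_snd.contDiffOn)).const_smul
    (1 / 2 : ℝ)).neg

theorem hasFDerivAt_coordHamiltonian {z : E × (E →L[ℝ] ℝ)} (hQ : DifferentiableAt ℝ Q z.1) :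
    ∃ D : E × (E →L[ℝ] ℝ) →L[ℝ] ℝ, HasFDerivAt (coordHamiltonian Q) D z ∧
      ∀ w, D w = (1 / 2) * (z.2 (fderiv ℝ Q z.1 w.1 z.2) + z.2 (Q z.1 w.2) + w.2 (Q z.1 z.2)) := by
  have h1 : HasFDerivAt (fun z : E × (E →L[ℝ] ℝ) => Q z.1)
      ((fderiv ℝ Q z.1).comp (ContinuousLinearMap.fst ℝ E (E →L[ℝ] ℝ))) z :=
    HasFDerivAt.comp (g := Q) z hQ.hasFDerivAt hasFDerivAt_fst
  have h2 := (ContinuousLinearMap.snd ℝ E (E →L[ℝ] ℝ)).hasFDerivAt (x := z)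
  have h3 := (h2.clm_apply (h1.clm_apply h2)).const_mul (1 / 2 : ℝ)
  refine ⟨_, h3, fun w => ?_⟩
  simp
  ring

theorem hasFDerivAt_coordSpray_fst {z : E × (E →L[ℝ] ℝ)} (hQ : DifferentiableAt ℝ Q z.1) :
    ∃ D : E × (E →L[ℝ] ℝ) →L[ℝ] E, HasFDerivAt (fun z => (coordSpray Q z).1) D z ∧
      ∀ w, D w = fderiv ℝ Q z.1 w.1 z.2 + Q z.1 w.2 := by
  have h1 : HasFDerivAt (fun z : E × (E →L[ℝ] ℝ) => Q z.1)
      ((fderiv ℝ Q z.1).comp (ContinuousLinearMap.fst ℝ E (E →L[ℝ] ℝ))) z :=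
    HasFDerivAt.comp (g := Q) z hQ.hasFDerivAt hasFDerivAt_fst
  have h2 := (ContinuousLinearMap.snd ℝ E (E →L[ℝ] ℝ)).hasFDerivAt (x := z)
  refine ⟨_, h1.clm_apply h2, fun w => ?_⟩
  simp [add_comm]

/-- The Hamiltonian is constant along integral curves of the Hamiltonian vector field. -/
theorem hasDerivAt_coordHamiltonian_zero {c : ℝ → E × (E →L[ℝ] ℝ)} {t : ℝ}
    (hsymm : ∀ p q : E →L[ℝ] ℝ, p (Q (c t).1 q) = q (Q (c t).1 p))
    (hQ : DifferentiableAt ℝ Q (c t).1) (hc : HasDerivAt c (coordSpray Q (c t)) t) :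
    HasDerivAt (fun s => coordHamiltonian Q (c s)) 0 t := by
  obtain ⟨D, hD, hDw⟩ := hasFDerivAt_coordHamiltonian (z := c t) hQ
  refine (hD.comp_hasDerivAt t hc).congr_deriv ?_
  rw [hDw, hsymm (c t).2, coordSpray_snd_apply]
  simp only [coordSpray]
  ring

/-- The flow of the Hamiltonian vector field of a quadratic Hamiltonian preserves the canonical
one-form along the zero level of the Hamiltonian. -/
theorem coordSpray_flow_preserves_oneForm {Ω : Set E} (hΩ : IsOpen Ω) (hQ : ContDiffOn ℝ ∞ Q Ω)
    (hsymm : ∀ x ∈ Ω, ∀ p q : E →L[ℝ] ℝ, p (Q x q) = q (Q x p))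
    {φ : (E × (E →L[ℝ] ℝ)) × ℝ → E × (E →L[ℝ] ℝ)} {U : Set (E × (E →L[ℝ] ℝ))} (hU : IsOpen U)
    {ε : ℝ} (hε : 0 < ε)
    (hφ : ContDiffOn ℝ ∞ φ (U ×ˢ Ioo (-ε) ε)) (hφ0 : ∀ z ∈ U, φ (z, 0) = z)
    (hφΩ : ∀ z ∈ U, ∀ t ∈ Ioo (-ε) ε, (φ (z, t)).1 ∈ Ω)
    (hφd : ∀ z ∈ U, ∀ t ∈ Ioo (-ε) ε, HasDerivAt (fun s => φ (z, s)) (coordSpray Q (φ (z, t))) t)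
    {Z : ℝ → E × (E →L[ℝ] ℝ)} {Z' : E × (E →L[ℝ] ℝ)} (hZ : HasDerivAt Z Z' 0) (hZU : Z 0 ∈ U)
    (hH : ∀ᶠ s in 𝓝 0, coordHamiltonian Q (Z s) = 0)
    {τ : ℝ → ℝ} {τ' : ℝ} (hτ : HasDerivAt τ τ' 0) (hτε : τ 0 ∈ Ioo (-ε) ε) :
    ∃ Y' : E × (E →L[ℝ] ℝ), HasDerivAt (fun s => φ (Z s, τ s)) Y' 0 ∧
      (φ (Z 0, τ 0)).2 Y'.1 = (Z 0).2 Z'.1 := by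
  set z := Z 0 with hz
  have hopen : IsOpen (U ×ˢ Ioo (-ε) ε) := hU.prod isOpen_Ioo
  have hφat : ∀ t ∈ Ioo (-ε) ε, ContDiffAt ℝ ∞ φ (z, t) := fun t ht =>
    hφ.contDiffAt (hopen.mem_nhds ⟨hZU, ht⟩)
  have hQd : ∀ x ∈ Ω, DifferentiableAt ℝ Q x := fun x hx =>
    (hQ.contDiffAt (hΩ.mem_nhds hx)).differentiableAt (by simp)
  have hfd : ∀ t ∈ Ioo (-ε) ε, DifferentiableAt ℝ (coordSpray Q) (φ (z, t)) := fun t ht =>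
    ((contDiffOn_coordSpray hΩ hQ).contDiffAt ((hΩ.prod isOpen_univ).mem_nhds
      ⟨hφΩ z hZU t ht, mem_univ _⟩)).differentiableAt (by simp)
  have hφfd : ∀ t ∈ Ioo (-ε) ε, HasFDerivAt φ (fderiv ℝ φ (z, t)) (z, t) := fun t ht =>
    ((hφat t ht).differentiableAt (by simp)).hasFDerivAt
  -- the time derivative of the flow as a partial derivative
  have hpartial : ∀ b ∈ U ×ˢ Ioo (-ε) ε, fderiv ℝ φ b (0, 1) = coordSpray Q (φ b) := by
    rintro ⟨y, t⟩ ⟨hy, ht⟩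
    have h1 : HasFDerivAt φ (fderiv ℝ φ (y, t)) (y, t) :=
      ((hφ.contDiffAt (hopen.mem_nhds ⟨hy, ht⟩)).differentiableAt (by simp)).hasFDerivAt
    have h2 : HasDerivAt (fun s : ℝ => (y, s)) ((0, 1) : (E × (E →L[ℝ] ℝ)) × ℝ) t :=
      (hasDerivAt_const t y).prodMk (hasDerivAt_id t)
    exact (h1.comp_hasDerivAt t h2).unique (hφd y hy t ht)
  let w : ℝ → E × (E →L[ℝ] ℝ) := fun t => fderiv ℝ φ (z, t) (Z', 0)
  have hw : ∀ t ∈ Ioo (-ε) ε, HasDerivAt w (fderiv ℝ (coordSpray Q) (φ (z, t)) (w t)) t := by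
    intro t ht
    have h1 : DifferentiableAt ℝ (fderiv ℝ φ) (z, t) :=
      ((hφat t ht).fderiv_right (m := 1) (WithTop.coe_le_coe.2 le_top)).differentiableAt (by simp)
    have h2 : HasDerivAt (fun s : ℝ => (z, s)) ((0, 1) : (E × (E →L[ℝ] ℝ)) × ℝ) t :=
      (hasDerivAt_const t z).prodMk (hasDerivAt_id t)
    have h3 := (h1.hasFDerivAt.comp_hasDerivAt t h2).clm_apply
      (hasDerivAt_const t ((Z', 0) : (E × (E →L[ℝ] ℝ)) × ℝ))
    refine h3.congr_deriv ?_
    simp only [map_zero, add_zero]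
    have hsy : fderiv ℝ (fderiv ℝ φ) (z, t) (0, 1) (Z', 0)
        = fderiv ℝ (fderiv ℝ φ) (z, t) (Z', 0) (0, 1) :=
      ((hφat t ht).isSymmSndFDerivAt (by simpa using ENat.LEInfty.out)).eq _ _
    rw [hsy]
    have h4 : HasFDerivAt (fun b => fderiv ℝ φ b (0, 1))
        ((fderiv ℝ (coordSpray Q) (φ (z, t))).comp (fderiv ℝ φ (z, t))) (z, t) := by
      refine ((hfd t ht).hasFDerivAt.comp (z, t) (hφfd t ht)).congr_of_eventuallyEq ?_
      filter_upwards [hopen.mem_nhds (⟨hZU, ht⟩ : (z, t) ∈ U ×ˢ Ioo (-ε) ε)] with b hb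
      exact hpartial b hb
    have h5 := (h1.hasFDerivAt.clm_apply
      (hasFDerivAt_const ((0, 1) : (E × (E →L[ℝ] ℝ)) × ℝ) (z, t))).unique h4
    have h6 := DFunLike.congr_fun h5 (Z', 0)
    simpa using h6
  -- conservation of the Hamiltonian
  have hcons : ∀ y ∈ U, ∀ t ∈ Ioo (-ε) ε,
      coordHamiltonian Q (φ (y, t)) = coordHamiltonian Q y := by
    intro y hy t ht
    have h0 : (0 : ℝ) ∈ Ioo (-ε) ε := by simpa using hε
    have hd : ∀ s ∈ Ioo (-ε) ε, HasDerivAt (fun s => coordHamiltonian Q (φ (y, s))) 0 s :=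
      fun s hs => hasDerivAt_coordHamiltonian_zero (c := fun s => φ (y, s))
        (hsymm _ (hφΩ y hy s hs)) (hQd _ (hφΩ y hy s hs)) (hφd y hy s hs)
    have := isOpen_Ioo.is_const_of_deriv_eq_zero isPreconnected_Ioo
      (fun s hs => (hd s hs).differentiableAt.differentiableWithinAt)
      (fun s hs => (hd s hs).deriv) ht h0
    rw [this, hφ0 y hy]
  -- The transported curve stays in the zero level of the Hamiltonian, so `dH` vanishes on its
  -- velocity `w`.
  have hDH : ∀ t ∈ Ioo (-ε) ε, ∀ D : E × (E →L[ℝ] ℝ) →L[ℝ] ℝ,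
      HasFDerivAt (coordHamiltonian Q) D (φ (z, t)) → D (w t) = 0 := by
    intro t ht D hD
    have h2 : HasDerivAt (fun s => (Z s, t)) ((Z', 0) : (E × (E →L[ℝ] ℝ)) × ℝ) 0 :=
      hZ.prodMk (hasDerivAt_const 0 t)
    have h3 : HasDerivAt (fun s => φ (Z s, t)) (w t) 0 := (hφfd t ht).comp_hasDerivAt 0 h2
    have h4 : HasDerivAt (fun s => coordHamiltonian Q (φ (Z s, t))) (D (w t)) 0 :=
      HasFDerivAt.comp_hasDerivAt (f := fun s => φ (Z s, t)) 0 hD h3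
    have h5 : (fun s => coordHamiltonian Q (φ (Z s, t))) =ᶠ[𝓝 0] fun _ => 0 := by
      filter_upwards [hH, hZ.continuousAt.eventually_mem (hU.mem_nhds hZU)] with s hs hsU
      rw [hcons _ hsU t ht, hs]
    exact h4.unique ((hasDerivAt_const 0 (0 : ℝ)).congr_of_eventuallyEq h5)
  -- Cartan's formula in coordinates: the Lie derivative of `p dx` along the spray is `d(2H) - dH =
  -- dH`. Hence the derivative of `θ` is `dH(w) = 0`.
  let θ : ℝ → ℝ := fun t => (φ (z, t)).2 (w t).1
  have hθ : ∀ t ∈ Ioo (-ε) ε, HasDerivAt θ 0 t := by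
    intro t ht
    have hx : (φ (z, t)).1 ∈ Ω := hφΩ z hZU t ht
    have h1 : HasDerivAt (fun s => (φ (z, s)).2) (coordSpray Q (φ (z, t))).2 t :=
      (hφd z hZU t ht).snd
    obtain ⟨D₁, hD₁, hD₁w⟩ := hasFDerivAt_coordSpray_fst (z := φ (z, t)) (hQd _ hx)
    obtain ⟨D, hD, hDw⟩ := hasFDerivAt_coordHamiltonian (z := φ (z, t)) (hQd _ hx)
    have h2 : (fderiv ℝ (coordSpray Q) (φ (z, t)) (w t)).1 = D₁ (w t) := by
      have := ((hfd t ht).hasFDerivAt.fst).unique hD₁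
      rw [← this]
      rfl
    have h3 := h1.clm_apply ((hw t ht).fst)
    refine h3.congr_deriv ?_
    rw [h2, hD₁w, coordSpray_snd_apply]
    have h4 := hDH t ht D hD
    rw [hDw] at h4
    have h5 := hsymm _ hx (φ (z, t)).2 (w t).2
    rw [map_add]
    linarith
  have h0 : (0 : ℝ) ∈ Ioo (-ε) ε := by simpa using hε
  have hconst := isOpen_Ioo.is_const_of_deriv_eq_zero isPreconnected_Ioo
      (fun s hs => (hθ s hs).differentiableAt.differentiableWithinAt)
      (fun s hs => (hθ s hs).deriv) hτε h0
  have hw0 : w 0 = Z' := by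
    have h2 : HasDerivAt (fun s => (Z s, (0 : ℝ))) ((Z', 0) : (E × (E →L[ℝ] ℝ)) × ℝ) 0 :=
      hZ.prodMk (hasDerivAt_const 0 0)
    have h3 : HasDerivAt (fun s => φ (Z s, 0)) (w 0) 0 :=
      HasFDerivAt.comp_hasDerivAt (f := fun s => (Z s, (0 : ℝ))) 0 (hφfd 0 h0) h2
    refine h3.unique (hZ.congr_of_eventuallyEq ?_)
    filter_upwards [hZ.continuousAt.eventually_mem (hU.mem_nhds hZU)] with s hsU
    exact hφ0 _ hsU
  refine ⟨fderiv ℝ φ (z, τ 0) (Z', τ'), (hφfd _ hτε).comp_hasDerivAt 0 (hZ.prodMk hτ), ?_⟩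
  -- A varying flow time adds `τ'` times the Hamiltonian field to the velocity, and `p dx` takes the
  -- value `2H = 0` on that field.
  have hsplit : ((Z', τ') : (E × (E →L[ℝ] ℝ)) × ℝ) = (Z', 0) + τ' • (0, 1) := by simp
  rw [hsplit, map_add, map_smul, hpartial _ ⟨hZU, hτε⟩]
  have hnull : (φ (z, τ 0)).2 (Q (φ (z, τ 0)).1 (φ (z, τ 0)).2) = 0 := by
    have h1 := hcons z hZU _ hτε
    rw [hH.self_of_nhds, coordHamiltonian] at h1
    linarith
  have h1 : θ (τ 0) = z.2 Z'.1 := by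
    rw [hconst]
    simp only [θ, hw0, hφ0 z hZU]
  have h2 : (φ (z, τ 0)).2 ((w (τ 0)).1 + τ' • Q (φ (z, τ 0)).1 (φ (z, τ 0)).2) = z.2 Z'.1 := by
    rw [map_add, map_smul, hnull, smul_zero, add_zero]
    exact h1
  exact h2

/-- The lift of a change of coordinates to the cotangent bundle is symplectic. -/
theorem cotangent_lift_symplectic {ψ : E → E} {R : E × (E →L[ℝ] ℝ) → E →L[ℝ] ℝ}
    {z : E × (E →L[ℝ] ℝ)} {R' : E × (E →L[ℝ] ℝ) →L[ℝ] E →L[ℝ] ℝ}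
    (hψ : ContDiffAt ℝ 2 ψ z.1) (hR : HasFDerivAt R R' z)
    (h : ∀ᶠ y in 𝓝 z, (R y).comp (fderiv ℝ ψ y.1) = y.2) (v w : E × (E →L[ℝ] ℝ)) :
    R' v (fderiv ℝ ψ z.1 w.1) - R' w (fderiv ℝ ψ z.1 v.1) = v.2 w.1 - w.2 v.1 := by
  have h1 : DifferentiableAt ℝ (fderiv ℝ ψ) z.1 :=
    (hψ.fderiv_right (m := 1) (by norm_num)).differentiableAt (by simp)
  have h2 : HasFDerivAt (fun y : E × (E →L[ℝ] ℝ) => fderiv ℝ ψ y.1)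
      ((fderiv ℝ (fderiv ℝ ψ) z.1).comp (ContinuousLinearMap.fst ℝ E (E →L[ℝ] ℝ))) z :=
    HasFDerivAt.comp (g := fderiv ℝ ψ) z h1.hasFDerivAt hasFDerivAt_fst
  have h3 := hR.clm_comp h2
  have h4 : HasFDerivAt (fun y : E × (E →L[ℝ] ℝ) => y.2) _ z := h3.congr_of_eventuallyEq
    (h.mono fun y hy => hy.symm)
  have h5 := h4.unique ((ContinuousLinearMap.snd ℝ E (E →L[ℝ] ℝ)).hasFDerivAt (x := z))
  -- The derivative of the relation `R ∘ Dψ = p`. Its second-order term in `ψ` is symmetric and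
  -- cancels on antisymmetrization.
  have h6 : ∀ a b : E × (E →L[ℝ] ℝ), R z (fderiv ℝ (fderiv ℝ ψ) z.1 a.1 b.1)
      + R' a (fderiv ℝ ψ z.1 b.1) = a.2 b.1 := by
    intro a b
    have := DFunLike.congr_fun (DFunLike.congr_fun h5 a) b.1
    simpa using this
  have h7 : fderiv ℝ (fderiv ℝ ψ) z.1 v.1 w.1 = fderiv ℝ (fderiv ℝ ψ) z.1 w.1 v.1 :=
    (hψ.isSymmSndFDerivAt (by simp)).eq _ _
  have h8 := h6 v w
  have h9 := h6 w v
  rw [h7] at h8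
  linarith

end CoordinateHamiltonian

/-! ## A differential inequality -/

/-- If `y' = w` with `y` bounded and `|w'| ≤ C w²`, then a positive `w` stays bounded and bounded
away from zero. -/
theorem bounds_of_abs_deriv_le_mul_sq {D : Set ℝ} (hD : Convex ℝ D) {t₀ : ℝ} (ht₀ : t₀ ∈ D)
    (hmin : ∀ t ∈ D, t₀ ≤ t) {y w w' : ℝ → ℝ} {C Y : ℝ}
    (hy : ∀ t ∈ D, HasDerivAt y (w t) t) (hw : ∀ t ∈ D, HasDerivAt w (w' t) t)
    (hC : 0 ≤ C) (hw' : ∀ t ∈ D, |w' t| ≤ C * w t ^ 2) (hpos : ∀ t ∈ D, 0 < w t)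
    (hY : ∀ t ∈ D, |y t - y t₀| ≤ Y) :
    ∀ t ∈ D, w t₀ * Real.exp (-(C * Y)) ≤ w t ∧ w t ≤ w t₀ * Real.exp (C * Y) := by
  -- Since `y' = w`, this factor contributes `c w²` to the derivative. For `c = -C` the product is
  -- decreasing and for `c = C` increasing.
  have key : ∀ c : ℝ, ∀ t ∈ D, HasDerivAt (fun s => w s * Real.exp (c * (y s - y t₀)))
      ((w' t + c * w t ^ 2) * Real.exp (c * (y t - y t₀))) t := by
    intro c t ht
    refine ((hw t ht).mul (((hy t ht).sub_const (y t₀)).const_mul c).exp).congr_deriv ?_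
    ring
  intro t ht
  have hE : ∀ c : ℝ, |c| = C → Real.exp (c * (y t - y t₀)) ≤ Real.exp (C * Y) := by
    intro c hc
    refine Real.exp_le_exp.2 ((le_abs_self _).trans ?_)
    rw [abs_mul, hc]
    exact mul_le_mul_of_nonneg_left (hY t ht) hC
  have hanti : AntitoneOn (fun s => w s * Real.exp (-C * (y s - y t₀))) D := by
    refine antitoneOn_of_deriv_nonpos hD
      (fun s hs => (key (-C) s hs).continuousAt.continuousWithinAt)
      (fun s hs => (key (-C) s (interior_subset hs)).differentiableAt.differentiableWithinAt) ?_
    intro s hs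
    rw [(key (-C) s (interior_subset hs)).deriv]
    refine mul_nonpos_of_nonpos_of_nonneg ?_ (Real.exp_pos _).le
    have := (abs_le.1 (hw' s (interior_subset hs))).2
    linarith
  have hmono : MonotoneOn (fun s => w s * Real.exp (C * (y s - y t₀))) D := by
    refine monotoneOn_of_deriv_nonneg hD
      (fun s hs => (key C s hs).continuousAt.continuousWithinAt)
      (fun s hs => (key C s (interior_subset hs)).differentiableAt.differentiableWithinAt) ?_
    intro s hs
    rw [(key C s (interior_subset hs)).deriv]
    refine mul_nonneg ?_ (Real.exp_pos _).le
    have := (abs_le.1 (hw' s (interior_subset hs))).1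
    linarith
  have h1 := hanti ht₀ ht (hmin t ht)
  have h2 := hmono ht₀ ht (hmin t ht)
  simp only [sub_self, mul_zero, Real.exp_zero, mul_one] at h1 h2
  have hp := hpos t ht
  constructor
  · rw [Real.exp_neg, ← div_eq_mul_inv, div_le_iff₀ (Real.exp_pos _)]
    exact h2.trans (mul_le_mul_of_nonneg_left (hE C (abs_of_nonneg hC)) hp.le)
  · have h3 : w t = w t * Real.exp (-C * (y t - y t₀)) * Real.exp (C * (y t - y t₀)) := by
      rw [mul_assoc, ← Real.exp_add]
      simp
    rw [h3]
    exact mul_le_mul h1 (hE C (abs_of_nonneg hC)) (Real.exp_pos _).le (hpos _ ht₀).le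

/-! ## Natural coordinates on the cotangent bundle -/

section NaturalCoordinates

variable {E : Type*} [NormedAddCommGroup E] [NormedSpace ℝ E]
  {M : Type*} [TopologicalSpace M] [ChartedSpace E M] [IsManifold 𝓘(ℝ, E) ∞ M]

/-- The natural coordinates of `T*M` induced by the preferred chart at `x₀`. -/
noncomputable def natChart (x₀ : M) : PartialEquiv (CotangentBundle E M) (E × (E →L[ℝ] ℝ)) :=
  extChartAt (cotangentModel E) (⟨x₀, 0⟩ : CotangentBundle E M)

/-- The differential of the preferred chart at `x₀`. -/
noncomputable def chartDeriv (x₀ x : M) : TangentSpace 𝓘(ℝ, E) x →L[ℝ] E :=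
  mfderiv 𝓘(ℝ, E) 𝓘(ℝ, E) (extChartAt 𝓘(ℝ, E) x₀) x

variable {x₀ : M}

theorem mem_natChart_source {q : CotangentBundle E M} :
    q ∈ (natChart x₀).source ↔ q.proj ∈ (chartAt E x₀).source := by
  rw [natChart, FiberBundle.extChartAt]
  simp only [PartialEquiv.trans_source, mem_inter_iff, mem_preimage, PartialEquiv.prod_source,
    PartialEquiv.refl_source, mem_prod, mem_univ, and_true]
  change (q.proj ∈ (chartAt E x₀).source ∩ univ ∧ q.proj ∈ (extChartAt 𝓘(ℝ, E) x₀).source) ↔ _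
  simp

theorem natChart_target :
    (natChart x₀ : PartialEquiv (CotangentBundle E M) _).target
      = (extChartAt 𝓘(ℝ, E) x₀).target ×ˢ univ := by
  rw [natChart, FiberBundle.extChartAt_target]
  congr 1
  rw [inter_eq_left]
  intro y hy
  simpa using (extChartAt 𝓘(ℝ, E) x₀).map_target hy

theorem natChart_fst (q : CotangentBundle E M) :
    (natChart x₀ q).1 = extChartAt 𝓘(ℝ, E) x₀ q.proj := by
  rw [natChart, FiberBundle.extChartAt]
  rfl

theorem chartDeriv_isInvertible {x : M} (hx : x ∈ (chartAt E x₀).source) :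
    (chartDeriv x₀ x : TangentSpace 𝓘(ℝ, E) x →L[ℝ] E).IsInvertible :=
  isInvertible_mfderiv_extChartAt (by simpa using hx)

theorem symmL_chartDeriv {x : M} (hx : x ∈ (chartAt E x₀).source)
    (u : TangentSpace 𝓘(ℝ, E) x) :
    (trivializationAt E (fun x : M => TangentSpace 𝓘(ℝ, E) x) x₀).symmL ℝ x
      (chartDeriv x₀ x u) = u := by
  have h : chartDeriv x₀ x = (trivializationAt E (fun x : M => TangentSpace 𝓘(ℝ, E) x) x₀).continuousLinearMapAt ℝ x :=
    (TangentBundle.continuousLinearMapAt_trivializationAt (I := 𝓘(ℝ, E)) hx).symm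
  rw [h]
  exact (trivializationAt E (fun x : M => TangentSpace 𝓘(ℝ, E) x) x₀).symmL_continuousLinearMapAt (by simpa using hx) u

/-- The momentum coordinates are determined by invariance of the pairing of covectors with vectors.
Later arguments use this characterization instead of the trivializations. -/
theorem natChart_snd {q : CotangentBundle E M} (hq : q.proj ∈ (chartAt E x₀).source)
    (u : TangentSpace 𝓘(ℝ, E) q.proj) :
    (natChart x₀ q).2 (chartDeriv x₀ q.proj u) = q.2 u := by
  have h : (natChart x₀ q).2 = q.2.comp
      ((trivializationAt E (fun x : M => TangentSpace 𝓘(ℝ, E) x) x₀).symmL ℝ q.proj) := by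
    rw [natChart, FiberBundle.extChartAt]
    change ContinuousLinearMap.inCoordinates E (TangentSpace 𝓘(ℝ, E)) ℝ (Bundle.Trivial M ℝ)
      x₀ q.proj x₀ q.proj q.2 = _
    ext u
    simp [ContinuousLinearMap.inCoordinates]
  rw [h]
  exact congrArg q.2 (symmL_chartDeriv hq u)

theorem natChart_symm_proj {z : E × (E →L[ℝ] ℝ)} (hz : z.1 ∈ (extChartAt 𝓘(ℝ, E) x₀).target) :
    ((natChart x₀).symm z).proj = (extChartAt 𝓘(ℝ, E) x₀).symm z.1 := by
  have hz' : z ∈ (natChart x₀ : PartialEquiv (CotangentBundle E M) _).target := by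
    rw [natChart_target]; exact ⟨hz, mem_univ _⟩
  have h1 := congrArg Prod.fst ((natChart x₀).right_inv hz')
  rw [natChart_fst] at h1
  have h2 := (natChart x₀).map_target hz'
  rw [mem_natChart_source] at h2
  rw [← h1, (extChartAt 𝓘(ℝ, E) x₀).left_inv (by simpa using h2)]

theorem natChart_symm_mem {z : E × (E →L[ℝ] ℝ)} (hz : z.1 ∈ (extChartAt 𝓘(ℝ, E) x₀).target) :
    ((natChart x₀).symm z).proj ∈ (chartAt E x₀).source := by
  rw [natChart_symm_proj hz]
  simpa using (extChartAt 𝓘(ℝ, E) x₀).map_target hz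

theorem natChart_right_inv {z : E × (E →L[ℝ] ℝ)} (hz : z.1 ∈ (extChartAt 𝓘(ℝ, E) x₀).target) :
    natChart x₀ ((natChart x₀).symm z) = z :=
  (natChart x₀).right_inv (by rw [natChart_target]; exact ⟨hz, mem_univ _⟩)

theorem natChart_left_inv {q : CotangentBundle E M} (hq : q.proj ∈ (chartAt E x₀).source) :
    (natChart x₀).symm (natChart x₀ q) = q :=
  (natChart x₀).left_inv (mem_natChart_source.2 hq)

theorem natChart_fst_mem {q : CotangentBundle E M} (hq : q.proj ∈ (chartAt E x₀).source) :
    (natChart x₀ q).1 ∈ (extChartAt 𝓘(ℝ, E) x₀).target := by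
  rw [natChart_fst]
  exact (extChartAt 𝓘(ℝ, E) x₀).map_source (by simpa using hq)

theorem contMDiffAt_natChart {q : CotangentBundle E M} (hq : q.proj ∈ (chartAt E x₀).source) :
    ContMDiffAt (cotangentModel E) 𝓘(ℝ, E × (E →L[ℝ] ℝ)) ∞ (natChart x₀) q := by
  refine contMDiffAt_extChartAt' (I := cotangentModel E) ?_
  have h := mem_natChart_source.2 hq
  rwa [natChart, extChartAt_source] at h

theorem contMDiffAt_natChart_symm {z : E × (E →L[ℝ] ℝ)}
    (hz : z.1 ∈ (extChartAt 𝓘(ℝ, E) x₀).target) :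
    ContMDiffAt 𝓘(ℝ, E × (E →L[ℝ] ℝ)) (cotangentModel E) ∞
      ((natChart x₀).symm : _ → CotangentBundle E M) z := by
  have hz' : z ∈ (natChart x₀ : PartialEquiv (CotangentBundle E M) _).target := by
    rw [natChart_target]; exact ⟨hz, mem_univ _⟩
  have ho : IsOpen (natChart x₀ : PartialEquiv (CotangentBundle E M) _).target :=
    isOpen_extChartAt_target (I := cotangentModel E) _
  exact (contMDiffOn_extChartAt_symm (I := cotangentModel E)
    (⟨x₀, 0⟩ : CotangentBundle E M)).contMDiffAt (ho.mem_nhds hz')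

theorem eventually_mem_chart {q : CotangentBundle E M} (hq : q.proj ∈ (chartAt E x₀).source) :
    ∀ᶠ r in 𝓝 q, r.proj ∈ (chartAt E x₀).source :=
  (FiberBundle.continuous_proj (E →L[ℝ] ℝ)
    (fun x : M => TangentSpace 𝓘(ℝ, E) x →L[ℝ] ℝ)).continuousAt.eventually_mem
      ((chartAt E x₀).open_source.mem_nhds hq)

theorem mdifferentiableAt_natChart {q : CotangentBundle E M}
    (hq : q.proj ∈ (chartAt E x₀).source) :
    MDifferentiableAt (cotangentModel E) 𝓘(ℝ, E × (E →L[ℝ] ℝ)) (natChart x₀) q :=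
  (contMDiffAt_natChart hq).mdifferentiableAt (by simp)

/-- The differential of natural coordinates. -/
noncomputable def natChartDeriv (x₀ : M) (q : CotangentBundle E M) :
    TangentSpace (cotangentModel E) q →L[ℝ] E × (E →L[ℝ] ℝ) :=
  mfderiv (cotangentModel E) 𝓘(ℝ, E × (E →L[ℝ] ℝ)) (natChart x₀) q

theorem hasMFDerivAt_natChart {q : CotangentBundle E M} (hq : q.proj ∈ (chartAt E x₀).source) :
    HasMFDerivAt (cotangentModel E) 𝓘(ℝ, E × (E →L[ℝ] ℝ)) (natChart x₀) q (natChartDeriv x₀ q) :=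
  (mdifferentiableAt_natChart hq).hasMFDerivAt

theorem natChartDeriv_isInvertible {q : CotangentBundle E M}
    (hq : q.proj ∈ (chartAt E x₀).source) : (natChartDeriv x₀ q).IsInvertible :=
  isInvertible_mfderiv_extChartAt (I := cotangentModel E) (mem_natChart_source.2 hq)

/-- The preferred chart of `T*M` depends only on the base point, so the one at `q` is the one at the
zero covector over `q.proj`. -/
theorem naturalComponents_eq (q : CotangentBundle E M) (w : TangentSpace (cotangentModel E) q) :
    naturalComponents q w = natChartDeriv q.proj q w := by
  have : (natChart q.proj : PartialEquiv (CotangentBundle E M) _)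
      = extChartAt (cotangentModel E) q := by
    rw [natChart, FiberBundle.extChartAt, FiberBundle.extChartAt]
  rw [naturalComponents, natChartDeriv, this]
  rfl

theorem hasMFDerivAt_extChartAt_base {x : M} (hx : x ∈ (chartAt E x₀).source) :
    HasMFDerivAt 𝓘(ℝ, E) 𝓘(ℝ, E) (extChartAt 𝓘(ℝ, E) x₀) x (chartDeriv x₀ x) :=
  (mdifferentiableAt_extChartAt hx).hasMFDerivAt

theorem natChartDeriv_fst {q : CotangentBundle E M} (hq : q.proj ∈ (chartAt E x₀).source)
    (w : TangentSpace (cotangentModel E) q) :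
    (natChartDeriv x₀ q w).1 = chartDeriv x₀ q.proj (mfderiv (cotangentModel E) 𝓘(ℝ, E)
      (fun r : CotangentBundle E M => r.proj) q w) := by
  have h1 : HasMFDerivAt (cotangentModel E) 𝓘(ℝ, E) (fun r => (natChart x₀ r).1) q
      ((ContinuousLinearMap.fst ℝ E (E →L[ℝ] ℝ)).comp (natChartDeriv x₀ q)) :=
    ((ContinuousLinearMap.fst ℝ E (E →L[ℝ] ℝ)).hasMFDerivAt (x := natChart x₀ q)).comp q
      (hasMFDerivAt_natChart hq)
  have h2 : HasMFDerivAt (cotangentModel E) 𝓘(ℝ, E)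
      (extChartAt 𝓘(ℝ, E) x₀ ∘ (fun r : CotangentBundle E M => r.proj)) q _ :=
    (hasMFDerivAt_extChartAt_base hq).comp q
      (((Bundle.contMDiff_proj (n := ∞) (IB := 𝓘(ℝ, E)) (F := E →L[ℝ] ℝ)
        (fun x : M => TangentSpace 𝓘(ℝ, E) x →L[ℝ] ℝ)).mdifferentiableAt
          (by simp)).hasMFDerivAt)
  have h3 : (fun r => (natChart x₀ r).1)
      = extChartAt 𝓘(ℝ, E) x₀ ∘ (fun r : CotangentBundle E M => r.proj) := by
    funext r; exact natChart_fst r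
  rw [h3] at h1
  exact DFunLike.congr_fun (hasMFDerivAt_unique h1 h2) w

theorem canonicalOneForm_eq {q : CotangentBundle E M} (hq : q.proj ∈ (chartAt E x₀).source)
    (w : TangentSpace (cotangentModel E) q) :
    canonicalOneForm q w = (natChart x₀ q).2 (natChartDeriv x₀ q w).1 := by
  rw [natChartDeriv_fst hq, natChart_snd hq]
  rfl

end NaturalCoordinates

/-! ### Changes of natural coordinates -/

section ChartChange

variable {E : Type*} [NormedAddCommGroup E] [NormedSpace ℝ E]
  {M : Type*} [TopologicalSpace M] [ChartedSpace E M] [IsManifold 𝓘(ℝ, E) ∞ M]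

theorem contDiffAt_chart_change {x₀ x₁ x : M} (h₀ : x ∈ (chartAt E x₀).source)
    (h₁ : x ∈ (chartAt E x₁).source) :
    ContDiffAt ℝ ∞ (extChartAt 𝓘(ℝ, E) x₁ ∘ (extChartAt 𝓘(ℝ, E) x₀).symm)
      (extChartAt 𝓘(ℝ, E) x₀ x) := by
  rw [← contMDiffAt_iff_contDiffAt]
  have hx : (extChartAt 𝓘(ℝ, E) x₀).symm (extChartAt 𝓘(ℝ, E) x₀ x) = x :=
    (extChartAt 𝓘(ℝ, E) x₀).left_inv (by simpa using h₀)
  have ht : extChartAt 𝓘(ℝ, E) x₀ x ∈ (extChartAt 𝓘(ℝ, E) x₀).target :=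
    (extChartAt 𝓘(ℝ, E) x₀).map_source (by simpa using h₀)
  refine ContMDiffAt.comp _ (I' := 𝓘(ℝ, E)) ?_ ((contMDiffOn_extChartAt_symm x₀).contMDiffAt
    ((isOpen_extChartAt_target x₀).mem_nhds ht))
  rw [hx]
  exact contMDiffAt_extChartAt' h₁

theorem chartDeriv_change {x₀ x₁ x : M} (h₀ : x ∈ (chartAt E x₀).source)
    (h₁ : x ∈ (chartAt E x₁).source) (u : TangentSpace 𝓘(ℝ, E) x) :
    chartDeriv x₁ x u = fderiv ℝ (extChartAt 𝓘(ℝ, E) x₁ ∘ (extChartAt 𝓘(ℝ, E) x₀).symm)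
      (extChartAt 𝓘(ℝ, E) x₀ x) (chartDeriv x₀ x u) := by
  have h2 : HasMFDerivAt 𝓘(ℝ, E) 𝓘(ℝ, E)
      ((extChartAt 𝓘(ℝ, E) x₁ ∘ (extChartAt 𝓘(ℝ, E) x₀).symm) ∘ extChartAt 𝓘(ℝ, E) x₀) x _ :=
    HasMFDerivAt.comp x ((contDiffAt_chart_change h₀ h₁).differentiableAt
      (by simp)).hasFDerivAt.hasMFDerivAt (hasMFDerivAt_extChartAt_base h₀)
  have h3 := (hasMFDerivAt_extChartAt_base h₁).congr_of_eventuallyEq (f₁ :=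
      (extChartAt 𝓘(ℝ, E) x₁ ∘ (extChartAt 𝓘(ℝ, E) x₀).symm) ∘ extChartAt 𝓘(ℝ, E) x₀) (by
    filter_upwards [(chartAt E x₀).open_source.mem_nhds h₀] with y hy
    have : (extChartAt 𝓘(ℝ, E) x₀).symm (extChartAt 𝓘(ℝ, E) x₀ y) = y :=
      (extChartAt 𝓘(ℝ, E) x₀).left_inv (by simpa using hy)
    simp only [Function.comp_apply, this])
  exact DFunLike.congr_fun (hasMFDerivAt_unique h3 h2) u

theorem contDiffAt_natChart_change {x₀ x₁ : M} {q : CotangentBundle E M}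
    (h₀ : q.proj ∈ (chartAt E x₀).source) (h₁ : q.proj ∈ (chartAt E x₁).source) :
    ContDiffAt ℝ ∞ (natChart x₁ ∘ (natChart x₀ : PartialEquiv (CotangentBundle E M) _).symm)
      (natChart x₀ q) := by
  rw [← contMDiffAt_iff_contDiffAt]
  refine ContMDiffAt.comp _ (I' := cotangentModel E) ?_
    (contMDiffAt_natChart_symm (natChart_fst_mem h₀))
  rw [natChart_left_inv h₀]
  exact contMDiffAt_natChart h₁

theorem natChartDeriv_change {x₀ x₁ : M} {q : CotangentBundle E M}
    (h₀ : q.proj ∈ (chartAt E x₀).source) (h₁ : q.proj ∈ (chartAt E x₁).source)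
    (u : TangentSpace (cotangentModel E) q) :
    natChartDeriv x₁ q u
      = fderiv ℝ (natChart x₁ ∘ (natChart x₀ : PartialEquiv (CotangentBundle E M) _).symm)
      (natChart x₀ q) (natChartDeriv x₀ q u) := by
  have h2 : HasMFDerivAt (cotangentModel E) 𝓘(ℝ, E × (E →L[ℝ] ℝ))
      ((natChart x₁ ∘ (natChart x₀ : PartialEquiv (CotangentBundle E M) _).symm) ∘ natChart x₀) q _ :=
    HasMFDerivAt.comp q ((contDiffAt_natChart_change h₀ h₁).differentiableAt
      (by simp)).hasFDerivAt.hasMFDerivAt (hasMFDerivAt_natChart h₀)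
  have h3 := (hasMFDerivAt_natChart h₁).congr_of_eventuallyEq (f₁ :=
      (natChart x₁ ∘ (natChart x₀ : PartialEquiv (CotangentBundle E M) _).symm) ∘ natChart x₀) (by
    filter_upwards [eventually_mem_chart h₀] with y hy
    simp only [Function.comp_apply, natChart_left_inv hy])
  exact DFunLike.congr_fun (hasMFDerivAt_unique h3 h2) u

/-- The symplectic form is `dp_a ∧ dx^a` in all natural coordinates. -/
theorem canonicalTwoForm_eq {x₀ : M} {q : CotangentBundle E M}
    (h₀ : q.proj ∈ (chartAt E x₀).source) (v w : TangentSpace (cotangentModel E) q) :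
    canonicalTwoForm q v w = (natChartDeriv x₀ q v).2 (natChartDeriv x₀ q w).1
      - (natChartDeriv x₀ q w).2 (natChartDeriv x₀ q v).1 := by
  have h₁ : q.proj ∈ (chartAt E q.proj).source := mem_chart_source E q.proj
  set x₁ := q.proj with hx₁
  set T := natChart x₁ ∘ (natChart x₀ : PartialEquiv (CotangentBundle E M) _).symm with hT
  set ψ := extChartAt 𝓘(ℝ, E) x₁ ∘ (extChartAt 𝓘(ℝ, E) x₀).symm with hψ
  set z := natChart x₀ q with hz
  have hz1 : z.1 = extChartAt 𝓘(ℝ, E) x₀ x₁ := natChart_fst q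
  have hTd : HasFDerivAt T (fderiv ℝ T z) z :=
    ((contDiffAt_natChart_change h₀ h₁).differentiableAt (by simp)).hasFDerivAt
  have hψc : ContDiffAt ℝ ∞ ψ z.1 := by rw [hz1]; exact contDiffAt_chart_change h₀ h₁
  have hnear : ∀ᶠ y in 𝓝 z, ∃ r : CotangentBundle E M, r.proj ∈ (chartAt E x₀).source ∧
      r.proj ∈ (chartAt E x₁).source ∧ natChart x₀ r = y ∧ (natChart x₀).symm y = r := by
    have hct := (contMDiffAt_natChart_symm (M := M) (natChart_fst_mem h₀)).continuousAt
    have hzt := (isOpen_extChartAt_target (I := 𝓘(ℝ, E)) x₀).mem_nhds (natChart_fst_mem h₀)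
    have hev : ∀ᶠ r in 𝓝 ((natChart x₀).symm (natChart x₀ q)), r.proj ∈ (chartAt E x₁).source := by
      rw [natChart_left_inv h₀]; exact eventually_mem_chart h₁
    filter_upwards [hct.eventually hev, continuousAt_fst.eventually_mem hzt] with y hy hyt
    exact ⟨(natChart x₀).symm y, natChart_symm_mem hyt, hy, natChart_right_inv hyt, rfl⟩
  have hT1 : ∀ w', (fderiv ℝ T z w').1 = fderiv ℝ ψ z.1 w'.1 := by
    intro w'
    have e1 : HasFDerivAt (fun y => (T y).1) _ z := hTd.fst
    have e2 : HasFDerivAt (fun y : E × (E →L[ℝ] ℝ) => ψ y.1)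
        ((fderiv ℝ ψ z.1).comp (ContinuousLinearMap.fst ℝ E (E →L[ℝ] ℝ))) z :=
      HasFDerivAt.comp (g := ψ) z (hψc.differentiableAt (by simp)).hasFDerivAt hasFDerivAt_fst
    have e3 : (fun y => (T y).1) =ᶠ[𝓝 z] fun y => ψ y.1 := by
      filter_upwards [hnear] with y ⟨r, hr0, hr1, hry, hrs⟩
      simp only [hT, hψ, Function.comp_apply, hrs]
      rw [natChart_fst, ← hry, natChart_fst, (extChartAt 𝓘(ℝ, E) x₀).left_inv (by simpa using hr0)]
    exact DFunLike.congr_fun (e1.unique (e2.congr_of_eventuallyEq e3)) w'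
  -- The transition map between natural charts is the cotangent lift of the transition map `ψ` of
  -- the base: both charts compute the same pairing, which is the relation required of `R`.
  have key := cotangent_lift_symplectic (ψ := ψ) (R := fun y => (T y).2) (z := z)
    (hψc.of_le ENat.LEInfty.out) hTd.snd (by
      filter_upwards [hnear] with y ⟨r, hr0, hr1, hry, hrs⟩
      have e1 : y.1 = extChartAt 𝓘(ℝ, E) x₀ r.proj := by rw [← hry, natChart_fst]
      have e2 : T y = natChart x₁ r := by simp only [hT, Function.comp_apply, hrs]
      ext e
      obtain ⟨L, hL⟩ := chartDeriv_isInvertible (x₀ := x₀) hr0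
      obtain ⟨u, rfl⟩ : ∃ u, chartDeriv x₀ r.proj u = e := by
        rw [← hL]; exact L.surjective e
      rw [ContinuousLinearMap.comp_apply, e1, ← chartDeriv_change hr0 hr1, e2, natChart_snd hr1,
        ← hry, natChart_snd hr0])
    (natChartDeriv x₀ q v) (natChartDeriv x₀ q w)
  rw [← key, canonicalTwoForm, naturalComponents_eq, naturalComponents_eq, ← hx₁,
    natChartDeriv_change h₀ h₁, natChartDeriv_change h₀ h₁, hT1, hT1]
  rfl

end ChartChange

/-! ## The metric and the geodesic spray in natural coordinates -/

section CoordMetric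

variable {E : Type*} [NormedAddCommGroup E] [NormedSpace ℝ E]
  {M : Type*} [TopologicalSpace M] [ChartedSpace E M] [IsManifold 𝓘(ℝ, E) ∞ M]

/-- The components of the metric in the preferred chart at `x₀`. -/
noncomputable def LorentzMetric.coordMetric (g : LorentzMetric E M) (x₀ : M) (y : E) :
    E →L[ℝ] E →L[ℝ] ℝ :=
  (trivializationAt (E →L[ℝ] E →L[ℝ] ℝ)
    (fun x : M => TangentSpace 𝓘(ℝ, E) x →L[ℝ] TangentSpace 𝓘(ℝ, E) x →L[ℝ] ℝ) x₀
    ⟨(extChartAt 𝓘(ℝ, E) x₀).symm y, g.val ((extChartAt 𝓘(ℝ, E) x₀).symm y)⟩).2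

variable (g : LorentzMetric E M) {x₀ : M}

theorem LorentzMetric.coordMetric_apply {x : M} (hx : x ∈ (chartAt E x₀).source)
    (u v : TangentSpace 𝓘(ℝ, E) x) :
    g.coordMetric x₀ (extChartAt 𝓘(ℝ, E) x₀ x) (chartDeriv x₀ x u) (chartDeriv x₀ x v)
      = g.val x u v := by
  have hinv : (extChartAt 𝓘(ℝ, E) x₀).symm (extChartAt 𝓘(ℝ, E) x₀ x) = x :=
    (extChartAt 𝓘(ℝ, E) x₀).left_inv (by simpa using hx)
  rw [coordMetric, hinv]
  change ContinuousLinearMap.inCoordinates E (fun x : M => TangentSpace 𝓘(ℝ, E) x)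
    (E →L[ℝ] ℝ) (fun x : M => TangentSpace 𝓘(ℝ, E) x →L[ℝ] Bundle.Trivial M ℝ x)
    x₀ x x₀ x (g.val x) (chartDeriv x₀ x u) (chartDeriv x₀ x v) = _
  rw [inCoordinates_apply_eq₂ (E₃ := Bundle.Trivial M ℝ) (by simpa using hx) (by simpa using hx)
    (by simp)]
  have h1 : (trivializationAt E (fun x : M => TangentSpace 𝓘(ℝ, E) x) x₀).symm x
      (chartDeriv x₀ x u) = u := by
    rw [← Bundle.Trivialization.symmL_apply (R := ℝ) _ (by simpa using hx)]
    exact symmL_chartDeriv hx u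
  have h2 : (trivializationAt E (fun x : M => TangentSpace 𝓘(ℝ, E) x) x₀).symm x
      (chartDeriv x₀ x v) = v := by
    rw [← Bundle.Trivialization.symmL_apply (R := ℝ) _ (by simpa using hx)]
    exact symmL_chartDeriv hx v
  rw [h1, h2]
  simp

theorem chart_symm_mem {y : E} (hy : y ∈ (extChartAt 𝓘(ℝ, E) x₀).target) :
    (extChartAt 𝓘(ℝ, E) x₀).symm y ∈ (chartAt E x₀).source := by
  simpa using (extChartAt 𝓘(ℝ, E) x₀).map_target hy

theorem LorentzMetric.contDiffOn_coordMetric :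
    ContDiffOn ℝ ∞ (g.coordMetric x₀) (extChartAt 𝓘(ℝ, E) x₀).target := by
  intro y hy
  refine ContDiffAt.contDiffWithinAt ?_
  rw [← contMDiffAt_iff_contDiffAt]
  have h1 : ContMDiffOn 𝓘(ℝ, E) 𝓘(ℝ, E →L[ℝ] E →L[ℝ] ℝ) ∞
      (fun x => (trivializationAt (E →L[ℝ] E →L[ℝ] ℝ)
        (fun x : M => TangentSpace 𝓘(ℝ, E) x →L[ℝ] TangentSpace 𝓘(ℝ, E) x →L[ℝ] ℝ) x₀
          ⟨x, g.val x⟩).2) (chartAt E x₀).source := by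
    intro x hx
    have hb : x ∈ (trivializationAt (E →L[ℝ] E →L[ℝ] ℝ)
        (fun x : M => TangentSpace 𝓘(ℝ, E) x →L[ℝ] TangentSpace 𝓘(ℝ, E) x →L[ℝ] ℝ) x₀).baseSet := by
      change x ∈ (chartAt E x₀).source ∩ ((chartAt E x₀).source ∩ univ)
      exact ⟨hx, hx, mem_univ _⟩
    exact (((trivializationAt (E →L[ℝ] E →L[ℝ] ℝ)
        (fun x : M => TangentSpace 𝓘(ℝ, E) x →L[ℝ] TangentSpace 𝓘(ℝ, E) x →L[ℝ] ℝ)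
          x₀).contMDiffAt_section_iff hb).1 (g.contMDiff x)).contMDiffWithinAt
  have h2 : ContMDiffAt 𝓘(ℝ, E) 𝓘(ℝ, E) ∞ (extChartAt 𝓘(ℝ, E) x₀).symm y :=
    (contMDiffOn_extChartAt_symm x₀).contMDiffAt ((isOpen_extChartAt_target x₀).mem_nhds hy)
  have h3 := chart_symm_mem hy
  exact ContMDiffAt.comp (g := fun x => (trivializationAt (E →L[ℝ] E →L[ℝ] ℝ)
    (fun x : M => TangentSpace 𝓘(ℝ, E) x →L[ℝ] TangentSpace 𝓘(ℝ, E) x →L[ℝ] ℝ) x₀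
      ⟨x, g.val x⟩).2) y (h1.contMDiffAt ((chartAt E x₀).open_source.mem_nhds h3)) h2

theorem LorentzMetric.exists_chartDeriv_eq {x : M} (hx : x ∈ (chartAt E x₀).source) (e : E) :
    ∃ u : TangentSpace 𝓘(ℝ, E) x, chartDeriv x₀ x u = e := by
  obtain ⟨L, hL⟩ := chartDeriv_isInvertible (x₀ := x₀) hx
  rw [← hL]
  exact L.surjective e

theorem chartDeriv_injective {x : M} (hx : x ∈ (chartAt E x₀).source) :
    Function.Injective (chartDeriv x₀ x : TangentSpace 𝓘(ℝ, E) x →L[ℝ] E) := by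
  obtain ⟨L, hL⟩ := chartDeriv_isInvertible (x₀ := x₀) hx
  rw [← hL]
  exact L.injective

theorem LorentzMetric.isLorentzForm (x : M) :
    IsLorentzForm (E := E) (g.val x) :=
  ⟨g.symm x, g.lorentzian x⟩

theorem LorentzMetric.coordMetric_isLorentzForm {y : E} (hy : y ∈ (extChartAt 𝓘(ℝ, E) x₀).target) :
    IsLorentzForm (g.coordMetric x₀ y) := by
  set x := (extChartAt 𝓘(ℝ, E) x₀).symm y with hxdef
  have hx : x ∈ (chartAt E x₀).source := chart_symm_mem hy
  have hxy : y = extChartAt 𝓘(ℝ, E) x₀ x := ((extChartAt 𝓘(ℝ, E) x₀).right_inv hy).symm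
  rw [hxy]
  constructor
  · intro u v
    obtain ⟨u, rfl⟩ := LorentzMetric.exists_chartDeriv_eq hx u
    obtain ⟨v, rfl⟩ := LorentzMetric.exists_chartDeriv_eq hx v
    rw [g.coordMetric_apply hx, g.coordMetric_apply hx, g.symm]
  · obtain ⟨u, hu, hpos⟩ := g.lorentzian x
    refine ⟨chartDeriv x₀ x u, by rwa [g.coordMetric_apply hx], fun w hw hw0 => ?_⟩
    obtain ⟨w, rfl⟩ := LorentzMetric.exists_chartDeriv_eq hx w
    rw [g.coordMetric_apply hx] at hw ⊢
    exact hpos w hw (by rintro rfl; simp at hw0)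

/-- A Lorentzian form is nondegenerate. -/
theorem IsLorentzForm.isInvertible [FiniteDimensional ℝ E] {B : E →L[ℝ] E →L[ℝ] ℝ}
    (hB : IsLorentzForm B) : B.IsInvertible := by
  have hinj : Function.Injective (B : E →ₗ[ℝ] E →L[ℝ] ℝ) := by
    rw [← LinearMap.ker_eq_bot, LinearMap.ker_eq_bot']
    intro v hv
    by_contra hne
    obtain ⟨hs, u, -, hu⟩ := hB
    have h0 : B u v = 0 := (hs u v).trans (DFunLike.congr_fun hv u)
    have h1 : B v v = 0 := DFunLike.congr_fun hv v
    exact absurd h1 (hu v h0 hne).ne'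
  have hdim : Module.finrank ℝ E = Module.finrank ℝ (E →L[ℝ] ℝ) := by
    rw [← (LinearMap.toContinuousLinearMap (𝕜 := ℝ) (E := E) (F' := ℝ)).finrank_eq]
    exact Subspace.dual_finrank_eq.symm
  exact ⟨(LinearMap.linearEquivOfInjective (B : E →ₗ[ℝ] E →L[ℝ] ℝ)
      hinj hdim).toContinuousLinearEquiv, by ext; rfl⟩

variable [FiniteDimensional ℝ E]

/-- The components of the inverse metric in the preferred chart at `x₀`. -/
noncomputable def LorentzMetric.coordInverse (g : LorentzMetric E M) (x₀ : M) (y : E) :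
    (E →L[ℝ] ℝ) →L[ℝ] E :=
  (g.coordMetric x₀ y).inverse

theorem LorentzMetric.contDiffOn_coordInverse :
    ContDiffOn ℝ ∞ (g.coordInverse x₀) (extChartAt 𝓘(ℝ, E) x₀).target := by
  intro y hy
  obtain ⟨L, hL⟩ := (g.coordMetric_isLorentzForm hy).isInvertible
  have h1 := contDiffAt_map_inverse (𝕜 := ℝ) (n := ∞) L
  rw [hL] at h1
  have : CompleteSpace E := FiniteDimensional.complete ℝ E
  exact ContDiffAt.comp_contDiffWithinAt y h1 (g.contDiffOn_coordMetric y hy)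

theorem LorentzMetric.coordMetric_coordInverse {y : E} (hy : y ∈ (extChartAt 𝓘(ℝ, E) x₀).target)
    (p : E →L[ℝ] ℝ) : g.coordMetric x₀ y (g.coordInverse x₀ y p) = p :=
  (g.coordMetric_isLorentzForm hy).isInvertible.self_apply_inverse p

theorem LorentzMetric.coordInverse_coordMetric {y : E} (hy : y ∈ (extChartAt 𝓘(ℝ, E) x₀).target)
    (e : E) : g.coordInverse x₀ y (g.coordMetric x₀ y e) = e :=
  (g.coordMetric_isLorentzForm hy).isInvertible.inverse_apply_self e

theorem LorentzMetric.coordInverse_symm {y : E} (hy : y ∈ (extChartAt 𝓘(ℝ, E) x₀).target)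
    (p q : E →L[ℝ] ℝ) : p (g.coordInverse x₀ y q) = q (g.coordInverse x₀ y p) := by
  conv_lhs => rw [← g.coordMetric_coordInverse hy p]
  conv_rhs => rw [← g.coordMetric_coordInverse hy q]
  exact (g.coordMetric_isLorentzForm hy).1 _ _

end CoordMetric

/-! ### Hamilton's equations in natural coordinates -/

section CoordSpray

variable {E : Type*} [NormedAddCommGroup E] [NormedSpace ℝ E] [FiniteDimensional ℝ E]
  {M : Type*} [TopologicalSpace M] [ChartedSpace E M] [IsManifold 𝓘(ℝ, E) ∞ M]

namespace SpacetimeStructure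

variable (g : SpacetimeStructure E M) {x₀ : M}

theorem chartDeriv_sharp {q : CotangentBundle E M} (hq : q.proj ∈ (chartAt E x₀).source) :
    chartDeriv x₀ q.proj (g.sharp q.proj q.2)
      = g.coordInverse x₀ (natChart x₀ q).1 (natChart x₀ q).2 := by
  have hy := natChart_fst_mem hq
  rw [← g.coordInverse_coordMetric hy (chartDeriv x₀ q.proj (g.sharp q.proj q.2))]
  congr 1
  ext e
  obtain ⟨u, rfl⟩ := LorentzMetric.exists_chartDeriv_eq hq e
  rw [natChart_fst, g.coordMetric_apply hq, natChart_snd hq, g.val_sharp]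

theorem apply_sharp_eq {q : CotangentBundle E M} (hq : q.proj ∈ (chartAt E x₀).source) :
    q.2 (g.sharp q.proj q.2)
      = (natChart x₀ q).2 (g.coordInverse x₀ (natChart x₀ q).1 (natChart x₀ q).2) := by
  rw [← g.chartDeriv_sharp hq, natChart_snd hq]

theorem hamiltonian_eq {q : CotangentBundle E M} (hq : q.proj ∈ (chartAt E x₀).source) :
    g.hamiltonian q = coordHamiltonian (g.coordInverse x₀) (natChart x₀ q) := by
  rw [hamiltonian, g.apply_sharp_eq hq, coordHamiltonian]

theorem differentiableAt_coordInverse {y : E} (hy : y ∈ (extChartAt 𝓘(ℝ, E) x₀).target) :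
    DifferentiableAt ℝ (g.coordInverse x₀) y :=
  ((g.contDiffOn_coordInverse).contDiffAt ((isOpen_extChartAt_target x₀).mem_nhds hy)).differentiableAt
    (by simp)

/-- The geodesic spray in natural coordinates. -/
theorem isGeodesicSprayAt_iff {q : CotangentBundle E M} (hq : q.proj ∈ (chartAt E x₀).source)
    (X : TangentSpace (cotangentModel E) q) :
    g.IsGeodesicSprayAt q X
      ↔ natChartDeriv x₀ q X = coordSpray (g.coordInverse x₀) (natChart x₀ q) := by
  have hy := natChart_fst_mem hq
  obtain ⟨D, hD, hDw⟩ := hasFDerivAt_coordHamiltonian (z := natChart x₀ q)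
    (g.differentiableAt_coordInverse hy)
  have hdH : ∀ w, g.dHamiltonian q w = D (natChartDeriv x₀ q w) := by
    intro w
    have h1 : HasMFDerivAt (cotangentModel E) 𝓘(ℝ, ℝ)
        (coordHamiltonian (g.coordInverse x₀) ∘ natChart x₀) q (D.comp (natChartDeriv x₀ q)) :=
      HasMFDerivAt.comp q hD.hasMFDerivAt (hasMFDerivAt_natChart hq)
    have h2 : HasMFDerivAt (cotangentModel E) 𝓘(ℝ, ℝ) g.hamiltonian q
        (D.comp (natChartDeriv x₀ q)) := by
      refine h1.congr_of_eventuallyEq ?_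
      filter_upwards [eventually_mem_chart hq] with r hr
      exact g.hamiltonian_eq hr
    rw [dHamiltonian, h2.mfderiv]
    rfl
  set z := natChart x₀ q with hz
  set Z := natChartDeriv x₀ q X with hZ
  have hsymm := g.coordInverse_symm hy
  have hform : g.IsGeodesicSprayAt q X ↔ ∀ w : E × (E →L[ℝ] ℝ),
      Z.2 w.1 - w.2 Z.1 + (1 / 2) * (z.2 (fderiv ℝ (g.coordInverse x₀) z.1 w.1 z.2)
        + z.2 (g.coordInverse x₀ z.1 w.2) + w.2 (g.coordInverse x₀ z.1 z.2)) = 0 := by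
    constructor
    · intro h w
      obtain ⟨L, hL⟩ := natChartDeriv_isInvertible (x₀ := x₀) hq
      obtain ⟨w', rfl⟩ : ∃ w', natChartDeriv x₀ q w' = w := by
        rw [← hL]; exact L.surjective w
      have := h w'
      rwa [hdH, hDw, canonicalTwoForm_eq hq] at this
    · intro h w
      rw [hdH, hDw, canonicalTwoForm_eq hq]
      exact h _
  rw [hform]
  constructor
  · intro h
    refine Prod.ext ?_ ?_
    · rw [← g.coordInverse_coordMetric hy Z.1]
      change _ = g.coordInverse x₀ z.1 z.2
      congr 1
      ext e
      -- Vertical test vectors isolate the position component; writing them through the metric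
      -- avoids inverting it. Below, horizontal test vectors isolate the momentum component.
      have h1 := h (0, g.coordMetric x₀ z.1 e)
      simp only [map_zero, zero_sub, zero_apply, zero_add] at h1
      rw [hsymm z.2] at h1
      have h2 : g.coordMetric x₀ z.1 e (g.coordInverse x₀ z.1 z.2) = z.2 e := by
        rw [(g.coordMetric_isLorentzForm hy).1, g.coordMetric_coordInverse hy]
      rw [h2] at h1
      rw [(g.coordMetric_isLorentzForm hy).1]
      linarith
    · ext e
      rw [coordSpray_snd_apply]
      have h1 := h (e, 0)
      simp only [map_zero, zero_apply, sub_zero, add_zero] at h1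
      linarith
  · intro h w
    rw [h, coordSpray_snd_apply, hsymm z.2]
    simp only [coordSpray]
    ring

end SpacetimeStructure

end CoordSpray

/-! ## Integral curves of the geodesic spray -/

section Geodesics

variable {E : Type*} [NormedAddCommGroup E] [NormedSpace ℝ E]
  {M : Type*} [TopologicalSpace M] [ChartedSpace E M] [IsManifold 𝓘(ℝ, E) ∞ M]

theorem continuous_cotangent_proj :
    Continuous (fun q : CotangentBundle E M => q.proj) :=
  FiberBundle.continuous_proj (E →L[ℝ] ℝ) (fun x : M => TangentSpace 𝓘(ℝ, E) x →L[ℝ] ℝ)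

/-- Uniqueness of integral curves needs unique limits in `T*M`. Points of one fibre are separated in
a chart, points of different fibres by the projection. -/
instance cotangentBundle_t2Space [T2Space M] : T2Space (CotangentBundle E M) := by
  refine ⟨fun q r hne => ?_⟩
  by_cases h : q.proj = r.proj
  · have hq : q.proj ∈ (chartAt E q.proj).source := mem_chart_source E q.proj
    have hr : r.proj ∈ (chartAt E q.proj).source := h ▸ hq
    have hz : natChart q.proj q ≠ natChart q.proj r := fun hz =>
      hne ((natChart q.proj).injOn (mem_natChart_source.2 hq) (mem_natChart_source.2 hr) hz)
    obtain ⟨u, v, hu, hv, hqu, hrv, huv⟩ := t2_separation hz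
    have h1 := (contMDiffAt_natChart hq).continuousAt.eventually_mem (hu.mem_nhds hqu)
    have h2 := (contMDiffAt_natChart hr).continuousAt.eventually_mem (hv.mem_nhds hrv)
    obtain ⟨u', hu', hu'o, hqu'⟩ := eventually_nhds_iff.1 h1
    obtain ⟨v', hv', hv'o, hrv'⟩ := eventually_nhds_iff.1 h2
    exact ⟨u', v', hu'o, hv'o, hqu', hrv', disjoint_left.2 fun s hs hs' =>
      disjoint_left.1 huv (hu' s hs) (hv' s hs')⟩
  · obtain ⟨u, v, hu, hv, hqu, hrv, huv⟩ := t2_separation h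
    exact ⟨_, _, hu.preimage continuous_cotangent_proj, hv.preimage continuous_cotangent_proj,
      hqu, hrv, huv.preimage _⟩

/-- The value of the canonical one-form on the velocity of a curve in `T*M`. -/
noncomputable def oneFormVelocity (Z : ℝ → CotangentBundle E M) (s : ℝ) : ℝ :=
  canonicalOneForm (Z s) (mfderiv 𝓘(ℝ, ℝ) (cotangentModel E) Z s (1 : ℝ))

variable {x₀ : M}

theorem hasDerivAt_natChart_comp {Z : ℝ → CotangentBundle E M} {s : ℝ}
    (hs : (Z s).proj ∈ (chartAt E x₀).source) {A : ℝ →L[ℝ] TangentSpace (cotangentModel E) (Z s)}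
    (hZ : HasMFDerivAt 𝓘(ℝ, ℝ) (cotangentModel E) Z s A) :
    HasDerivAt (fun t => natChart x₀ (Z t)) (natChartDeriv x₀ (Z s) (A 1)) s := by
  have h : HasFDerivAt (fun t => natChart x₀ (Z t))
      ((natChartDeriv x₀ (Z s)).comp A : ℝ →L[ℝ] E × (E →L[ℝ] ℝ)) s :=
    (HasMFDerivAt.comp s (hasMFDerivAt_natChart hs) hZ).hasFDerivAt
  exact h.hasDerivAt

theorem oneFormVelocity_eq {Z : ℝ → CotangentBundle E M} {s : ℝ}
    (hs : (Z s).proj ∈ (chartAt E x₀).source)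
    (hZ : MDifferentiableAt 𝓘(ℝ, ℝ) (cotangentModel E) Z s) {Z' : E × (E →L[ℝ] ℝ)}
    (hZ' : HasDerivAt (fun t => natChart x₀ (Z t)) Z' s) :
    oneFormVelocity Z s = (natChart x₀ (Z s)).2 Z'.1 := by
  rw [oneFormVelocity, canonicalOneForm_eq hs]
  exact congrArg (fun v : E × (E →L[ℝ] ℝ) => (natChart x₀ (Z s)).2 v.1)
    (hZ'.unique (hasDerivAt_natChart_comp hs hZ.hasMFDerivAt)).symm

theorem oneFormVelocity_congr {Z W : ℝ → CotangentBundle E M} {s : ℝ} (h : Z =ᶠ[𝓝 s] W) :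
    oneFormVelocity Z s = oneFormVelocity W s := by
  have h1 := h.eq_of_nhds
  have h2 := h.mfderiv_eq (I := 𝓘(ℝ, ℝ)) (I' := cotangentModel E)
  rw [oneFormVelocity, oneFormVelocity]
  -- The two derivatives have values in tangent spaces at points that are only propositionally
  -- equal. They are generalized so that this equality can be substituted.
  revert h2
  generalize mfderiv 𝓘(ℝ, ℝ) (cotangentModel E) Z s = A
  generalize mfderiv 𝓘(ℝ, ℝ) (cotangentModel E) W s = B
  revert A B
  rw [h1]
  rintro A B rfl
  rfl

theorem mdifferentiableAt_of_natChart {Z : ℝ → CotangentBundle E M} {s : ℝ}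
    (hs : (Z s).proj ∈ (chartAt E x₀).source) (hev : ∀ᶠ t in 𝓝 s, (Z t).proj ∈ (chartAt E x₀).source)
    {Z' : E × (E →L[ℝ] ℝ)} (hZ' : HasDerivAt (fun t => natChart x₀ (Z t)) Z' s) :
    MDifferentiableAt 𝓘(ℝ, ℝ) (cotangentModel E) Z s := by
  have h1 : MDifferentiableAt 𝓘(ℝ, E × (E →L[ℝ] ℝ)) (cotangentModel E)
      ((natChart x₀).symm : _ → CotangentBundle E M) (natChart x₀ (Z s)) :=
    (contMDiffAt_natChart_symm (natChart_fst_mem hs)).mdifferentiableAt (by simp)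
  have h2 : MDifferentiableAt 𝓘(ℝ, ℝ) 𝓘(ℝ, E × (E →L[ℝ] ℝ)) (fun t => natChart x₀ (Z t)) s :=
    hZ'.differentiableAt.mdifferentiableAt
  refine (h1.comp s h2).congr_of_eventuallyEq ?_
  filter_upwards [hev] with t ht
  exact (natChart_left_inv ht).symm

variable [FiniteDimensional ℝ E]

namespace SpacetimeStructure

variable (g : SpacetimeStructure E M)

/-- The curve `c` has the value of the geodesic spray as velocity at time `t`. -/
def IsGeodesicAt (c : ℝ → CotangentBundle E M) (t : ℝ) : Prop :=
  ∃ X : TangentSpace (cotangentModel E) (c t), g.IsGeodesicSprayAt (c t) X ∧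
    HasMFDerivAt 𝓘(ℝ, ℝ) (cotangentModel E) c t ((1 : ℝ →L[ℝ] ℝ).smulRight X)

variable {g} {c c' : ℝ → CotangentBundle E M} {t : ℝ}

theorem IsGeodesicAt.continuousAt (h : g.IsGeodesicAt c t) : ContinuousAt c t := by
  obtain ⟨X, -, hX⟩ := h
  exact hX.continuousAt

theorem IsGeodesicAt.congr (h : g.IsGeodesicAt c t) (hc : c' =ᶠ[𝓝 t] c) : g.IsGeodesicAt c' t := by
  obtain ⟨X, hX, hd⟩ := h
  have he : c t = c' t := hc.self_of_nhds.symm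
  rw [IsGeodesicAt]
  have hd' := hd.congr_of_eventuallyEq hc
  rw [← he]
  exact ⟨X, hX, hd'⟩

theorem IsGeodesicAt.hasDerivAt (h : g.IsGeodesicAt c t)
    (ht : (c t).proj ∈ (chartAt E x₀).source) :
    HasDerivAt (fun s => natChart x₀ (c s))
      (coordSpray (g.coordInverse x₀) (natChart x₀ (c t))) t := by
  obtain ⟨X, hX, hd⟩ := h
  have h1 := hasDerivAt_natChart_comp ht hd
  rw [← (g.isGeodesicSprayAt_iff ht X).1 hX]
  convert h1 using 2
  simp

theorem isGeodesicAt_of_hasDerivAt (ht : (c t).proj ∈ (chartAt E x₀).source)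
    (hev : ∀ᶠ s in 𝓝 t, (c s).proj ∈ (chartAt E x₀).source)
    (hd : HasDerivAt (fun s => natChart x₀ (c s))
      (coordSpray (g.coordInverse x₀) (natChart x₀ (c t))) t) : g.IsGeodesicAt c t := by
  have h1 := mdifferentiableAt_of_natChart ht hev hd
  refine ⟨mfderiv 𝓘(ℝ, ℝ) (cotangentModel E) c t (1 : ℝ), ?_, ?_⟩
  · rw [g.isGeodesicSprayAt_iff ht]
    exact (hd.unique (hasDerivAt_natChart_comp ht h1.hasMFDerivAt)).symm
  · have h2 : (1 : ℝ →L[ℝ] ℝ).smulRight (mfderiv 𝓘(ℝ, ℝ) (cotangentModel E) c t (1 : ℝ)) =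
        mfderiv 𝓘(ℝ, ℝ) (cotangentModel E) c t :=
      ContinuousLinearMap.ext_ring (by simp; rfl)
    rw [h2]
    exact h1.hasMFDerivAt

/-- In a chart the spray is continuously differentiable, hence locally Lipschitz, and the uniqueness
theorem for ordinary differential equations applies. -/
theorem eventually_eq_of_isGeodesicAt (hc : ∀ᶠ s in 𝓝 t, g.IsGeodesicAt c s)
    (hc' : ∀ᶠ s in 𝓝 t, g.IsGeodesicAt c' s) (h : c t = c' t) : c =ᶠ[𝓝 t] c' := by
  set x₀ := (c t).proj with hx₀
  have ht : (c t).proj ∈ (chartAt E x₀).source := mem_chart_source E _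
  have ht' : (c' t).proj ∈ (chartAt E x₀).source := h ▸ ht
  have hev := hc.self_of_nhds.continuousAt.eventually (eventually_mem_chart ht)
  have hev' := hc'.self_of_nhds.continuousAt.eventually (eventually_mem_chart ht')
  have hf : ContDiffAt ℝ 1 (coordSpray (g.coordInverse x₀)) (natChart x₀ (c t)) :=
    ((contDiffOn_coordSpray (isOpen_extChartAt_target x₀) g.contDiffOn_coordInverse).contDiffAt
      (((isOpen_extChartAt_target x₀).prod isOpen_univ).mem_nhds
        ⟨natChart_fst_mem ht, mem_univ _⟩)).of_le ENat.LEInfty.out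
  obtain ⟨K, s, hs, hlip⟩ := hf.exists_lipschitzOnWith
  have hcs : ∀ᶠ r in 𝓝 t, natChart x₀ (c r) ∈ s :=
    (hc.self_of_nhds.hasDerivAt ht).continuousAt.eventually_mem hs
  have hcs' : ∀ᶠ r in 𝓝 t, natChart x₀ (c' r) ∈ s := by
    refine (hc'.self_of_nhds.hasDerivAt ht').continuousAt.eventually_mem ?_
    rw [← h]; exact hs
  have key : (fun r => natChart x₀ (c r)) =ᶠ[𝓝 t] fun r => natChart x₀ (c' r) := by
    refine ODE_solution_unique_of_eventually (v := fun _ => coordSpray (g.coordInverse x₀))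
      (s := fun _ => s) (K := K) (Eventually.of_forall fun _ => hlip) ?_ ?_ (by rw [h])
    · filter_upwards [hc, hev, hcs] with r h1 h2 h3
      exact ⟨h1.hasDerivAt h2, h3⟩
    · filter_upwards [hc', hev', hcs'] with r h1 h2 h3
      exact ⟨h1.hasDerivAt h2, h3⟩
  filter_upwards [key, hev, hev'] with r h1 h2 h3
  rw [← natChart_left_inv h2, ← natChart_left_inv h3, h1]

/-- Uniqueness of integral curves of the geodesic spray. -/
theorem eqOn_of_isGeodesicAt [T2Space M] {J : Set ℝ} (hJ : IsOpen J) (hJc : J.OrdConnected)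
    (hc : ∀ s ∈ J, g.IsGeodesicAt c s) (hc' : ∀ s ∈ J, g.IsGeodesicAt c' s) (ht : t ∈ J)
    (h : c t = c' t) : EqOn c c' J := by
  have hev : ∀ s ∈ J, c s = c' s → c =ᶠ[𝓝 s] c' := fun s hs he =>
    eventually_eq_of_isGeodesicAt ((hJ.eventually_mem hs).mono hc) ((hJ.eventually_mem hs).mono hc') he
  -- Agreement of germs is an open condition. At a limit in `J` of such times the values agree, by
  -- the Hausdorff property, and then the germs agree by local uniqueness; connectedness of `J`
  -- concludes.
  let u : Set ℝ := {s | c =ᶠ[𝓝 s] c'}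
  have hu : IsOpen u := by
    rw [isOpen_iff_mem_nhds]
    intro s hs
    exact eventually_eventually_nhds.2 hs
  have hsub : J ⊆ u := by
    refine hJc.isPreconnected.subset_of_closure_inter_subset hu ⟨t, ht, hev t ht h⟩ ?_
    rintro s ⟨hs, hsJ⟩
    refine hev s hsJ ?_
    have hfr : ∃ᶠ r in 𝓝 s, c r = c' r := by
      refine (mem_closure_iff_frequently.1 hs).mono fun r hr => ?_
      exact Filter.EventuallyEq.eq_of_nhds (show c =ᶠ[𝓝 r] c' from hr)
    by_contra hne
    exact hfr (((hc s hsJ).continuousAt.prodMk (hc' s hsJ).continuousAt).eventually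
      (isClosed_diagonal.isOpen_compl.mem_nhds hne))
  intro s hs
  exact Filter.EventuallyEq.eq_of_nhds (show c =ᶠ[𝓝 s] c' from hsub hs)

/-- Multiplication of covectors by a real number. -/
noncomputable def scaleCovector (a : ℝ) (q : CotangentBundle E M) : CotangentBundle E M := ⟨q.proj, a • q.2⟩

theorem scaleCovector_one (q : CotangentBundle E M) : scaleCovector 1 q = q := by
  obtain ⟨x, p⟩ := q
  exact congrArg (Bundle.TotalSpace.mk x) (one_smul ℝ p)

theorem natChart_scaleCovector {a : ℝ} {q : CotangentBundle E M}
    (hq : q.proj ∈ (chartAt E x₀).source) :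
    natChart x₀ (scaleCovector a q) = ((natChart x₀ q).1, a • (natChart x₀ q).2) := by
  refine Prod.ext ?_ ?_
  · rw [natChart_fst, natChart_fst]; rfl
  · ext e
    obtain ⟨u, rfl⟩ := LorentzMetric.exists_chartDeriv_eq hq e
    have := natChart_snd (q := scaleCovector a q) hq u
    refine this.trans ?_
    rw [smul_apply, natChart_snd hq]
    rfl

/-- Affine reparametrization of geodesics. -/
theorem IsGeodesicAt.scale {a b : ℝ} (h : g.IsGeodesicAt c (a * t + b)) :
    g.IsGeodesicAt (fun s => scaleCovector a (c (a * s + b))) t := by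
  set x₀ := (c (a * t + b)).proj with hx₀
  have ht : (c (a * t + b)).proj ∈ (chartAt E x₀).source := mem_chart_source E _
  have hcont : ContinuousAt (fun s : ℝ => a * s + b) t := by fun_prop
  have hev : ∀ᶠ s in 𝓝 t, (c (a * s + b)).proj ∈ (chartAt E x₀).source :=
    (ContinuousAt.comp (f := fun s : ℝ => a * s + b) h.continuousAt hcont).eventually
      (eventually_mem_chart ht)
  refine isGeodesicAt_of_hasDerivAt (x₀ := x₀) ht hev ?_
  have h1 := h.hasDerivAt ht
  have h2 : HasDerivAt (fun s : ℝ => a * s + b) a t := by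
    simpa using ((hasDerivAt_id t).const_mul a).add_const b
  have h3 := HasDerivAt.scomp (h := fun s : ℝ => a * s + b) t h1 h2
  have h4 : HasDerivAt (fun s => ((natChart x₀ (c (a * s + b))).1, a • (natChart x₀ (c (a * s + b))).2))
      ((a • coordSpray (g.coordInverse x₀) (natChart x₀ (c (a * t + b)))).1,
        a • (a • coordSpray (g.coordInverse x₀) (natChart x₀ (c (a * t + b)))).2) t :=
    (((ContinuousLinearMap.fst ℝ E (E →L[ℝ] ℝ)).prod
      (a • ContinuousLinearMap.snd ℝ E (E →L[ℝ] ℝ))).hasFDerivAt).comp_hasDerivAt t h3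
  rw [natChart_scaleCovector ht, coordSpray_smul]
  refine (h4.congr_of_eventuallyEq ?_).congr_deriv ?_
  · filter_upwards [hev] with s hs
    exact natChart_scaleCovector hs
  · simp [smul_smul]

theorem IsGeodesicAt.comp_add_const {b : ℝ} (h : g.IsGeodesicAt c (t + b)) :
    g.IsGeodesicAt (fun s => c (s + b)) t := by
  have h1 := IsGeodesicAt.scale (a := 1) (b := b) (t := t) (g := g) (c := c) (by simpa using h)
  refine h1.congr (Eventually.of_forall fun s => ?_)
  change c (s + b) = scaleCovector 1 (c (1 * s + b))
  rw [scaleCovector_one, one_mul]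

end SpacetimeStructure

end Geodesics

/-! ## The geodesic flow on the cotangent bundle -/

section GeodesicFlow

variable {E : Type*} [NormedAddCommGroup E] [NormedSpace ℝ E] [FiniteDimensional ℝ E]
  {M : Type*} [TopologicalSpace M] [ChartedSpace E M] [IsManifold 𝓘(ℝ, E) ∞ M]

namespace SpacetimeStructure

variable (g : SpacetimeStructure E M)

/-- `c` is an integral curve of the geodesic spray on the open interval `J`, starting at `q`. -/
structure IsGeodesicFrom (q : CotangentBundle E M) (c : ℝ → CotangentBundle E M) (J : Set ℝ) :
    Prop where
  isOpen : IsOpen J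
  ordConnected : J.OrdConnected
  zero_mem : (0 : ℝ) ∈ J
  isGeodesicAt : ∀ t ∈ J, g.IsGeodesicAt c t
  start : c 0 = q

/-- The interval of definition of the maximal geodesic starting at `q`. -/
def geodesicDomain (q : CotangentBundle E M) : Set ℝ :=
  {t | ∃ c J, g.IsGeodesicFrom q c J ∧ t ∈ J}

open Classical in
/-- The geodesic flow. -/
noncomputable def geodesicFlow (q : CotangentBundle E M) (t : ℝ) : CotangentBundle E M :=
  if h : t ∈ g.geodesicDomain q then h.choose t else q

variable {g} {q : CotangentBundle E M} {c : ℝ → CotangentBundle E M} {J : Set ℝ} {s t : ℝ}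

theorem IsGeodesicFrom.subset_geodesicDomain (h : g.IsGeodesicFrom q c J) :
    J ⊆ g.geodesicDomain q := fun _ ht => ⟨c, J, h, ht⟩

theorem IsGeodesicFrom.shift (h : g.IsGeodesicFrom q c J) (ht : t ∈ J) :
    g.IsGeodesicFrom (c t) (fun s => c (s + t)) ((fun s => s + t) ⁻¹' J) where
  isOpen := h.isOpen.preimage (by fun_prop)
  ordConnected := h.ordConnected.preimage_mono fun _ _ hab => by simpa using hab
  zero_mem := by simpa using ht
  isGeodesicAt s hs := (h.isGeodesicAt _ hs).comp_add_const
  start := by simp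

variable [T2Space M]

theorem IsGeodesicFrom.geodesicFlow_eq (h : g.IsGeodesicFrom q c J) (ht : t ∈ J) :
    g.geodesicFlow q t = c t := by
  have ht' : t ∈ g.geodesicDomain q := h.subset_geodesicDomain ht
  obtain ⟨J', h', htJ'⟩ := ht'.choose_spec
  rw [geodesicFlow, dif_pos ht']
  exact eqOn_of_isGeodesicAt (h'.isOpen.inter h.isOpen) (h'.ordConnected.inter h.ordConnected)
    (fun s hs => h'.isGeodesicAt s hs.1) (fun s hs => h.isGeodesicAt s hs.2)
    ⟨h'.zero_mem, h.zero_mem⟩ (h'.start.trans h.start.symm) ⟨htJ', ht⟩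

variable (g)

/-- The flow of the coordinate spray, carried to `T*M` by a natural chart. The coordinate flow `φ`
is kept in the conclusion because the computations with the one-form and with hitting times are made
on it. -/
theorem exists_local_geodesicFlow (q₀ : CotangentBundle E M) :
    ∃ (U : Set (E × (E →L[ℝ] ℝ))) (ε : ℝ) (φ : (E × (E →L[ℝ] ℝ)) × ℝ → E × (E →L[ℝ] ℝ)),
      IsOpen U ∧ natChart q₀.proj q₀ ∈ U ∧ 0 < ε ∧ ContDiffOn ℝ ∞ φ (U ×ˢ Ioo (-ε) ε) ∧
      (∀ z ∈ U, φ (z, 0) = z) ∧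
      (∀ z ∈ U, ∀ t ∈ Ioo (-ε) ε, (φ (z, t)).1 ∈ (extChartAt 𝓘(ℝ, E) q₀.proj).target) ∧
      (∀ z ∈ U, ∀ t ∈ Ioo (-ε) ε,
        HasDerivAt (fun s => φ (z, s)) (coordSpray (g.coordInverse q₀.proj) (φ (z, t))) t) ∧
      ∀ q : CotangentBundle E M, q.proj ∈ (chartAt E q₀.proj).source → natChart q₀.proj q ∈ U →
        g.IsGeodesicFrom q (fun t => (natChart q₀.proj).symm (φ (natChart q₀.proj q, t)))
          (Ioo (-ε) ε) := by
  have hq₀ : q₀.proj ∈ (chartAt E q₀.proj).source := mem_chart_source E _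
  have : CompleteSpace E := FiniteDimensional.complete ℝ E
  obtain ⟨φ, U, hU, hqU, hUΩ, ε, hε, hφ, hφ0, hφΩ, hφd⟩ :=
    exists_contDiffOn_localFlow_of_isOpen
      ((isOpen_extChartAt_target (I := 𝓘(ℝ, E)) q₀.proj).prod isOpen_univ)
      (contDiffOn_coordSpray (isOpen_extChartAt_target q₀.proj) g.contDiffOn_coordInverse)
      (⟨natChart_fst_mem hq₀, mem_univ _⟩ :
        natChart q₀.proj q₀ ∈ (extChartAt 𝓘(ℝ, E) q₀.proj).target ×ˢ univ)
  refine ⟨U, ε, φ, hU, hqU, hε, hφ, hφ0, fun z hz t ht => (hφΩ z hz t ht).1, hφd,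
    fun q hq hqz => ⟨isOpen_Ioo, ordConnected_Ioo, ⟨by linarith, hε⟩, fun t ht => ?_, ?_⟩⟩
  · have hmem : ∀ s ∈ Ioo (-ε) ε, ((natChart q₀.proj).symm (φ (natChart q₀.proj q, s)) :
        CotangentBundle E M).proj ∈ (chartAt E q₀.proj).source := fun s hs =>
      natChart_symm_mem (hφΩ _ hqz s hs).1
    refine isGeodesicAt_of_hasDerivAt (x₀ := q₀.proj) (hmem t ht)
      ((isOpen_Ioo.eventually_mem ht).mono hmem) ?_
    rw [natChart_right_inv (hφΩ _ hqz t ht).1]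
    refine (hφd _ hqz t ht).congr_of_eventuallyEq ?_
    filter_upwards [isOpen_Ioo.eventually_mem ht] with s hs
    exact natChart_right_inv (hφΩ _ hqz s hs).1
  · simp only [hφ0 _ hqz]
    exact natChart_left_inv hq

theorem zero_mem_geodesicDomain (q : CotangentBundle E M) : (0 : ℝ) ∈ g.geodesicDomain q := by
  obtain ⟨U, ε, φ, -, hqU, hε, -, -, -, -, h⟩ := g.exists_local_geodesicFlow q
  exact (h q (mem_chart_source E _) hqU).subset_geodesicDomain ⟨by linarith, hε⟩

/-- The union of intervals containing `0` is an interval, and uniqueness makes the curves on them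
fit together. -/
theorem isGeodesicFrom_geodesicFlow (q : CotangentBundle E M) :
    g.IsGeodesicFrom q (g.geodesicFlow q) (g.geodesicDomain q) where
  isOpen := by
    rw [isOpen_iff_mem_nhds]
    rintro t ⟨c, J, h, ht⟩
    exact mem_of_superset (h.isOpen.mem_nhds ht) h.subset_geodesicDomain
  ordConnected := by
    refine ⟨?_⟩
    rintro x ⟨c, J, h, hx⟩ y ⟨c', J', h', hy⟩ z hz
    rcases le_total z 0 with hz0 | hz0
    · exact ⟨c, J, h, h.ordConnected.out hx h.zero_mem ⟨hz.1, hz0⟩⟩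
    · exact ⟨c', J', h', h'.ordConnected.out h'.zero_mem hy ⟨hz0, hz.2⟩⟩
  zero_mem := g.zero_mem_geodesicDomain q
  isGeodesicAt := by
    rintro t ⟨c, J, h, ht⟩
    refine (h.isGeodesicAt t ht).congr ?_
    filter_upwards [h.isOpen.mem_nhds ht] with s hs
    exact h.geodesicFlow_eq hs
  start := by
    obtain ⟨c, J, h, ht⟩ := g.zero_mem_geodesicDomain q
    rw [h.geodesicFlow_eq ht, h.start]

theorem geodesicFlow_zero (q : CotangentBundle E M) : g.geodesicFlow q 0 = q :=
  (g.isGeodesicFrom_geodesicFlow q).start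

variable {g}

/-- The maximal curve shifted by `t` is an integral curve starting at the flowed point, hence part
of the maximal one there. -/
theorem mem_geodesicDomain_of_add (ht : t ∈ g.geodesicDomain q)
    (hst : s + t ∈ g.geodesicDomain q) :
    s ∈ g.geodesicDomain (g.geodesicFlow q t) ∧
      g.geodesicFlow (g.geodesicFlow q t) s = g.geodesicFlow q (s + t) := by
  have h := (g.isGeodesicFrom_geodesicFlow q).shift ht
  exact ⟨h.subset_geodesicDomain hst, h.geodesicFlow_eq hst⟩

theorem geodesicFlow_neg (ht : t ∈ g.geodesicDomain q) :
    -t ∈ g.geodesicDomain (g.geodesicFlow q t) ∧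
      g.geodesicFlow (g.geodesicFlow q t) (-t) = q := by
  have h := mem_geodesicDomain_of_add (s := -t) ht
    (by rw [neg_add_cancel]; exact g.zero_mem_geodesicDomain q)
  rwa [neg_add_cancel, geodesicFlow_zero] at h

/-- Flowing back by `-t` reduces this to `mem_geodesicDomain_of_add` at the flowed point. -/
theorem add_mem_geodesicDomain (ht : t ∈ g.geodesicDomain q)
    (hs : s ∈ g.geodesicDomain (g.geodesicFlow q t)) :
    s + t ∈ g.geodesicDomain q ∧
      g.geodesicFlow q (s + t) = g.geodesicFlow (g.geodesicFlow q t) s := by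
  obtain ⟨h1, h2⟩ := geodesicFlow_neg ht
  have h := mem_geodesicDomain_of_add (s := s + t) h1 (by rwa [add_neg_cancel_right])
  rwa [h2, add_neg_cancel_right] at h

end SpacetimeStructure

end GeodesicFlow

/-! ## Regularity and invariants of the geodesic flow -/

section FlowRegularity

variable {E : Type*} [NormedAddCommGroup E] [NormedSpace ℝ E] [FiniteDimensional ℝ E]
  {M : Type*} [TopologicalSpace M] [ChartedSpace E M] [IsManifold 𝓘(ℝ, E) ∞ M] [T2Space M]

namespace SpacetimeStructure

variable {g : SpacetimeStructure E M} {q : CotangentBundle E M} {c : ℝ → CotangentBundle E M}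
  {s t : ℝ}

theorem hasDerivAt_hamiltonian (h : g.IsGeodesicAt c t) :
    HasDerivAt (fun s => g.hamiltonian (c s)) 0 t := by
  have ht : (c t).proj ∈ (chartAt E (c t).proj).source := mem_chart_source E _
  have h1 := hasDerivAt_coordHamiltonian_zero (c := fun s => natChart (c t).proj (c s))
    (g.coordInverse_symm (natChart_fst_mem ht))
    (g.differentiableAt_coordInverse (natChart_fst_mem ht)) (h.hasDerivAt ht)
  refine h1.congr_of_eventuallyEq ?_
  filter_upwards [h.continuousAt.eventually (eventually_mem_chart ht)] with s hs
  exact g.hamiltonian_eq hs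

theorem hamiltonian_geodesicFlow (ht : t ∈ g.geodesicDomain q) :
    g.hamiltonian (g.geodesicFlow q t) = g.hamiltonian q := by
  have h := g.isGeodesicFrom_geodesicFlow q
  have hd : ∀ s ∈ g.geodesicDomain q,
      HasDerivAt (fun s => g.hamiltonian (g.geodesicFlow q s)) 0 s := fun s hs =>
    hasDerivAt_hamiltonian (h.isGeodesicAt s hs)
  have h1 := h.isOpen.is_const_of_deriv_eq_zero h.ordConnected.isPreconnected
    (fun s hs => (hd s hs).differentiableAt.differentiableWithinAt)
    (fun s hs => (hd s hs).deriv) ht h.zero_mem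
  simpa [geodesicFlow_zero] using h1

variable (g) in
theorem isGeodesicFrom_zero (x : M) :
    g.IsGeodesicFrom (⟨x, 0⟩ : CotangentBundle E M) (fun _ => ⟨x, 0⟩) univ where
  isOpen := isOpen_univ
  ordConnected := ordConnected_univ
  zero_mem := mem_univ _
  isGeodesicAt t _ := by
    have hx : x ∈ (chartAt E x).source := mem_chart_source E _
    refine isGeodesicAt_of_hasDerivAt (x₀ := x) hx (Eventually.of_forall fun _ => hx) ?_
    have h2 : (natChart x (⟨x, 0⟩ : CotangentBundle E M)).2 = 0 := by
      ext e
      obtain ⟨u, rfl⟩ := LorentzMetric.exists_chartDeriv_eq hx e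
      exact (natChart_snd (q := (⟨x, 0⟩ : CotangentBundle E M)) hx u).trans rfl
    have h3 : coordSpray (g.coordInverse x) (natChart x (⟨x, 0⟩ : CotangentBundle E M)) = 0 := by
      refine Prod.ext ?_ ?_
      · simp [coordSpray, h2]
      · ext e
        rw [coordSpray_snd_apply, h2]
        simp
    rw [h3]
    exact hasDerivAt_const t _
  start := rfl

/-- Zero covectors are fixed by the flow, so flowing back from one would show that `q.2` vanishes.
-/
theorem geodesicFlow_snd_ne_zero (hq : q.2 ≠ 0) (ht : t ∈ g.geodesicDomain q) :
    (g.geodesicFlow q t).2 ≠ 0 := by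
  intro h0
  have h1 : g.geodesicFlow q t = ⟨(g.geodesicFlow q t).proj, 0⟩ := by
    conv_lhs => rw [← Bundle.TotalSpace.eta (g.geodesicFlow q t), h0]
  obtain ⟨h2, h3⟩ := geodesicFlow_neg ht
  rw [h1] at h3
  rw [(g.isGeodesicFrom_zero _).geodesicFlow_eq (mem_univ _)] at h3
  apply hq
  rw [← h3]

variable (g)

/-- The coordinates of the time orientation. -/
theorem contMDiffAt_chartDeriv_timeField {x₀ x : M} (hx : x ∈ (chartAt E x₀).source) :
    ContMDiffAt 𝓘(ℝ, E) 𝓘(ℝ, E) ∞ (fun y => (chartDeriv x₀ y (g.timeField y) : E)) x := by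
  have h := (g.contMDiff_timeField x)
  have hx' : (⟨x, g.timeField x⟩ : TangentBundle 𝓘(ℝ, E) M) ∈
      (trivializationAt E (fun x : M => TangentSpace 𝓘(ℝ, E) x) x₀).source := by
    simpa [Bundle.Trivialization.mem_source] using hx
  have h1 := (((trivializationAt E (fun x : M => TangentSpace 𝓘(ℝ, E) x) x₀).contMDiffAt_iff
    (f := fun y => (⟨y, g.timeField y⟩ : TangentBundle 𝓘(ℝ, E) M)) (IB := 𝓘(ℝ, E)) hx').1 h).2
  refine h1.congr_of_eventuallyEq ?_
  filter_upwards [(chartAt E x₀).open_source.mem_nhds hx] with y hy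
  have h : chartDeriv x₀ y = (trivializationAt E (fun x : M => TangentSpace 𝓘(ℝ, E) x) x₀).continuousLinearMapAt ℝ y :=
    (TangentBundle.continuousLinearMapAt_trivializationAt (I := 𝓘(ℝ, E)) hy).symm
  rw [h, Bundle.Trivialization.continuousLinearMapAt_apply,
    Bundle.Trivialization.coe_linearMapAt_of_mem _ (by simpa using hy)]

theorem continuousAt_apply_timeField (q : CotangentBundle E M) :
    ContinuousAt (fun r : CotangentBundle E M => r.2 (g.timeField r.proj)) q := by
  have hq : q.proj ∈ (chartAt E q.proj).source := mem_chart_source E _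
  have h1 : ContinuousAt (fun r : CotangentBundle E M =>
      (chartDeriv q.proj r.proj (g.timeField r.proj) : E)) q :=
    ContinuousAt.comp (f := fun r : CotangentBundle E M => r.proj)
      (g.contMDiffAt_chartDeriv_timeField hq).continuousAt
      continuous_cotangent_proj.continuousAt
  have h2 : ContinuousAt (fun r : CotangentBundle E M => (natChart q.proj r).2) q :=
    (contMDiffAt_natChart hq).continuousAt.snd
  refine (h2.clm_apply h1).congr ?_
  filter_upwards [eventually_mem_chart hq] with r hr
  exact natChart_snd hr _

variable {g}

theorem val_sharp_timeField (q : CotangentBundle E M) :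
    g.val q.proj (g.sharp q.proj q.2) (g.timeField q.proj) = q.2 (g.timeField q.proj) := by
  rw [g.val_sharp]

theorem sharp_ne_zero (hq : q.2 ≠ 0) : g.sharp q.proj q.2 ≠ 0 := by
  intro h
  apply hq
  rw [← g.val_sharp q.proj q.2, h, map_zero]

/-- Because `g(p^#, T) = p(T)`, the causal conditions reduce to one equation conserved by the flow
and one open inequality. -/
theorem mem_nullBundle_iff :
    q ∈ g.nullBundle ↔ g.hamiltonian q = 0 ∧ q.2 (g.timeField q.proj) < 0 := by
  have h : g.val q.proj (g.sharp q.proj q.2) (g.sharp q.proj q.2)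
      = q.2 (g.sharp q.proj q.2) := by rw [g.val_sharp]
  rw [nullBundle, mem_ofPred_eq, IsFutureCausal, val_sharp_timeField, h, hamiltonian]
  constructor
  · rintro ⟨h1, h2, h3⟩
    exact ⟨by simp [h1], h3⟩
  · rintro ⟨h1, h2⟩
    have h3 : q.2 (g.sharp q.proj q.2) = 0 := by simpa using h1
    exact ⟨h3, h3.le, h2⟩

theorem snd_ne_zero_of_mem_nullBundle (hq : q ∈ g.nullBundle) : q.2 ≠ 0 := by
  intro h
  have := (mem_nullBundle_iff.1 hq).2
  rw [h] at this
  exact lt_irrefl _ this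

theorem apply_timeField_ne_zero (h0 : g.hamiltonian q = 0) (hq : q.2 ≠ 0) :
    q.2 (g.timeField q.proj) ≠ 0 := by
  rw [← val_sharp_timeField (g := g)]
  refine (g.isLorentzForm q.proj).ne_zero_of_causal_of_timelike (g.timelike_timeField q.proj) ?_
    (sharp_ne_zero hq)
  have h : g.val q.proj (g.sharp q.proj q.2) (g.sharp q.proj q.2)
      = q.2 (g.sharp q.proj q.2) := by rw [g.val_sharp]
  refine (h.trans ?_).le
  simpa [hamiltonian] using h0

/-- The bundle of future pointing null covectors is invariant under the geodesic flow. -/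
theorem geodesicFlow_mem_nullBundle (hq : q ∈ g.nullBundle) (ht : t ∈ g.geodesicDomain q) :
    g.geodesicFlow q t ∈ g.nullBundle := by
  have hH := (mem_nullBundle_iff.1 hq).1
  have h := g.isGeodesicFrom_geodesicFlow q
  -- A nonzero null vector is never orthogonal to a timelike one, so `p(T)` has no zero along the
  -- orbit and keeps its sign by the intermediate value theorem.
  have hne : ∀ s ∈ g.geodesicDomain q,
      (g.geodesicFlow q s).2 (g.timeField (g.geodesicFlow q s).proj) ≠ 0 := fun s hs =>
    apply_timeField_ne_zero ((hamiltonian_geodesicFlow hs).trans hH)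
      (geodesicFlow_snd_ne_zero (snd_ne_zero_of_mem_nullBundle hq) hs)
  refine mem_nullBundle_iff.2 ⟨(hamiltonian_geodesicFlow ht).trans hH, ?_⟩
  by_contra hpos
  have hcont : ContinuousOn (fun s => (g.geodesicFlow q s).2
      (g.timeField (g.geodesicFlow q s).proj)) (g.geodesicDomain q) := fun s hs =>
    (ContinuousAt.comp (f := g.geodesicFlow q) (g.continuousAt_apply_timeField _)
      (h.isGeodesicAt s hs).continuousAt).continuousWithinAt
  have h0 : (g.geodesicFlow q 0).2 (g.timeField (g.geodesicFlow q 0).proj) ≤ 0 := by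
    rw [geodesicFlow_zero]; exact (mem_nullBundle_iff.1 hq).2.le
  obtain ⟨s, hs, hs0⟩ := h.ordConnected.isPreconnected.intermediate_value h.zero_mem ht hcont
    ⟨h0, not_lt.1 hpos⟩
  exact hne s hs hs0

variable (g) in
/-- The geodesic flow is smooth at `(q, t)` and preserves there the values of the canonical one-form
on the velocities of curves of null covectors. -/
structure IsFlowRegularAt (q : CotangentBundle E M) (t : ℝ) : Prop where
  eventually_mem : ∀ᶠ r : CotangentBundle E M × ℝ in 𝓝 (q, t), r.2 ∈ g.geodesicDomain r.1
  contMDiffAt : ContMDiffAt ((cotangentModel E).prod 𝓘(ℝ, ℝ)) (cotangentModel E) ∞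
    (fun r : CotangentBundle E M × ℝ => g.geodesicFlow r.1 r.2) (q, t)
  oneFormVelocity_eq : ∀ (Z : ℝ → CotangentBundle E M) (τ : ℝ → ℝ), Z 0 = q → τ 0 = t →
    MDifferentiableAt 𝓘(ℝ, ℝ) (cotangentModel E) Z 0 → DifferentiableAt ℝ τ 0 →
    (∀ᶠ s in 𝓝 0, g.hamiltonian (Z s) = 0) →
    oneFormVelocity (fun s => g.geodesicFlow (Z s) (τ s)) 0 = oneFormVelocity Z 0

theorem IsFlowRegularAt.mdifferentiableAt (h : g.IsFlowRegularAt q t)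
    {Z : ℝ → CotangentBundle E M} {τ : ℝ → ℝ} (hZ0 : Z 0 = q) (hτ0 : τ 0 = t)
    (hZ : MDifferentiableAt 𝓘(ℝ, ℝ) (cotangentModel E) Z 0) (hτ : DifferentiableAt ℝ τ 0) :
    MDifferentiableAt 𝓘(ℝ, ℝ) (cotangentModel E) (fun s => g.geodesicFlow (Z s) (τ s)) 0 := by
  subst hZ0 hτ0
  have h1 := h.contMDiffAt.mdifferentiableAt (by simp)
  have h2 : MDifferentiableAt 𝓘(ℝ, ℝ) ((cotangentModel E).prod 𝓘(ℝ, ℝ))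
      (fun s => (Z s, τ s)) 0 := hZ.prodMk hτ.mdifferentiableAt
  exact MDifferentiableAt.comp (g := fun r : CotangentBundle E M × ℝ => g.geodesicFlow r.1 r.2)
    (0 : ℝ) h1 h2

-- The neighbourhood `V` with a common `ε` matters twice: for chaining short flows along an orbit,
-- and for extending a geodesic that returns near a cluster point.
variable (g) in
theorem eventually_isFlowRegularAt (q₀ : CotangentBundle E M) :
    ∃ V ∈ 𝓝 q₀, ∃ ε > 0, ∀ q ∈ V, ∀ t ∈ Ioo (-ε) ε, g.IsFlowRegularAt q t := by
  have hq₀ : q₀.proj ∈ (chartAt E q₀.proj).source := mem_chart_source E _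
  obtain ⟨U, ε, φ, hU, hqU, hε, hφ, hφ0, hφΩ, hφd, hφg⟩ := g.exists_local_geodesicFlow q₀
  set x₀ := q₀.proj with hx₀
  have hVev : ∀ q : CotangentBundle E M, q.proj ∈ (chartAt E x₀).source → natChart x₀ q ∈ U →
      ∀ᶠ r : CotangentBundle E M in 𝓝 q, r.proj ∈ (chartAt E x₀).source ∧ natChart x₀ r ∈ U :=
    fun q hq hqU => (eventually_mem_chart hq).and
      ((contMDiffAt_natChart hq).continuousAt.eventually_mem (hU.mem_nhds hqU))
  refine ⟨{q | q.proj ∈ (chartAt E x₀).source ∧ natChart x₀ q ∈ U}, hVev q₀ hq₀ hqU, ε, hε, ?_⟩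
  rintro q ⟨hq, hqz⟩ t ht
  have hev : ∀ᶠ r : CotangentBundle E M × ℝ in 𝓝 (q, t),
      (r.1.proj ∈ (chartAt E x₀).source ∧ natChart x₀ r.1 ∈ U) ∧ r.2 ∈ Ioo (-ε) ε :=
    ((hVev q hq hqz).prod_nhds (isOpen_Ioo.eventually_mem ht))
  have heq : ∀ r : CotangentBundle E M × ℝ, (r.1.proj ∈ (chartAt E x₀).source ∧
      natChart x₀ r.1 ∈ U) ∧ r.2 ∈ Ioo (-ε) ε →
      g.geodesicFlow r.1 r.2 = (natChart x₀).symm (φ (natChart x₀ r.1, r.2)) := fun r hr =>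
    (hφg r.1 hr.1.1 hr.1.2).geodesicFlow_eq hr.2
  have hsm : ContMDiffAt ((cotangentModel E).prod 𝓘(ℝ, ℝ)) (cotangentModel E) ∞
      (fun r : CotangentBundle E M × ℝ => g.geodesicFlow r.1 r.2) (q, t) := by
    have h1 : ContMDiffAt ((cotangentModel E).prod 𝓘(ℝ, ℝ)) 𝓘(ℝ, (E × (E →L[ℝ] ℝ)) × ℝ) ∞
        (fun r : CotangentBundle E M × ℝ => (natChart x₀ r.1, r.2)) (q, t) := by
      refine ContMDiffAt.prodMk_space ?_ contMDiffAt_snd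
      exact ContMDiffAt.comp (g := natChart x₀) (q, t) (contMDiffAt_natChart hq) contMDiffAt_fst
    have h2 : ContMDiffAt 𝓘(ℝ, (E × (E →L[ℝ] ℝ)) × ℝ) 𝓘(ℝ, E × (E →L[ℝ] ℝ)) ∞ φ
        (natChart x₀ q, t) :=
      (hφ.contDiffAt ((hU.prod isOpen_Ioo).mem_nhds ⟨hqz, ht⟩)).contMDiffAt
    have h3 := contMDiffAt_natChart_symm (E := E) (M := M) (x₀ := x₀) (hφΩ _ hqz t ht)
    have h4 := ContMDiffAt.comp (g := φ) (q, t) h2 h1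
    refine (ContMDiffAt.comp (g := ((natChart x₀).symm : _ → CotangentBundle E M))
      (q, t) h3 h4).congr_of_eventuallyEq ?_
    filter_upwards [hev] with r hr
    exact heq r hr
  refine ⟨hev.mono fun r hr => (hφg r.1 hr.1.1 hr.1.2).subset_geodesicDomain hr.2, hsm, ?_⟩
  rintro Z τ rfl rfl hZ hτ hH
  have hZev : ∀ᶠ s in 𝓝 (0 : ℝ), ((Z s).proj ∈ (chartAt E x₀).source ∧ natChart x₀ (Z s) ∈ U) ∧
      τ s ∈ Ioo (-ε) ε :=
    (hZ.continuousAt.prodMk hτ.continuousAt).eventually hev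
  obtain ⟨Y', hY, hYe⟩ := coordSpray_flow_preserves_oneForm
    (isOpen_extChartAt_target x₀) g.contDiffOn_coordInverse
    (fun x hx => g.coordInverse_symm hx) hU hε hφ hφ0 hφΩ hφd
    (hasDerivAt_natChart_comp hq hZ.hasMFDerivAt) hqz
    (by filter_upwards [hH, hZev] with s h1 h2; rw [← g.hamiltonian_eq h2.1.1, h1])
    hτ.hasDerivAt ht
  have hWev : ∀ᶠ s in 𝓝 (0 : ℝ), natChart x₀ (g.geodesicFlow (Z s) (τ s))
      = φ (natChart x₀ (Z s), τ s) := by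
    filter_upwards [hZev] with s hs
    rw [heq (Z s, τ s) hs, natChart_right_inv (hφΩ _ hs.1.2 _ hs.2)]
  have hWmem : (g.geodesicFlow (Z 0) (τ 0)).proj ∈ (chartAt E x₀).source := by
    rw [heq (Z 0, τ 0) ⟨⟨hq, hqz⟩, ht⟩]
    exact natChart_symm_mem (hφΩ _ hqz _ ht)
  have hWd : MDifferentiableAt 𝓘(ℝ, ℝ) (cotangentModel E)
      (fun s => g.geodesicFlow (Z s) (τ s)) 0 := by
    have h1 := hsm.mdifferentiableAt (by simp)
    have h2 : MDifferentiableAt 𝓘(ℝ, ℝ) ((cotangentModel E).prod 𝓘(ℝ, ℝ))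
        (fun s => (Z s, τ s)) 0 := hZ.prodMk hτ.mdifferentiableAt
    exact MDifferentiableAt.comp (g := fun r : CotangentBundle E M × ℝ => g.geodesicFlow r.1 r.2)
      (0 : ℝ) h1 h2
  rw [oneFormVelocity_eq (Z := fun s => g.geodesicFlow (Z s) (τ s)) hWmem hWd
    (hY.congr_of_eventuallyEq hWev), hWev.self_of_nhds, hYe,
    oneFormVelocity_eq hq hZ (hasDerivAt_natChart_comp hq hZ.hasMFDerivAt)]

/-- A time `r` near `s + t` is split as `r - s` followed by `s`. The variable part of the time goes
into the first flow, and the second has constant duration. -/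
theorem IsFlowRegularAt.trans (hs : g.IsFlowRegularAt (g.geodesicFlow q t) s)
    (ht : g.IsFlowRegularAt q t) : g.IsFlowRegularAt q (s + t) := by
  have hc : ContMDiffAt ((cotangentModel E).prod 𝓘(ℝ, ℝ))
      ((cotangentModel E).prod 𝓘(ℝ, ℝ)) ∞
      (fun r : CotangentBundle E M × ℝ => (g.geodesicFlow r.1 (r.2 - s), s)) (q, s + t) := by
    have h1 : ContMDiffAt ((cotangentModel E).prod 𝓘(ℝ, ℝ)) ((cotangentModel E).prod 𝓘(ℝ, ℝ)) ∞
        (fun r : CotangentBundle E M × ℝ => (r.1, r.2 - s)) (q, s + t) :=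
      contMDiffAt_fst.prodMk (contMDiffAt_snd.sub contMDiffAt_const)
    have h2 : ContMDiffAt ((cotangentModel E).prod 𝓘(ℝ, ℝ)) (cotangentModel E) ∞
      (fun r : CotangentBundle E M × ℝ => g.geodesicFlow r.1 r.2) (q, s + t - s) := by
      rw [add_sub_cancel_left]; exact ht.contMDiffAt
    exact (ContMDiffAt.comp (g := fun r : CotangentBundle E M × ℝ => g.geodesicFlow r.1 r.2)
      (q, s + t) h2 h1).prodMk contMDiffAt_const
  have hval : g.geodesicFlow q (s + t - s) = g.geodesicFlow q t := by rw [add_sub_cancel_left]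
  have hev : ∀ᶠ r : CotangentBundle E M × ℝ in 𝓝 (q, s + t),
      r.2 - s ∈ g.geodesicDomain r.1 ∧ s ∈ g.geodesicDomain (g.geodesicFlow r.1 (r.2 - s)) := by
    have h1 : ContinuousAt (fun r : CotangentBundle E M × ℝ => (r.1, r.2 - s)) (q, s + t) := by
      fun_prop
    have h2 := ht.eventually_mem
    have h3 := hs.eventually_mem
    rw [ContinuousAt, add_sub_cancel_left] at h1
    have h4 := hc.continuousAt
    rw [ContinuousAt, hval] at h4
    exact (h1.eventually h2).and (h4.eventually h3)
  have heq : ∀ r : CotangentBundle E M × ℝ,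
      r.2 - s ∈ g.geodesicDomain r.1 ∧ s ∈ g.geodesicDomain (g.geodesicFlow r.1 (r.2 - s)) →
      r.2 ∈ g.geodesicDomain r.1 ∧
        g.geodesicFlow r.1 r.2 = g.geodesicFlow (g.geodesicFlow r.1 (r.2 - s)) s := by
    rintro r ⟨h1, h2⟩
    have := add_mem_geodesicDomain h1 h2
    rwa [add_sub_cancel] at this
  refine ⟨hev.mono fun r hr => (heq r hr).1, ?_, ?_⟩
  · have h5 := hs.contMDiffAt
    rw [← hval] at h5
    refine (ContMDiffAt.comp (g := fun r : CotangentBundle E M × ℝ => g.geodesicFlow r.1 r.2)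
      (q, s + t) h5 hc).congr_of_eventuallyEq ?_
    filter_upwards [hev] with r hr
    exact (heq r hr).2
  · intro Z τ hZ0 hτ0 hZ hτ hH
    have hτ' : DifferentiableAt ℝ (fun u => τ u - s) 0 := hτ.sub_const s
    have hτ0' : (fun u => τ u - s) 0 = t := by simp [hτ0]
    have h1 := ht.oneFormVelocity_eq Z (fun u => τ u - s) hZ0 hτ0' hZ hτ' hH
    have h2 := ht.mdifferentiableAt hZ0 hτ0' hZ hτ'
    have hevZ : ∀ᶠ u in 𝓝 (0 : ℝ), τ u - s ∈ g.geodesicDomain (Z u) ∧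
        s ∈ g.geodesicDomain (g.geodesicFlow (Z u) (τ u - s)) := by
      have := hZ.continuousAt.prodMk hτ.continuousAt
      rw [ContinuousAt, hZ0, hτ0] at this
      exact this.eventually hev
    have h3 := hs.oneFormVelocity_eq (fun u => g.geodesicFlow (Z u) (τ u - s)) (fun _ => s)
      (by rw [hZ0, hτ0, add_sub_cancel_left]) rfl h2 (differentiableAt_const s) (by
        filter_upwards [hevZ, hH] with u hu hu'
        rw [hamiltonian_geodesicFlow hu.1, hu'])
    rw [← h1, ← h3]
    have h6 : (fun u => g.geodesicFlow (Z u) (τ u)) =ᶠ[𝓝 0]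
        fun u => g.geodesicFlow (g.geodesicFlow (Z u) (τ u - s)) s := by
      filter_upwards [hevZ] with u hu
      exact (heq (Z u, τ u) hu).2
    exact oneFormVelocity_congr h6

/-- The geodesic flow is regular on its domain. -/
theorem isFlowRegularAt (ht : t ∈ g.geodesicDomain q) : g.IsFlowRegularAt q t := by
  have h := g.isGeodesicFrom_geodesicFlow q
  -- Regularity of the flow from time `a` to time `b` holds for close times, in either order, and is
  -- transitive. On the connected domain it therefore holds for the pair `0`, `t`.
  have key := h.ordConnected.isPreconnected.induction₂'
    (fun a b => a ∈ g.geodesicDomain q → b ∈ g.geodesicDomain q →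
      g.IsFlowRegularAt (g.geodesicFlow q a) (b - a)) ?_ ?_ h.zero_mem ht h.zero_mem ht
  · rwa [geodesicFlow_zero, sub_zero] at key
  · intro a ha
    obtain ⟨V, hV, ε, hε, hreg⟩ := g.eventually_isFlowRegularAt (g.geodesicFlow q a)
    have h1 : ∀ᶠ b in 𝓝[g.geodesicDomain q] a, g.geodesicFlow q b ∈ V :=
      mem_nhdsWithin_of_mem_nhds ((h.isGeodesicAt a ha).continuousAt.eventually_mem hV)
    have h2 : ∀ᶠ b in 𝓝[g.geodesicDomain q] a, b ∈ Ioo (a - ε) (a + ε) :=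
      mem_nhdsWithin_of_mem_nhds (Ioo_mem_nhds (by linarith) (by linarith))
    filter_upwards [h1, h2] with b hb1 hb2
    exact ⟨fun _ _ => hreg _ (mem_of_mem_nhds hV) _ ⟨by linarith [hb2.1], by linarith [hb2.2]⟩,
      fun _ _ => hreg _ hb1 _ ⟨by linarith [hb2.2], by linarith [hb2.1]⟩⟩
  · intro a b d ha hb hd hab hbd ha' hd'
    have h1 := hab ha' hb
    have h2 := hbd hb hd'
    have h3 : g.geodesicFlow (g.geodesicFlow q a) (b - a) = g.geodesicFlow q b := by
      have := (mem_geodesicDomain_of_add (s := b - a) ha (by rwa [sub_add_cancel])).2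
      rwa [sub_add_cancel] at this
    rw [← h3] at h2
    have h4 := h2.trans h1
    rwa [sub_add_sub_cancel] at h4

end SpacetimeStructure

end FlowRegularity

/-! ## A priori bounds for null geodesics in a coordinate neighbourhood -/

section CausalBounds

variable {E : Type*} [NormedAddCommGroup E] [NormedSpace ℝ E] [FiniteDimensional ℝ E]

/-- On the unit sphere `B v v` and `|B v T|` cannot both be nonpositive, so by compactness their
maximum has a positive lower bound `m`. For `B'` within `m` of `B`, a nonzero vector causal for `B'`
has `B v v < m ‖v‖²`, and the bound must come from `|B v T|`. -/
theorem IsLorentzForm.exists_le_abs_apply {B : E →L[ℝ] E →L[ℝ] ℝ} (hB : IsLorentzForm B) {T : E}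
    (hT : B T T < 0) :
    ∃ m > 0, ∀ B' : E →L[ℝ] E →L[ℝ] ℝ, ‖B' - B‖ < m → ∀ v, B' v v ≤ 0 →
      m * ‖v‖ ≤ |B v T| := by
  have hpos : ∀ v ∈ Metric.sphere (0 : E) 1, 0 < max (B v v) |B v T| := by
    intro v hv
    by_contra! h
    rw [max_le_iff] at h
    have hv0 : v ≠ 0 := by
      rintro rfl
      simp at hv
    exact hB.ne_zero_of_causal_of_timelike hT h.1 hv0 (abs_nonpos_iff.1 h.2)
  obtain ⟨m, hm, hle⟩ := (isCompact_sphere (0 : E) 1).exists_forall_le'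
    (f := fun v => max (B v v) |B v T|) (by fun_prop) hpos
  refine ⟨m, hm, fun B' hB' v hv => ?_⟩
  rcases eq_or_ne v 0 with rfl | hv0
  · simp
  have hn : 0 < ‖v‖ := norm_pos_iff.2 hv0
  have hu := hle (‖v‖⁻¹ • v) (by simp [norm_smul, hn.ne'])
  have h1 : B v v < m * ‖v‖ ^ 2 := by
    have h2 : |(B' - B) v v| ≤ ‖B' - B‖ * ‖v‖ * ‖v‖ := (B' - B).le_opNorm₂ v v
    have h3 : (B' - B) v v = B' v v - B v v := by simp
    rw [h3, abs_le] at h2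
    have h4 : ‖B' - B‖ * ‖v‖ * ‖v‖ < m * ‖v‖ ^ 2 := by
      rw [mul_assoc, ← sq]
      exact mul_lt_mul_of_pos_right hB' (by positivity)
    linarith [h2.1]
  simp only [map_smul, smul_apply, smul_eq_mul, abs_mul, abs_inv, abs_norm] at hu
  rcases le_max_iff.1 hu with h | h
  · exfalso
    have : m * ‖v‖ ^ 2 ≤ B v v := by
      calc m * ‖v‖ ^ 2 ≤ (‖v‖⁻¹ * (‖v‖⁻¹ * B v v)) * ‖v‖ ^ 2 := by gcongr
        _ = B v v := by field_simp
    linarith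
  · calc m * ‖v‖ ≤ (‖v‖⁻¹ * |B v T|) * ‖v‖ := by gcongr
      _ = |B v T| := by field_simp

/-- Null geodesics which stay in a sufficiently small neighbourhood are bounded, in finite time. -/
theorem exists_nhds_null_bound {Ω : Set E} (hΩ : IsOpen Ω) {G : E → E →L[ℝ] E →L[ℝ] ℝ}
    {Q : E → (E →L[ℝ] ℝ) →L[ℝ] E} (hG : ContinuousOn G Ω) (hQ : ContDiffOn ℝ ∞ Q Ω)
    (hGQ : ∀ y ∈ Ω, ∀ p, G y (Q y p) = p) {y₀ : E} (hy₀ : y₀ ∈ Ω) (hL : IsLorentzForm (G y₀)) :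
    ∃ N ∈ 𝓝 y₀, ∀ (z : ℝ → E × (E →L[ℝ] ℝ)) (J : Set ℝ) (t₀ : ℝ), J.OrdConnected → t₀ ∈ J →
      (∀ t ∈ J, t₀ ≤ t → HasDerivAt z (coordSpray Q (z t)) t ∧ (z t).1 ∈ N ∧ (z t).2 ≠ 0 ∧
        (z t).2 (Q (z t).1 (z t).2) = 0) →
      ∃ R, ∀ t ∈ J, t₀ ≤ t → t ≤ R ∧ ‖(z t).2‖ ≤ R := by
  obtain ⟨T, hT, -⟩ := hL.2
  obtain ⟨m, hm, hmle⟩ := hL.exists_le_abs_apply hT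
  -- A linear time function: on vectors that are causal for a metric close to `G y₀`, its absolute
  -- value is comparable to the norm.
  let ℓ : E →L[ℝ] ℝ := (G y₀).flip T
  have hGat : ContinuousAt G y₀ := hG.continuousAt (hΩ.mem_nhds hy₀)
  have hQat : ContinuousAt Q y₀ := hQ.continuousOn.continuousAt (hΩ.mem_nhds hy₀)
  have hDQat : ContinuousAt (fderiv ℝ Q) y₀ :=
    (hQ.fderiv_of_isOpen (m := ∞) hΩ (by simp)).continuousOn.continuousAt (hΩ.mem_nhds hy₀)
  set a := ‖G y₀‖ + 1
  set b := ‖Q y₀‖ + 1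
  set d := ‖fderiv ℝ Q y₀‖ + 1
  have ha0 : 0 ≤ a := by positivity
  have hb0 : 0 ≤ b := by positivity
  have hd0 : 0 ≤ d := by positivity
  have hev : ∀ᶠ y in 𝓝 y₀, y ∈ Ω ∧ ‖G y - G y₀‖ < m ∧ ‖G y‖ < a ∧ ‖Q y‖ < b ∧
      ‖fderiv ℝ Q y‖ < d ∧ |ℓ y - ℓ y₀| < 1 / 2 := by
    refine (hΩ.eventually_mem hy₀).and (.and ?_ (.and ?_ (.and ?_ (.and ?_ ?_))))
    · have h : ContinuousAt (fun y => ‖G y - G y₀‖) y₀ := (hGat.sub continuousAt_const).norm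
      exact h.eventually_lt continuousAt_const (by simpa using hm)
    · exact hGat.norm.eventually_lt continuousAt_const (by simp [a])
    · exact hQat.norm.eventually_lt continuousAt_const (by simp [b])
    · exact hDQat.norm.eventually_lt continuousAt_const (by simp [d])
    · have h : ContinuousAt (fun y => |ℓ y - ℓ y₀|) y₀ := by fun_prop
      exact h.eventually_lt continuousAt_const (by simp)
  refine ⟨_, hev, fun z J t₀ hJ ht₀ hz => ?_⟩
  set D := {t | t ∈ J ∧ t₀ ≤ t} with hD
  have hDconv : Convex ℝ D := (hJ.inter ordConnected_Ici).convex
  have ht₀D : t₀ ∈ D := ⟨ht₀, le_rfl⟩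
  have hzD : ∀ t ∈ D, HasDerivAt z (coordSpray Q (z t)) t := fun t ht => (hz t ht.1 ht.2).1
  have hzN : ∀ t ∈ D, (z t).1 ∈ Ω ∧ ‖G (z t).1 - G y₀‖ < m ∧ ‖G (z t).1‖ < a ∧ ‖Q (z t).1‖ < b ∧
      ‖fderiv ℝ Q (z t).1‖ < d ∧ |ℓ (z t).1 - ℓ y₀| < 1 / 2 := fun t ht => (hz t ht.1 ht.2).2.1
  let v : ℝ → E := fun t => Q (z t).1 (z t).2
  have hGv : ∀ t ∈ D, G (z t).1 (v t) = (z t).2 := fun t ht => hGQ _ (hzN t ht).1 _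
  have hv0 : ∀ t ∈ D, v t ≠ 0 := by
    intro t ht h0
    apply (hz t ht.1 ht.2).2.2.1
    rw [← hGv t ht, h0, map_zero]
  have hlow : ∀ t ∈ D, m * ‖v t‖ ≤ |ℓ (v t)| := by
    intro t ht
    refine hmle _ (hzN t ht).2.1 (v t) ?_
    rw [hGv t ht]
    exact (hz t ht.1 ht.2).2.2.2.le
  have hp : ∀ t ∈ D, ‖(z t).2‖ ≤ a * ‖v t‖ := by
    intro t ht
    rw [← hGv t ht]
    exact ((G (z t).1).le_opNorm (v t)).trans (by gcongr; exact (hzN t ht).2.2.1.le)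
  -- The geodesic equation is quadratic in velocity and momentum, and the momentum is bounded by a
  -- multiple of the velocity.
  have hvd : ∀ t ∈ D, ∃ v', HasDerivAt v v' t ∧ ‖v'‖ ≤ (d * a + b * d * a ^ 2) * ‖v t‖ ^ 2 := by
    intro t ht
    obtain ⟨A, hA, hAw⟩ := hasFDerivAt_coordSpray_fst (z := z t)
      ((hQ.contDiffAt (hΩ.mem_nhds (hzN t ht).1)).differentiableAt (by simp))
    refine ⟨_, hA.comp_hasDerivAt t (hzD t ht), ?_⟩
    rw [hAw]
    have hpt := hp t ht
    have h1 : ‖fderiv ℝ Q (z t).1 (coordSpray Q (z t)).1 (z t).2‖ ≤ d * ‖v t‖ * (a * ‖v t‖) := by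
      refine ((fderiv ℝ Q (z t).1).le_opNorm₂ _ _).trans ?_
      gcongr
      exacts [(hzN t ht).2.2.2.2.1.le, le_rfl]
    have h2 : ‖(coordSpray Q (z t)).2‖ ≤ d * (a * ‖v t‖) ^ 2 := by
      refine ContinuousLinearMap.opNorm_le_bound _ (by positivity) fun e => ?_
      rw [coordSpray_snd_apply, norm_neg, norm_mul]
      have h3 : ‖(z t).2 (fderiv ℝ Q (z t).1 e (z t).2)‖ ≤
          (a * ‖v t‖) * (d * ‖e‖ * (a * ‖v t‖)) := by
        refine ((z t).2.le_opNorm _).trans ?_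
        gcongr
        refine ((fderiv ℝ Q (z t).1).le_opNorm₂ _ _).trans ?_
        gcongr
        exact (hzN t ht).2.2.2.2.1.le
      calc ‖(1 / 2 : ℝ)‖ * ‖(z t).2 (fderiv ℝ Q (z t).1 e (z t).2)‖
          ≤ 1 * ((a * ‖v t‖) * (d * ‖e‖ * (a * ‖v t‖))) := by
            gcongr
            norm_num
        _ = d * (a * ‖v t‖) ^ 2 * ‖e‖ := by ring
    have h4 : ‖Q (z t).1 (coordSpray Q (z t)).2‖ ≤ b * (d * (a * ‖v t‖) ^ 2) := by
      refine ((Q (z t).1).le_opNorm _).trans ?_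
      gcongr
      exact (hzN t ht).2.2.2.1.le
    calc _ ≤ d * ‖v t‖ * (a * ‖v t‖) + b * (d * (a * ‖v t‖) ^ 2) := norm_add_le_of_le h1 h4
      _ = _ := by ring
  choose! v' hv' hv'le using hvd
  -- The sign `σ` covers both time directions: the estimate assumes the covector null and nonzero,
  -- but not future pointing.
  obtain ⟨σ, hσ, hσ0⟩ : ∃ σ : ℝ, |σ| = 1 ∧ 0 < σ * ℓ (v t₀) := by
    have h0 : ℓ (v t₀) ≠ 0 := fun h0 => by
      have := hlow t₀ ht₀D
      rw [h0, abs_zero] at this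
      have := mul_pos hm (norm_pos_iff.2 (hv0 t₀ ht₀D))
      linarith
    rcases lt_or_gt_of_ne h0 with h | h
    · exact ⟨-1, by simp, by linarith⟩
    · exact ⟨1, by simp, by linarith⟩
  have hwd : ∀ t ∈ D, HasDerivAt (fun t => σ * ℓ (v t)) (σ * ℓ (v' t)) t := fun t ht =>
    (ℓ.hasFDerivAt.comp_hasDerivAt t (hv' t ht)).const_mul σ
  have hyd : ∀ t ∈ D, HasDerivAt (fun t => σ * ℓ (z t).1) (σ * ℓ (v t)) t := fun t ht =>
    (ℓ.hasFDerivAt.comp_hasDerivAt t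
      ((ContinuousLinearMap.fst ℝ E (E →L[ℝ] ℝ)).hasFDerivAt.comp_hasDerivAt t (hzD t ht))).const_mul σ
  have hwpos : ∀ t ∈ D, 0 < σ * ℓ (v t) := by
    intro t ht
    by_contra! hneg
    have hcont : ContinuousOn (fun t => σ * ℓ (v t)) D := fun s hs =>
      (hwd s hs).continuousAt.continuousWithinAt
    obtain ⟨s, hs, hs0⟩ := hDconv.isPreconnected.intermediate_value ht ht₀D hcont ⟨hneg, hσ0.le⟩
    have h1 := hlow s hs
    have h2 : |ℓ (v s)| = 0 := by
      have : |σ * ℓ (v s)| = 0 := by simpa using hs0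
      rwa [abs_mul, hσ, one_mul] at this
    have := mul_pos hm (norm_pos_iff.2 (hv0 s hs))
    linarith
  set C := ‖ℓ‖ * (d * a + b * d * a ^ 2) / m ^ 2
  have hC : 0 ≤ C := by positivity
  have hw' : ∀ t ∈ D, |σ * ℓ (v' t)| ≤ C * (σ * ℓ (v t)) ^ 2 := by
    intro t ht
    have h1 : (σ * ℓ (v t)) ^ 2 = |ℓ (v t)| ^ 2 := by
      rw [← sq_abs, abs_mul, hσ, one_mul]
    rw [abs_mul, hσ, one_mul, h1]
    have h2 : (m * ‖v t‖) ^ 2 ≤ |ℓ (v t)| ^ 2 := by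
      gcongr
      exact hlow t ht
    calc |ℓ (v' t)| ≤ ‖ℓ‖ * ‖v' t‖ := ℓ.le_opNorm _
      _ ≤ ‖ℓ‖ * ((d * a + b * d * a ^ 2) * ‖v t‖ ^ 2) := by gcongr; exact hv'le t ht
      _ = C * (m * ‖v t‖) ^ 2 := by simp only [C]; field_simp
      _ ≤ _ := by gcongr
  have hY : ∀ t ∈ D, |σ * ℓ (z t).1 - σ * ℓ (z t₀).1| ≤ 1 := by
    intro t ht
    rw [← mul_sub, abs_mul, hσ, one_mul]
    have h1 := abs_lt.1 (hzN t ht).2.2.2.2.2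
    have h2 := abs_lt.1 (hzN t₀ ht₀D).2.2.2.2.2
    rw [abs_le]
    constructor <;> linarith [h1.1, h1.2, h2.1, h2.2]
  have hbounds := bounds_of_abs_deriv_le_mul_sq hDconv ht₀D (fun t ht => ht.2) hyd hwd hC hw' hwpos hY
  set w₀ := σ * ℓ (v t₀)
  set w₁ := w₀ * Real.exp (-(C * 1))
  set w₂ := w₀ * Real.exp (C * 1)
  have hw₁ : 0 < w₁ := by positivity
  have hw₂ : 0 < w₂ := by positivity
  -- The function `σ ℓ` grows at rate at least `w₁` along the curve but changes by at most `1`,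
  -- which bounds the time. The upper bound `w₂` for the rate bounds the velocity, hence the
  -- momentum.
  refine ⟨max (t₀ + 1 / w₁) (a * (w₂ / m)), fun t ht htt => ⟨le_max_of_le_left ?_, le_max_of_le_right ?_⟩⟩
  · have hmono : MonotoneOn (fun t => σ * ℓ (z t).1 - w₁ * t) D := by
      refine monotoneOn_of_deriv_nonneg hDconv (fun s hs => ?_) (fun s hs => ?_) (fun s hs => ?_)
      · exact ((hyd s hs).sub ((hasDerivAt_id s).const_mul w₁)).continuousAt.continuousWithinAt
      · exact ((hyd s (interior_subset hs)).sub
          ((hasDerivAt_id s).const_mul w₁)).differentiableAt.differentiableWithinAt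
      · have h1 := ((hyd s (interior_subset hs)).sub ((hasDerivAt_id s).const_mul w₁)).deriv
        have h2 : deriv (fun t => σ * ℓ (z t).1 - w₁ * t) s = σ * ℓ (v s) - w₁ * 1 := h1
        rw [h2]
        linarith [(hbounds s (interior_subset hs)).1]
    have h1 := hmono ht₀D ⟨ht, htt⟩ htt
    have h2 := (abs_le.1 (hY t ⟨ht, htt⟩)).2
    have h3 : w₁ * (t - t₀) ≤ 1 := by
      simp only at h1
      linarith
    have h4 : t - t₀ ≤ 1 / w₁ := by
      rw [le_div_iff₀ hw₁]
      linarith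
    linarith
  · refine (hp t ⟨ht, htt⟩).trans ?_
    gcongr
    rw [le_div_iff₀ hm, mul_comm]
    refine (hlow t ⟨ht, htt⟩).trans ?_
    have h1 := (hbounds t ⟨ht, htt⟩).2
    have h2 : |ℓ (v t)| = |σ * ℓ (v t)| := by rw [abs_mul, hσ, one_mul]
    rw [h2, abs_of_pos (hwpos t ⟨ht, htt⟩)]
    exact h1

end CausalBounds

/-! ## Maximal null geodesics are inextendible causal curves -/

section Inextendible

variable {E : Type*} [NormedAddCommGroup E] [NormedSpace ℝ E] [FiniteDimensional ℝ E]
  {M : Type*} [TopologicalSpace M] [ChartedSpace E M] [IsManifold 𝓘(ℝ, E) ∞ M] [T2Space M]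

namespace SpacetimeStructure

variable {g : SpacetimeStructure E M} {q : CotangentBundle E M} {t : ℝ}

/-- A limit point would confine the end of the lifted curve to a compact set of natural coordinates
and to bounded time, by `exists_nhds_null_bound`. Near a cluster point the flow exists for a uniform
time, so the curve could be continued beyond the supremum of its maximal interval. -/
theorem not_tendsto_geodesicFlow_proj_atTop (hH : g.hamiltonian q = 0) (hq : q.2 ≠ 0) (x : M) :
    ¬ Tendsto (fun t : g.geodesicDomain q => (g.geodesicFlow q t).proj) atTop (𝓝 x) := by
  intro hlim
  have h := g.isGeodesicFrom_geodesicFlow q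
  have hne : Nonempty (g.geodesicDomain q) := ⟨⟨0, h.zero_mem⟩⟩
  have hx : x ∈ (chartAt E x).source := mem_chart_source E x
  have hy : extChartAt 𝓘(ℝ, E) x x ∈ (extChartAt 𝓘(ℝ, E) x).target := mem_extChartAt_target x
  obtain ⟨N, hN, hbound⟩ := exists_nhds_null_bound (isOpen_extChartAt_target (I := 𝓘(ℝ, E)) x)
    g.contDiffOn_coordMetric.continuousOn g.contDiffOn_coordInverse
    (fun y hy p => g.coordMetric_coordInverse hy p) hy (g.coordMetric_isLorentzForm hy)
  obtain ⟨r, hr, hrsub⟩ := Metric.nhds_basis_closedBall.mem_iff.1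
    ((isOpen_extChartAt_target (I := 𝓘(ℝ, E)) x).mem_nhds hy)
  have hev : ∀ᶠ x' in 𝓝 x, x' ∈ (chartAt E x).source ∧ extChartAt 𝓘(ℝ, E) x x' ∈ N ∧
      extChartAt 𝓘(ℝ, E) x x' ∈ Metric.closedBall (extChartAt 𝓘(ℝ, E) x x) r :=
    ((chartAt E x).open_source.eventually_mem hx).and
      (((continuousAt_extChartAt x).eventually_mem hN).and
        ((continuousAt_extChartAt x).eventually_mem (Metric.closedBall_mem_nhds _ hr)))
  obtain ⟨⟨t₀, ht₀⟩, hev₀⟩ := eventually_atTop.1 (hlim.eventually hev)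
  have hev' : ∀ t ∈ g.geodesicDomain q, t₀ ≤ t →
      (g.geodesicFlow q t).proj ∈ (chartAt E x).source ∧
      (natChart x (g.geodesicFlow q t)).1 ∈ N ∧
      (natChart x (g.geodesicFlow q t)).1 ∈ Metric.closedBall (extChartAt 𝓘(ℝ, E) x x) r := by
    intro t ht htt
    rw [natChart_fst]
    exact hev₀ ⟨t, ht⟩ htt
  obtain ⟨R, hR⟩ := hbound (fun t => natChart x (g.geodesicFlow q t)) (g.geodesicDomain q) t₀
    h.ordConnected ht₀ (fun t ht htt => by
      obtain ⟨h1, h2, -⟩ := hev' t ht htt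
      refine ⟨(h.isGeodesicAt t ht).hasDerivAt h1, h2, fun h0 => ?_, ?_⟩
      · refine geodesicFlow_snd_ne_zero hq ht ?_
        ext u
        rw [← natChart_snd h1 u, h0]
        rfl
      · have h3 := (hamiltonian_geodesicFlow ht).trans hH
        rw [g.hamiltonian_eq h1] at h3
        simpa [coordHamiltonian] using h3)
  have hbdd : BddAbove (g.geodesicDomain q) := ⟨max t₀ R, fun t ht => by
    rcases le_total t₀ t with htt | htt
    · exact le_max_of_le_right (hR t ht htt).1
    · exact le_max_of_le_left htt⟩
  obtain ⟨z, hz, hcl⟩ := ((isCompact_closedBall (extChartAt 𝓘(ℝ, E) x x) r).prod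
      (isCompact_closedBall (0 : E →L[ℝ] ℝ) R)).exists_mapClusterPt_of_frequently (l := atTop)
      (f := fun t : g.geodesicDomain q => natChart x (g.geodesicFlow q t)) (by
        refine Eventually.frequently ?_
        filter_upwards [eventually_ge_atTop (⟨t₀, ht₀⟩ : g.geodesicDomain q)] with t ht
        exact ⟨(hev' t t.2 ht).2.2, by simpa using (hR t t.2 ht).2⟩)
  have hzt : z.1 ∈ (extChartAt 𝓘(ℝ, E) x).target := hrsub hz.1
  obtain ⟨V, hV, ε, hε, hreg⟩ := g.eventually_isFlowRegularAt ((natChart x).symm z)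
  have hV' : ∀ᶠ z' in 𝓝 z, ((natChart x).symm z' : CotangentBundle E M) ∈ V :=
    (contMDiffAt_natChart_symm hzt).continuousAt.eventually_mem hV
  -- After `t₁` less than `ε / 2` remains before the supremum, while from a point of `V` the curve
  -- can be continued by `ε / 2`.
  obtain ⟨t₁, ht₁, hlt⟩ := exists_lt_of_lt_csSup ⟨0, h.zero_mem⟩
    (show sSup (g.geodesicDomain q) - ε / 2 < sSup (g.geodesicDomain q) by linarith)
  obtain ⟨⟨t, ht⟩, ⟨htV, ht₁t⟩, htt⟩ := ((hcl.frequently hV').and_eventually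
    ((eventually_ge_atTop (⟨t₁, ht₁⟩ : g.geodesicDomain q)))).and_eventually
    (eventually_ge_atTop (⟨t₀, ht₀⟩ : g.geodesicDomain q)) |>.exists
  simp only [Subtype.mk_le_mk] at ht₁t htt
  rw [natChart_left_inv (hev' t ht htt).1] at htV
  have h5 : ε / 2 ∈ g.geodesicDomain (g.geodesicFlow q t) :=
    (hreg _ htV (ε / 2) ⟨by linarith, by linarith⟩).eventually_mem.self_of_nhds
  have h6 := le_csSup hbdd (add_mem_geodesicDomain ht h5).1
  linarith

theorem isGeodesicFrom_scale {a : ℝ} :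
    g.IsGeodesicFrom (scaleCovector a q) (fun s => scaleCovector a (g.geodesicFlow q (a * s)))
      ((fun s => a * s) ⁻¹' g.geodesicDomain q) where
  isOpen := (g.isGeodesicFrom_geodesicFlow q).isOpen.preimage (by fun_prop)
  ordConnected := by
    have hc := (g.isGeodesicFrom_geodesicFlow q).ordConnected
    refine ⟨fun u hu v hv w hw => ?_⟩
    refine hc.uIcc_subset hu hv ?_
    rw [mem_uIcc]
    rcases le_total 0 a with ha | ha
    · exact Or.inl ⟨mul_le_mul_of_nonneg_left hw.1 ha, mul_le_mul_of_nonneg_left hw.2 ha⟩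
    · exact Or.inr ⟨mul_le_mul_of_nonpos_left hw.2 ha, mul_le_mul_of_nonpos_left hw.1 ha⟩
  zero_mem := by
    simpa using g.zero_mem_geodesicDomain q
  isGeodesicAt s hs := by
    have h := IsGeodesicAt.scale (a := a) (b := 0) (t := s) (g := g) (c := g.geodesicFlow q)
      (by simpa using (g.isGeodesicFrom_geodesicFlow q).isGeodesicAt _ hs)
    simpa only [add_zero] using h
  start := by simp [geodesicFlow_zero]

theorem scaleCovector_scaleCovector (a b : ℝ) (q : CotangentBundle E M) :
    scaleCovector a (scaleCovector b q) = scaleCovector (a * b) q :=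
  congrArg (Bundle.TotalSpace.mk q.proj) (smul_smul a b q.2)

theorem hamiltonian_scaleCovector (a : ℝ) (q : CotangentBundle E M) :
    g.hamiltonian (scaleCovector a q) = a ^ 2 * g.hamiltonian q := by
  have h : g.sharp q.proj (a • q.2) = a • g.sharp q.proj q.2 :=
    map_smul (g.val q.proj).inverse a q.2
  change (1 / 2) * (a • q.2) (g.sharp q.proj (a • q.2)) = a ^ 2 * ((1 / 2) * q.2 (g.sharp q.proj q.2))
  rw [h, map_smul, smul_apply]
  simp only [smul_eq_mul]
  ring

/-- One direction is `isGeodesicFrom_scale`; the other is the same lemma for the factor `a⁻¹`. -/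
theorem mem_geodesicDomain_scale {a s : ℝ} (ha : a ≠ 0) :
    s ∈ g.geodesicDomain (scaleCovector a q) ↔ a * s ∈ g.geodesicDomain q := by
  constructor
  · intro hs
    have h := (isGeodesicFrom_scale (g := g) (q := scaleCovector a q) (a := a⁻¹))
    rw [scaleCovector_scaleCovector, inv_mul_cancel₀ ha, scaleCovector_one] at h
    refine h.subset_geodesicDomain ?_
    simpa [ha] using hs
  · intro hs
    exact isGeodesicFrom_scale.subset_geodesicDomain hs

theorem geodesicFlow_scale {a s : ℝ} (hs : a * s ∈ g.geodesicDomain q) :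
    g.geodesicFlow (scaleCovector a q) s = scaleCovector a (g.geodesicFlow q (a * s)) :=
  isGeodesicFrom_scale.geodesicFlow_eq hs

/-- Time reversal, by scaling covectors with `-1`. This destroys future directedness, so both
statements on endpoints assume only `H = 0` and a nonzero covector. -/
theorem not_tendsto_geodesicFlow_proj_atBot (hH : g.hamiltonian q = 0) (hq : q.2 ≠ 0) (x : M) :
    ¬ Tendsto (fun t : g.geodesicDomain q => (g.geodesicFlow q t).proj) atBot (𝓝 x) := by
  intro hlim
  refine not_tendsto_geodesicFlow_proj_atTop (g := g) (q := scaleCovector (-1) q)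
    (by rw [hamiltonian_scaleCovector, hH, mul_zero]) ?_ x ?_
  · change (-1 : ℝ) • q.2 ≠ 0
    exact smul_ne_zero (by norm_num) hq
  · have hmem : ∀ t : g.geodesicDomain (scaleCovector (-1) q), (-1 : ℝ) * t ∈ g.geodesicDomain q :=
      fun t => (mem_geodesicDomain_scale (by norm_num)).1 t.2
    have h1 : Tendsto (fun t : g.geodesicDomain (scaleCovector (-1) q) =>
        (⟨(-1 : ℝ) * t, hmem t⟩ : g.geodesicDomain q)) atTop atBot := by
      refine tendsto_atTop_atBot_of_antitone (fun a b hab => ?_) fun b => ?_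
      · simpa using hab
      · refine ⟨⟨(-1 : ℝ) * b, (mem_geodesicDomain_scale (by norm_num)).2 (by simp)⟩, ?_⟩
        simp
    refine (hlim.comp h1).congr fun t => ?_
    rw [geodesicFlow_scale (hmem t)]
    rfl

theorem contMDiffAt_geodesicFlow_proj (ht : t ∈ g.geodesicDomain q) :
    ContMDiffAt 𝓘(ℝ, ℝ) 𝓘(ℝ, E) ∞ (fun s => (g.geodesicFlow q s).proj) t := by
  have h1 : ContMDiffAt 𝓘(ℝ, ℝ) ((cotangentModel E).prod 𝓘(ℝ, ℝ)) ∞ (fun s : ℝ => (q, s)) t :=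
    contMDiffAt_const.prodMk contMDiffAt_id
  have h2 := ContMDiffAt.comp (g := fun r : CotangentBundle E M × ℝ => g.geodesicFlow r.1 r.2)
    t (isFlowRegularAt ht).contMDiffAt h1
  exact ContMDiffAt.comp (g := fun r : CotangentBundle E M => r.proj) t
    (Bundle.contMDiffAt_proj _) h2

/-- Hamilton's first equation. It makes the projected curve causal and future directed. -/
theorem mfderiv_geodesicFlow_proj (ht : t ∈ g.geodesicDomain q) :
    mfderiv 𝓘(ℝ, ℝ) 𝓘(ℝ, E) (fun s => (g.geodesicFlow q s).proj) t (1 : ℝ)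
      = g.sharp (g.geodesicFlow q t).proj (g.geodesicFlow q t).2 := by
  set r := g.geodesicFlow q t with hr
  have hx : r.proj ∈ (chartAt E r.proj).source := mem_chart_source E _
  refine chartDeriv_injective hx ?_
  have h1 := (g.isGeodesicFrom_geodesicFlow q).isGeodesicAt t ht
  have hd := h1.hasDerivAt (x₀ := r.proj) hx
  have h2 : HasMFDerivAt 𝓘(ℝ, ℝ) 𝓘(ℝ, E) (fun s => (g.geodesicFlow q s).proj) t
      (mfderiv 𝓘(ℝ, ℝ) 𝓘(ℝ, E) (fun s => (g.geodesicFlow q s).proj) t) :=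
    ((contMDiffAt_geodesicFlow_proj ht).mdifferentiableAt (by simp)).hasMFDerivAt
  have h3 : HasFDerivAt (fun s => extChartAt 𝓘(ℝ, E) r.proj (g.geodesicFlow q s).proj)
      ((chartDeriv r.proj r.proj).comp
        (mfderiv 𝓘(ℝ, ℝ) 𝓘(ℝ, E) (fun s => (g.geodesicFlow q s).proj) t) : ℝ →L[ℝ] E) t :=
    (HasMFDerivAt.comp t (hasMFDerivAt_extChartAt_base hx) h2).hasFDerivAt
  have h4 : HasDerivAt (fun s => extChartAt 𝓘(ℝ, E) r.proj (g.geodesicFlow q s).proj)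
      (coordSpray (g.coordInverse r.proj) (natChart r.proj r)).1 t := by
    refine (((ContinuousLinearMap.fst ℝ E (E →L[ℝ] ℝ)).hasFDerivAt.comp_hasDerivAt t
      hd)).congr_of_eventuallyEq (Eventually.of_forall fun s => ?_)
    exact (natChart_fst _).symm
  rw [g.chartDeriv_sharp hx]
  exact h3.hasDerivAt.unique h4

/-- A maximal null geodesic is an inextendible causal curve. -/
theorem isInextendibleCausalCurveOn_geodesicFlow (hq : q ∈ g.nullBundle) :
    g.IsInextendibleCausalCurveOn (fun t => (g.geodesicFlow q t).proj) (g.geodesicDomain q) where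
  isOpen := (g.isGeodesicFrom_geodesicFlow q).isOpen
  ordConnected := (g.isGeodesicFrom_geodesicFlow q).ordConnected
  nonempty := ⟨0, g.zero_mem_geodesicDomain q⟩
  contMDiffOn t ht := (contMDiffAt_geodesicFlow_proj ht).contMDiffWithinAt
  causal t ht := by
    rw [mfderiv_geodesicFlow_proj ht]
    exact (geodesicFlow_mem_nullBundle hq ht).2
  no_future_endpoint := fun ⟨x, hx⟩ => not_tendsto_geodesicFlow_proj_atTop
    (mem_nullBundle_iff.1 hq).1 (snd_ne_zero_of_mem_nullBundle hq) x hx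
  no_past_endpoint := fun ⟨x, hx⟩ => not_tendsto_geodesicFlow_proj_atBot
    (mem_nullBundle_iff.1 hq).1 (snd_ne_zero_of_mem_nullBundle hq) x hx

end SpacetimeStructure

end Inextendible

/-! ## Null lifts of unit covectors -/

section NullLift

variable {E : Type*} [NormedAddCommGroup E] [NormedSpace ℝ E] [FiniteDimensional ℝ E]
  {M : Type*} [TopologicalSpace M] [ChartedSpace E M] [IsManifold 𝓘(ℝ, E) ∞ M]
  {F : Type*} [NormedAddCommGroup F] [NormedSpace ℝ F] [FiniteDimensional ℝ F]
  {S : Type*} [TopologicalSpace S] [ChartedSpace F S] [IsManifold 𝓘(ℝ, F) ∞ S]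

namespace SpacetimeStructure

variable {g : SpacetimeStructure E M} {ι : S → M}

theorem sharp_val (x : M) (v : TangentSpace 𝓘(ℝ, E) x) : g.sharp x (g.val x v) = v :=
  (g.isInvertible x).inverse_apply_self v

theorem val_sharp_apply (x : M) (p : TangentSpace 𝓘(ℝ, E) x →L[ℝ] ℝ)
    (v : TangentSpace 𝓘(ℝ, E) x) : g.val x (g.sharp x p) v = p v := by
  rw [g.val_sharp]

theorem val_apply_sharp (x : M) (v : TangentSpace 𝓘(ℝ, E) x)
    (p : TangentSpace 𝓘(ℝ, E) x →L[ℝ] ℝ) : g.val x v (g.sharp x p) = p v := by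
  rw [g.symm, g.val_sharp]

theorem val_neg_of_future {x : M} {v w T : TangentSpace 𝓘(ℝ, E) x} (hT : g.val x T T < 0)
    (hv : g.val x v v ≤ 0) (hvT : g.val x v T < 0) (hw : g.val x w w < 0)
    (hwT : g.val x w T < 0) : g.val x v w < 0 :=
  IsLorentzForm.neg_of_future (E := E) (g.isLorentzForm x) hT hv hvT hw hwT

variable (hS : ∀ (x : S) (u : TangentSpace 𝓘(ℝ, F) x), u ≠ 0 → 0 < g.inducedMetric ι x u u)
  (hdim : Module.finrank ℝ F + 1 = Module.finrank ℝ E)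

include hS hdim

theorem exists_isUnitFutureConormal (x : S) : ∃ n, g.IsUnitFutureConormal (F := F) ι x n := by
  obtain ⟨N, hN, hNN, hNT⟩ : ∃ N : TangentSpace 𝓘(ℝ, E) (ι x),
      (∀ u : TangentSpace 𝓘(ℝ, F) x, g.val (ι x) N (mfderiv 𝓘(ℝ, F) 𝓘(ℝ, E) ι x u) = 0) ∧
      g.val (ι x) N N = -1 ∧ g.val (ι x) N (g.timeField (ι x)) < 0 :=
    IsLorentzForm.exists_unit_normal (E := E) (F := F)
    (g.isLorentzForm (ι x)) (A := mfderiv 𝓘(ℝ, F) 𝓘(ℝ, E) ι x) (hS x) hdim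
    (g.timelike_timeField (ι x))
  refine ⟨g.val (ι x) N, hN, ?_, ?_, ?_⟩
  · rw [sharp_val]; exact hNN
  · rw [sharp_val]; exact (hNN.trans_lt (by norm_num)).le
  · rw [sharp_val]; exact hNT

theorem IsUnitFutureConormal.eq {x : S} {n m : TangentSpace 𝓘(ℝ, E) (ι x) →L[ℝ] ℝ}
    (hn : g.IsUnitFutureConormal (F := F) ι x n) (hm : g.IsUnitFutureConormal (F := F) ι x m) :
    m = n := by
  have h := unit_normal_unique (E := E) (F := F) (B := g.val (ι x))
    (A := mfderiv 𝓘(ℝ, F) 𝓘(ℝ, E) ι x) (hS x) hdim (T := g.timeField (ι x))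
    (n := g.sharp (ι x) n) (m := g.sharp (ι x) m)
    (fun u => (val_sharp_apply _ _ _).trans (hn.1 u)) ((val_sharp_apply _ _ _).trans hn.2.1)
    hn.2.2.2
    (fun u => (val_sharp_apply _ _ _).trans (hm.1 u)) ((val_sharp_apply _ _ _).trans hm.2.1)
    hm.2.2.2
  rw [← g.val_sharp (ι x) n, ← g.val_sharp (ι x) m]
  exact congrArg (g.val (ι x)) h

theorem IsUnitFutureConormal.exists_eq_add_smul {x : S}
    {n : TangentSpace 𝓘(ℝ, E) (ι x) →L[ℝ] ℝ} (hn : g.IsUnitFutureConormal (F := F) ι x n)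
    (e : TangentSpace 𝓘(ℝ, E) (ι x)) :
    ∃ (u : TangentSpace 𝓘(ℝ, F) x) (c : ℝ),
      e = mfderiv 𝓘(ℝ, F) 𝓘(ℝ, E) ι x u + c • g.sharp (ι x) n := by
  refine exists_eq_add_smul_of_orthogonal (E := E) (F := F) (B := g.val (ι x))
    (A := mfderiv 𝓘(ℝ, F) 𝓘(ℝ, E) ι x) (hS x) hdim (n := g.sharp (ι x) n) ?_
    (fun u => (val_sharp_apply _ _ _).trans (hn.1 u)) e
  intro h0
  have h1 := congrArg n (show g.sharp (ι x) n = (0 : TangentSpace 𝓘(ℝ, E) (ι x)) from h0)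
  rw [hn.2.1, map_zero] at h1
  norm_num at h1

theorem IsNullLift.eq {q : CotangentBundle F S} {p p' : TangentSpace 𝓘(ℝ, E) (ι q.proj) →L[ℝ] ℝ}
    (hp : g.IsNullLift ι q p) (hp' : g.IsNullLift ι q p') : p = p' := by
  obtain ⟨n, v, hn, hv, hvq, rfl⟩ := hp
  obtain ⟨n', v', hn', hv', hvq', rfl⟩ := hp'
  obtain rfl := IsUnitFutureConormal.eq hS hdim hn hn'
  congr 1
  ext e
  obtain ⟨u, c, rfl⟩ := IsUnitFutureConormal.exists_eq_add_smul hS hdim hn e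
  rw [map_add, map_add, map_smul, map_smul, hv, hv', hvq, hvq']

omit hS hdim in
theorem IsNullLift.apply_mfderiv {q : CotangentBundle F S}
    {p : TangentSpace 𝓘(ℝ, E) (ι q.proj) →L[ℝ] ℝ} (hp : g.IsNullLift ι q p)
    (u : TangentSpace 𝓘(ℝ, F) q.proj) : p (mfderiv 𝓘(ℝ, F) 𝓘(ℝ, E) ι q.proj u) = q.2 u := by
  obtain ⟨n, v, hn, hv, hvq, rfl⟩ := hp
  rw [add_apply, hvq, hn.1, add_zero]

omit hS hdim in
theorem IsNullLift.apply_sharp_conormal {q : CotangentBundle F S}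
    {p n : TangentSpace 𝓘(ℝ, E) (ι q.proj) →L[ℝ] ℝ} (hp : g.IsNullLift ι q p)
    (hn : ∀ m, g.IsUnitFutureConormal (F := F) ι q.proj m → m = n) :
    p (g.sharp (ι q.proj) n) = -1 := by
  obtain ⟨m, v, hm, hv, hvq, rfl⟩ := hp
  obtain rfl := hn m hm
  rw [add_apply, hv, hm.2.1, zero_add]

omit hS hdim in
theorem isNullLift_of_tangent {q : CotangentBundle F S} {u : TangentSpace 𝓘(ℝ, F) q.proj}
    (hu : ∀ v, q.2 v = g.inducedMetric ι q.proj u v)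
    {n : TangentSpace 𝓘(ℝ, E) (ι q.proj) →L[ℝ] ℝ}
    (hn : g.IsUnitFutureConormal (F := F) ι q.proj n) :
    g.IsNullLift ι q (g.val (ι q.proj) (mfderiv 𝓘(ℝ, F) 𝓘(ℝ, E) ι q.proj u) + n) := by
  refine ⟨n, _, hn, ?_, fun w => (hu w).symm, rfl⟩
  rw [val_apply_sharp, hn.1]

/-- The lift is a sum of orthogonal covectors of squares `1` and `-1`, hence null. -/
theorem exists_isNullLift {q : CotangentBundle F S} (hq : q ∈ g.cosphereBundle ι) :
    ∃ p, g.IsNullLift ι q p ∧ (⟨ι q.proj, p⟩ : CotangentBundle E M) ∈ g.nullBundle := by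
  obtain ⟨u, hu, huu⟩ := hq
  obtain ⟨n, hn⟩ := exists_isUnitFutureConormal hS hdim q.proj
  refine ⟨_, isNullLift_of_tangent hu hn, ?_⟩
  set Au := mfderiv 𝓘(ℝ, F) 𝓘(ℝ, E) ι q.proj u with hAu
  set N := g.sharp (ι q.proj) n with hN
  have hsharp : g.sharp (ι q.proj) (g.val (ι q.proj) Au + n) = Au + N := by
    have h1 : g.val (ι q.proj) (Au + N) = g.val (ι q.proj) Au + n := by
      rw [map_add, hN, g.val_sharp]
    rw [← h1, sharp_val]
  have hnull : (g.val (ι q.proj) Au + n) (Au + N) = 0 := by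
    have h1 : g.val (ι q.proj) Au Au = 1 := huu
    have h2 : g.val (ι q.proj) Au N = 0 := by rw [hN, val_apply_sharp]; exact hn.1 u
    have h3 : n Au = 0 := hn.1 u
    have h4 : n N = -1 := hn.2.1
    rw [add_apply, map_add, map_add, h1, h2, h3, h4]
    norm_num
  have hval : g.val (ι q.proj) (Au + N) = g.val (ι q.proj) Au + n := by
    rw [← hsharp, g.val_sharp]
  change _ ∧ _
  rw [IsFutureCausal, hsharp, hval]
  refine ⟨hnull, hnull.le, ?_⟩
  rw [← hval]
  -- The normal `N` plays the part of the reference direction and the time field that of the second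
  -- vector, since the sign known in advance is that of `g(Au + N, N)`.
  refine val_neg_of_future (v := Au + N)
    (w := g.timeField (ι q.proj)) (T := N) ?_ (by rw [hval]; exact hnull.le) ?_
    (g.timelike_timeField _) ?_
  · rw [hN, g.val_sharp]
    exact hn.2.1.trans_lt (by norm_num)
  · rw [hval, add_apply, hN, val_apply_sharp, hn.1, zero_add]
    exact hn.2.1.trans_lt (by norm_num)
  · rw [g.symm]; exact hn.2.2.2

/-- Split `p^#` into a tangential part `Au` and a normal part `c N`. Future directedness gives `c >
0`, nullity gives `h(u, u) = c²`, and division by `c` produces the unit covector. -/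
theorem exists_pos_smul_isNullLift {x : S} {p : TangentSpace 𝓘(ℝ, E) (ι x) →L[ℝ] ℝ}
    (hp : (⟨ι x, p⟩ : CotangentBundle E M) ∈ g.nullBundle) :
    ∃ (Q : TangentSpace 𝓘(ℝ, F) x →L[ℝ] ℝ) (a : ℝ) (p' : TangentSpace 𝓘(ℝ, E) (ι x) →L[ℝ] ℝ),
      (⟨x, Q⟩ : CotangentBundle F S) ∈ g.cosphereBundle ι ∧ 0 < a ∧
      g.IsNullLift ι (⟨x, Q⟩ : CotangentBundle F S) p' ∧ p = a • p' := by
  obtain ⟨n, hn⟩ := exists_isUnitFutureConormal hS hdim x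
  obtain ⟨u, c, hV⟩ := IsUnitFutureConormal.exists_eq_add_smul hS hdim hn (g.sharp (ι x) p)
  obtain ⟨h0, h1, h2⟩ := hp
  change p (g.sharp (ι x) p) = 0 at h0
  change g.val (ι x) (g.sharp (ι x) p) (g.sharp (ι x) p) ≤ 0 at h1
  change g.val (ι x) (g.sharp (ι x) p) (g.timeField (ι x)) < 0 at h2
  set Au := mfderiv 𝓘(ℝ, F) 𝓘(ℝ, E) ι x u with hAu
  set N := g.sharp (ι x) n with hN
  have hNN : g.val (ι x) N N = -1 := by rw [hN, g.val_sharp]; exact hn.2.1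
  have hNA : n Au = 0 := hn.1 u
  have hpeq : p = g.val (ι x) Au + c • n := by
    rw [← g.val_sharp (ι x) p, hV, map_add, map_smul, hN, g.val_sharp]
  have hpN : p N = -c := by
    rw [hpeq, add_apply, smul_apply, hN, val_apply_sharp, hNA]
    have : n (g.sharp (ι x) n) = -1 := hn.2.1
    rw [this]
    simp
  have hc : 0 < c := by
    have h3 := val_neg_of_future
      (v := g.sharp (ι x) p) (w := N) (T := g.timeField (ι x)) (g.timelike_timeField _) h1 h2
      (hNN.trans_lt (by norm_num)) hn.2.2.2
    rw [g.val_sharp, hpN] at h3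
    linarith
  have huu : g.inducedMetric ι x u u = c ^ 2 := by
    have h4 : p (Au + c • N) = 0 := by rw [← hV]; exact h0
    rw [map_add, map_smul, hpN, hpeq, add_apply, smul_apply, hNA] at h4
    change g.val (ι x) Au Au = c ^ 2
    simp only [smul_eq_mul] at h4
    linarith
  let u' : TangentSpace 𝓘(ℝ, F) x := c⁻¹ • u
  let Q : TangentSpace 𝓘(ℝ, F) x →L[ℝ] ℝ :=
    (g.val (ι x) (mfderiv 𝓘(ℝ, F) 𝓘(ℝ, E) ι x u')).comp (mfderiv 𝓘(ℝ, F) 𝓘(ℝ, E) ι x)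
  have hQ : ∀ v, Q v = g.inducedMetric ι x u' v := fun v => rfl
  refine ⟨Q, c, _, ⟨u', hQ, ?_⟩, hc,
    isNullLift_of_tangent (q := (⟨x, Q⟩ : CotangentBundle F S)) (u := u') hQ hn, ?_⟩
  · have h5 : g.inducedMetric ι x u' u' = c⁻¹ * (c⁻¹ * g.inducedMetric ι x u u) := by
      simp only [inducedMetric, u', map_smul, smul_apply, smul_eq_mul]
    rw [h5, huu]
    field_simp
  · rw [hpeq, smul_add]
    congr 1
    simp only [u', map_smul, smul_smul]
    rw [mul_inv_cancel₀ hc.ne', one_smul]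

/-- Every null lift takes the value `-1` on the unit normal, which determines the multiplier;
restriction to the tangent space then determines the unit covector. -/
theorem isNullLift_smul_unique {x : S} {Q Q' : TangentSpace 𝓘(ℝ, F) x →L[ℝ] ℝ} {a a' : ℝ}
    {p p' : TangentSpace 𝓘(ℝ, E) (ι x) →L[ℝ] ℝ}
    (hp : g.IsNullLift ι (⟨x, Q⟩ : CotangentBundle F S) p)
    (hp' : g.IsNullLift ι (⟨x, Q'⟩ : CotangentBundle F S) p') (ha : a ≠ 0)
    (h : a • p = a' • p') : Q = Q' := by
  obtain ⟨n, hn⟩ := exists_isUnitFutureConormal hS hdim x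
  have hu := fun m hm => IsUnitFutureConormal.eq hS hdim (m := m) hn hm
  have h1 : p (g.sharp (ι x) n) = -1 := IsNullLift.apply_sharp_conormal hp hu
  have h2 : p' (g.sharp (ι x) n) = -1 := IsNullLift.apply_sharp_conormal hp' hu
  have h3 := DFunLike.congr_fun h (g.sharp (ι x) n)
  rw [smul_apply, smul_apply, h1, h2] at h3
  obtain rfl : a = a' := by simpa using h3
  have h4 : p = p' := smul_right_injective _ ha h
  ext u
  have h5 := IsNullLift.apply_mfderiv hp u
  have h6 := IsNullLift.apply_mfderiv hp' u
  rw [← h4] at h6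
  exact h5.symm.trans h6

omit [FiniteDimensional ℝ F] [FiniteDimensional ℝ E] hdim in
theorem eq_one_of_smul_mem_cosphereBundle {x : S} {Q : TangentSpace 𝓘(ℝ, F) x →L[ℝ] ℝ} {a : ℝ}
    (ha : 0 < a) (hQ : (⟨x, Q⟩ : CotangentBundle F S) ∈ g.cosphereBundle ι)
    (haQ : (⟨x, a • Q⟩ : CotangentBundle F S) ∈ g.cosphereBundle ι) : a = 1 := by
  obtain ⟨u, hu, huu⟩ := hQ
  obtain ⟨w, hw, hww⟩ := haQ
  have h1 : w = a • u := by
    by_contra hne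
    have h2 := hS x (w - a • u) (sub_ne_zero.2 hne)
    have h3 : ∀ v, g.inducedMetric ι x (w - a • u) v = 0 := by
      intro v
      have h4 := hw v
      have h5 := hu v
      change (a • Q) v = _ at h4
      change Q v = _ at h5
      rw [smul_apply, h5] at h4
      simp only [inducedMetric, map_sub, map_smul, sub_apply, smul_apply, smul_eq_mul] at h4 ⊢
      linarith
    exact h2.ne' (h3 _)
  have h6 : g.inducedMetric ι x w w = a * (a * g.inducedMetric ι x u u) := by
    rw [h1]
    simp only [inducedMetric, map_smul, smul_apply, smul_eq_mul]
  rw [hww, huu] at h6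
  nlinarith

/-- A future null extension is a multiple `a` of a null lift, and `a = 1` because both restrictions
have unit length. The lift is thus characterized by equations and an open condition, in a form
suited to the inverse function theorem. -/
theorem isNullLift_of_mem_nullBundle {q : CotangentBundle F S} (hq : q ∈ g.cosphereBundle ι)
    {p : TangentSpace 𝓘(ℝ, E) (ι q.proj) →L[ℝ] ℝ}
    (hp : (⟨ι q.proj, p⟩ : CotangentBundle E M) ∈ g.nullBundle)
    (hpq : ∀ u, p (mfderiv 𝓘(ℝ, F) 𝓘(ℝ, E) ι q.proj u) = q.2 u) : g.IsNullLift ι q p := by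
  obtain ⟨x, Q⟩ := q
  obtain ⟨Q', a, p', hQ', ha, hp', rfl⟩ :=
    exists_pos_smul_isNullLift (x := x) hS hdim hp
  have h1 : Q = a • Q' := by
    ext u
    have h2 := hpq u
    have h3 := IsNullLift.apply_mfderiv hp' u
    rw [smul_apply] at h2 ⊢
    rw [← h2]
    exact congrArg (a • ·) h3
  subst h1
  obtain rfl := eq_one_of_smul_mem_cosphereBundle hS ha hQ' hq
  rw [one_smul, one_smul]
  exact hp'

end SpacetimeStructure

end NullLift

/-! ## The correspondence between unit covectors of Cauchy surfaces -/

section Correspondence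

variable {E : Type*} [NormedAddCommGroup E] [NormedSpace ℝ E] [FiniteDimensional ℝ E]
  {M : Type*} [TopologicalSpace M] [ChartedSpace E M] [IsManifold 𝓘(ℝ, E) ∞ M] [T2Space M]
  {F : Type*} [NormedAddCommGroup F] [NormedSpace ℝ F] [FiniteDimensional ℝ F]
  {S₁ : Type*} [TopologicalSpace S₁] [ChartedSpace F S₁] [IsManifold 𝓘(ℝ, F) ∞ S₁]
  {S₂ : Type*} [TopologicalSpace S₂] [ChartedSpace F S₂] [IsManifold 𝓘(ℝ, F) ∞ S₂]

namespace SpacetimeStructure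

variable {g : SpacetimeStructure E M} {ι₁ : S₁ → M} {ι₂ : S₂ → M}

theorem scaleCovector_mem_nullBundle {a : ℝ} (ha : 0 < a) {r : CotangentBundle E M}
    (hr : r ∈ g.nullBundle) : scaleCovector a r ∈ g.nullBundle := by
  obtain ⟨h1, h2⟩ := mem_nullBundle_iff.1 hr
  refine mem_nullBundle_iff.2 ⟨by rw [hamiltonian_scaleCovector, h1, mul_zero], ?_⟩
  change (a • r.2) (g.timeField r.proj) < 0
  rw [smul_apply, smul_eq_mul]
  exact mul_neg_of_pos_of_neg ha h2

theorem isLiftedNullGeodesicOn_geodesicFlow {r : CotangentBundle E M} (hr : r ∈ g.nullBundle) :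
    g.IsLiftedNullGeodesicOn (g.geodesicFlow r) (g.geodesicDomain r) where
  isOpen := (g.isGeodesicFrom_geodesicFlow r).isOpen
  ordConnected := (g.isGeodesicFrom_geodesicFlow r).ordConnected
  mem_nullBundle _ ht := geodesicFlow_mem_nullBundle hr ht
  integral := (g.isGeodesicFrom_geodesicFlow r).isGeodesicAt

/-- Shifting the parameter and using uniqueness replaces an arbitrary lifted geodesic by the flow
line starting at the null lift of `q₁`. -/
theorem geodesicRelated_iff {q₁ : CotangentBundle F S₁} {q₂ : CotangentBundle F S₂} :
    g.GeodesicRelated ι₁ ι₂ q₁ q₂ ↔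
      ∃ (p₁ : TangentSpace 𝓘(ℝ, E) (ι₁ q₁.proj) →L[ℝ] ℝ)
        (p₂ : TangentSpace 𝓘(ℝ, E) (ι₂ q₂.proj) →L[ℝ] ℝ) (t a : ℝ),
        g.IsNullLift ι₁ q₁ p₁ ∧ g.IsNullLift ι₂ q₂ p₂ ∧
        (⟨ι₁ q₁.proj, p₁⟩ : CotangentBundle E M) ∈ g.nullBundle ∧
        t ∈ g.geodesicDomain ⟨ι₁ q₁.proj, p₁⟩ ∧ 0 < a ∧
        g.geodesicFlow ⟨ι₁ q₁.proj, p₁⟩ t = ⟨ι₂ q₂.proj, a • p₂⟩ := by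
  constructor
  · rintro ⟨p₁, p₂, c, J, t₁, t₂, a, hp₁, hp₂, hc, ht₁, ht₂, ha, hct₁, hct₂⟩
    have h1 : g.IsGeodesicFrom (c t₁) (fun s => c (s + t₁)) ((fun s => s + t₁) ⁻¹' J) :=
      { isOpen := hc.isOpen.preimage (by fun_prop)
        ordConnected := hc.ordConnected.preimage_mono fun _ _ hab => by simpa using hab
        zero_mem := by simpa using ht₁
        isGeodesicAt := fun s hs => IsGeodesicAt.comp_add_const (hc.integral _ hs)
        start := by simp }
    have h2 : t₂ - t₁ ∈ (fun s => s + t₁) ⁻¹' J := by simpa using ht₂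
    have h3 := h1.geodesicFlow_eq h2
    have h4 := h1.subset_geodesicDomain h2
    simp only [sub_add_cancel] at h3
    rw [hct₁] at h3 h4
    exact ⟨p₁, p₂, t₂ - t₁, a, hp₁, hp₂, hct₁ ▸ hc.mem_nullBundle t₁ ht₁, h4, ha, h3.trans hct₂⟩
  · rintro ⟨p₁, p₂, t, a, hp₁, hp₂, hn, ht, ha, hf⟩
    exact ⟨p₁, p₂, _, _, 0, t, a, hp₁, hp₂, isLiftedNullGeodesicOn_geodesicFlow hn,
      g.zero_mem_geodesicDomain _, ht, ha, g.geodesicFlow_zero _, hf⟩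

/-- The reversed flow starts at `a • p₂`. Passing to `p₂` divides covectors by `a` and multiplies
times by `a`. -/
theorem GeodesicRelated.symm {q₁ : CotangentBundle F S₁} {q₂ : CotangentBundle F S₂}
    (h : g.GeodesicRelated ι₁ ι₂ q₁ q₂) : g.GeodesicRelated ι₂ ι₁ q₂ q₁ := by
  obtain ⟨p₁, p₂, t, a, hp₁, hp₂, hn, ht, ha, hf⟩ := geodesicRelated_iff.1 h
  have h1 : (⟨ι₂ q₂.proj, p₂⟩ : CotangentBundle E M)
      = scaleCovector a⁻¹ (g.geodesicFlow ⟨ι₁ q₁.proj, p₁⟩ t) := by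
    rw [hf]
    refine congrArg (Bundle.TotalSpace.mk _) ?_
    rw [smul_smul, inv_mul_cancel₀ ha.ne', one_smul]
  obtain ⟨h2, h3⟩ := geodesicFlow_neg ht
  have h4 : a⁻¹ * (-(a * t)) = -t := by field_simp
  refine geodesicRelated_iff.2 ⟨p₂, p₁, -(a * t), a⁻¹, hp₂, hp₁, ?_, ?_, inv_pos.2 ha, ?_⟩
  · rw [h1]
    exact scaleCovector_mem_nullBundle (inv_pos.2 ha) (geodesicFlow_mem_nullBundle hn ht)
  · rw [h1, mem_geodesicDomain_scale (inv_ne_zero ha.ne'), h4]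
    exact h2
  · rw [h1, geodesicFlow_scale (by rw [h4]; exact h2), h4, h3]
    rfl

variable (hdim : Module.finrank ℝ F + 1 = Module.finrank ℝ E)

include hdim

omit [T2Space M] in
theorem eq_of_smul_isNullLift
    (hS : ∀ (x : S₂) (u : TangentSpace 𝓘(ℝ, F) x), u ≠ 0 → 0 < g.inducedMetric ι₂ x u u)
    (hinj : Function.Injective ι₂) {q q' : CotangentBundle F S₂}
    {p : TangentSpace 𝓘(ℝ, E) (ι₂ q.proj) →L[ℝ] ℝ}
    {p' : TangentSpace 𝓘(ℝ, E) (ι₂ q'.proj) →L[ℝ] ℝ} {a a' : ℝ} (ha : a ≠ 0)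
    (hp : g.IsNullLift ι₂ q p) (hp' : g.IsNullLift ι₂ q' p')
    (h : (⟨ι₂ q.proj, a • p⟩ : CotangentBundle E M) = ⟨ι₂ q'.proj, a' • p'⟩) : q = q' := by
  obtain ⟨x, Q⟩ := q
  obtain ⟨x', Q'⟩ := q'
  obtain rfl : x = x' := hinj (congrArg Bundle.TotalSpace.proj h)
  have h1 : a • p = a' • p' := by
    simpa only [Bundle.TotalSpace.mk.injEq, heq_eq_eq, true_and] using h
  rw [isNullLift_smul_unique hS hdim hp hp' ha h1]

/-- The null lift of `q₁` is unique, and the geodesic through it meets the second Cauchy surface at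
only one time. The covector reached there has only one normalization. -/
theorem GeodesicRelated.unique (h₁ : g.IsCauchySurface (F := F) ι₁)
    (h₂ : g.IsCauchySurface (F := F) ι₂) {q₁ : CotangentBundle F S₁}
    {q₂ q₂' : CotangentBundle F S₂} (h : g.GeodesicRelated ι₁ ι₂ q₁ q₂)
    (h' : g.GeodesicRelated ι₁ ι₂ q₁ q₂') : q₂ = q₂' := by
  obtain ⟨p₁, p₂, t, a, hp₁, hp₂, hn, ht, ha, hf⟩ := geodesicRelated_iff.1 h
  obtain ⟨p₁', p₂', t', a', hp₁', hp₂', -, ht', -, hf'⟩ := geodesicRelated_iff.1 h'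
  obtain rfl := IsNullLift.eq h₁.spacelike hdim hp₁ hp₁'
  have h3 := h₂.existsUnique_meets _ _ (isInextendibleCausalCurveOn_geodesicFlow hn)
  obtain rfl := h3.unique ⟨ht, by rw [hf]; exact mem_range_self _⟩
    ⟨ht', by rw [hf']; exact mem_range_self _⟩
  exact eq_of_smul_isNullLift hdim h₂.spacelike h₂.isEmbedding.injective ha.ne' hp₂ hp₂'
    (hf.symm.trans hf')

/-- The maximal null geodesic is inextendible, so it meets the second Cauchy surface, and its
covector there is normalized by `exists_pos_smul_isNullLift`. -/
theorem exists_geodesicRelated (h₁ : g.IsCauchySurface (F := F) ι₁)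
    (h₂ : g.IsCauchySurface (F := F) ι₂) {q₁ : CotangentBundle F S₁}
    (hq₁ : q₁ ∈ g.cosphereBundle ι₁) :
    ∃ q₂ ∈ g.cosphereBundle (F := F) ι₂, g.GeodesicRelated ι₁ ι₂ q₁ q₂ := by
  obtain ⟨p₁, hp₁, hn⟩ := exists_isNullLift h₁.spacelike hdim hq₁
  obtain ⟨t, ht, x₂, hx₂⟩ :=
    (h₂.existsUnique_meets _ _ (isInextendibleCausalCurveOn_geodesicFlow hn)).exists
  have hn' := geodesicFlow_mem_nullBundle hn ht
  generalize hr : g.geodesicFlow ⟨ι₁ q₁.proj, p₁⟩ t = r at hx₂ hn'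
  obtain ⟨y, p⟩ := r
  subst hx₂
  obtain ⟨Q, a, p₂, hQ, ha, hp₂, rfl⟩ := exists_pos_smul_isNullLift h₂.spacelike hdim hn'
  exact ⟨⟨x₂, Q⟩, hQ, geodesicRelated_iff.2 ⟨p₁, p₂, t, a, hp₁, hp₂, hn, ht, ha, hr⟩⟩

/-- The relation is symmetric and single-valued in both directions, so the two choices of images are
inverse to each other. -/
theorem exists_equiv_geodesicRelated (h₁ : g.IsCauchySurface (F := F) ι₁)
    (h₂ : g.IsCauchySurface (F := F) ι₂) :
    ∃ f : g.cosphereBundle (F := F) ι₁ ≃ g.cosphereBundle (F := F) ι₂,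
      ∀ q₁ q₂, f q₁ = q₂ ↔ g.GeodesicRelated ι₁ ι₂ q₁.1 q₂.1 := by
  have hex := fun q₁ : g.cosphereBundle (F := F) ι₁ => exists_geodesicRelated hdim h₁ h₂ q₁.2
  have hex' := fun q₂ : g.cosphereBundle (F := F) ι₂ => exists_geodesicRelated hdim h₂ h₁ q₂.2
  choose f hf hfr using hex
  choose f' hf' hfr' using hex'
  refine ⟨⟨fun q => ⟨f q, hf q⟩, fun q => ⟨f' q, hf' q⟩, fun q => Subtype.ext ?_,
    fun q => Subtype.ext ?_⟩, fun q₁ q₂ => ⟨?_, fun h => Subtype.ext ?_⟩⟩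
  · exact GeodesicRelated.unique hdim h₂ h₁ (hfr' ⟨f q, hf q⟩) (hfr q).symm
  · exact GeodesicRelated.unique hdim h₁ h₂ (hfr ⟨f' q, hf' q⟩) (hfr' q).symm
  · rintro rfl
    exact hfr q₁
  · exact GeodesicRelated.unique hdim h₁ h₂ (hfr q₁) h

end SpacetimeStructure

end Correspondence

/-! ## Null extensions and hitting times in coordinates -/

section CoordinateSolutions

variable {E : Type*} [NormedAddCommGroup E] [NormedSpace ℝ E] [FiniteDimensional ℝ E]
  {F : Type*} [NormedAddCommGroup F] [NormedSpace ℝ F] [FiniteDimensional ℝ F]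

/-- Equality of dimensions turns an injective derivative into an isomorphism. The local right
inverse then gives solutions of `f v = z` that depend smoothly on `z`. -/
theorem exists_contDiffAt_localInverse {V W : Type*} [NormedAddCommGroup V] [NormedSpace ℝ V]
    [FiniteDimensional ℝ V] [NormedAddCommGroup W] [NormedSpace ℝ W] [FiniteDimensional ℝ W]
    {f : V → W} {a : V} (hf : ContDiffAt ℝ ∞ f a)
    (hdim : Module.finrank ℝ V = Module.finrank ℝ W) (hinj : ∀ v, fderiv ℝ f a v = 0 → v = 0) :
    ∃ h : W → V, ContDiffAt ℝ ∞ h (f a) ∧ h (f a) = a ∧ ∀ᶠ z in 𝓝 (f a), f (h z) = z := by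
  have : CompleteSpace V := FiniteDimensional.complete ℝ V
  have hinj' : Function.Injective (fderiv ℝ f a : V →ₗ[ℝ] W) := by
    rw [← LinearMap.ker_eq_bot, LinearMap.ker_eq_bot']
    exact hinj
  let L : V ≃L[ℝ] W :=
    (LinearMap.linearEquivOfInjective (fderiv ℝ f a : V →ₗ[ℝ] W) hinj' hdim).toContinuousLinearEquiv
  have hL : (L : V →L[ℝ] W) = fderiv ℝ f a := by ext; rfl
  have hd : HasFDerivAt f (L : V →L[ℝ] W) a := by
    rw [hL]
    exact (hf.differentiableAt (by simp)).hasFDerivAt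
  exact ⟨hf.localInverse hd (by simp), hf.to_localInverse hd (by simp),
    hf.localInverse_apply_image hd (by simp),
    (hf.hasStrictFDerivAt' hd (by simp)).eventually_right_inverse⟩

theorem finrank_continuousDual : Module.finrank ℝ (E →L[ℝ] ℝ) = Module.finrank ℝ E := by
  rw [← (LinearMap.toContinuousLinearMap (𝕜 := ℝ) (E := E) (F' := ℝ)).finrank_eq]
  exact Subspace.dual_finrank_eq

variable {Q : E → (E →L[ℝ] ℝ) →L[ℝ] E} {i : F → E} {y₀ : F} {P₀ : E →L[ℝ] ℝ}

theorem contDiffAt_coordHamiltonian_comp (hi : ContDiffAt ℝ ∞ i y₀)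
    (hQ : ContDiffAt ℝ ∞ Q (i y₀)) :
    ContDiffAt ℝ ∞ (fun w : F × (E →L[ℝ] ℝ) => coordHamiltonian Q (i w.1, w.2)) (y₀, P₀) := by
  have h1 : ContDiffAt ℝ ∞ (fun w : F × (E →L[ℝ] ℝ) => Q (i w.1)) (y₀, P₀) :=
    ContDiffAt.comp (g := fun y => Q (i y)) (y₀, P₀) (ContDiffAt.comp y₀ hQ hi) contDiffAt_fst
  exact contDiffAt_const.mul (contDiffAt_snd.clm_apply (h1.clm_apply contDiffAt_snd))

/-- Covectors on a transversal hypersurface have smooth null extensions. -/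
theorem exists_null_extension (hdim : Module.finrank ℝ F + 1 = Module.finrank ℝ E)
    (hi : ContDiffAt ℝ ∞ i y₀) (hQ : ContDiffAt ℝ ∞ Q (i y₀))
    (hsymm : ∀ p q : E →L[ℝ] ℝ, p (Q (i y₀) q) = q (Q (i y₀) p))
    (hspan : ∀ e, ∃ u, ∃ c : ℝ, e = fderiv ℝ i y₀ u + c • Q (i y₀) P₀)
    (hnull : coordHamiltonian Q (i y₀, P₀) = 0) :
    ∃ Λ : F × (F →L[ℝ] ℝ) → E →L[ℝ] ℝ,
      ContDiffAt ℝ ∞ Λ (y₀, P₀.comp (fderiv ℝ i y₀)) ∧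
      Λ (y₀, P₀.comp (fderiv ℝ i y₀)) = P₀ ∧
      ∀ᶠ w in 𝓝 (y₀, P₀.comp (fderiv ℝ i y₀)), (Λ w).comp (fderiv ℝ i w.1) = w.2 ∧
        coordHamiltonian Q (i w.1, Λ w) = 0 := by
  -- A null extension with given restriction is a solution of `K = (y, R, 0)`. In a direction `p`
  -- the derivative is `p` on the tangent space together with `p (Q P₀)`, which is injective because
  -- these directions span `E`.
  let K : F × (E →L[ℝ] ℝ) → F × ((F →L[ℝ] ℝ) × ℝ) :=
    fun w => (w.1, w.2.comp (fderiv ℝ i w.1), coordHamiltonian Q (i w.1, w.2))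
  have hdi : ContDiffAt ℝ ∞ (fderiv ℝ i) y₀ := hi.fderiv_right (m := ∞) (by simp)
  have hdi' : ContDiffAt ℝ ∞ (fun w : F × (E →L[ℝ] ℝ) => fderiv ℝ i w.1) (y₀, P₀) :=
    ContDiffAt.comp (g := fderiv ℝ i) (y₀, P₀) hdi contDiffAt_fst
  have hK : ContDiffAt ℝ ∞ K (y₀, P₀) :=
    contDiffAt_fst.prodMk ((contDiffAt_snd.clm_comp hdi').prodMk
      (contDiffAt_coordHamiltonian_comp hi hQ))
  have hKd := (hK.differentiableAt (by simp)).hasFDerivAt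
  have h1 : ∀ w, (fderiv ℝ K (y₀, P₀) w).1 = w.1 := fun w =>
    DFunLike.congr_fun (hKd.fst.unique (hasFDerivAt_fst (p := (y₀, P₀)))) w
  have h2 : ∀ p, fderiv ℝ K (y₀, P₀) (0, p)
      = (0, p.comp (fderiv ℝ i y₀), p (Q (i y₀) P₀)) := by
    intro p
    have hl : HasDerivAt (fun s : ℝ => (y₀, P₀ + s • p)) (0, p) 0 :=
      (hasDerivAt_const 0 y₀).prodMk
        (by simpa using ((hasDerivAt_id (0 : ℝ)).smul_const p).const_add P₀)
    have hK0 : HasFDerivAt K (fderiv ℝ K (y₀, P₀)) (y₀, P₀ + (0 : ℝ) • p) := by simpa using hKd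
    have h3 := hK0.comp_hasDerivAt 0 hl
    obtain ⟨D, hD, hDw⟩ := hasFDerivAt_coordHamiltonian (Q := Q) (z := (i y₀, P₀))
      (hQ.differentiableAt (by simp))
    have hl2 : HasDerivAt (fun s : ℝ => P₀ + s • p) p 0 := by
      simpa using ((hasDerivAt_id (0 : ℝ)).smul_const p).const_add P₀
    have hD0 : HasFDerivAt (coordHamiltonian Q) D (i y₀, P₀ + (0 : ℝ) • p) := by simpa using hD
    have h4 := HasFDerivAt.comp_hasDerivAt (f := fun s : ℝ => (i y₀, P₀ + s • p)) 0 hD0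
      ((hasDerivAt_const 0 (i y₀)).prodMk hl2)
    have h5 : HasDerivAt (fun s : ℝ => (P₀ + s • p).comp (fderiv ℝ i y₀))
        (p.comp (fderiv ℝ i y₀)) 0 := by
      simpa using hl2.clm_comp (hasDerivAt_const 0 (fderiv ℝ i y₀))
    refine (h3.unique ((hasDerivAt_const 0 y₀).prodMk (h5.prodMk h4))).trans ?_
    rw [hDw, hsymm P₀ p]
    simp only [map_zero, zero_apply]
    congr 2
    ring
  obtain ⟨h, hh, hha, hhr⟩ := exists_contDiffAt_localInverse hK (by
      simp only [Module.finrank_prod, finrank_continuousDual, Module.finrank_self]; omega) (by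
    rintro ⟨u, p⟩ hw
    obtain rfl : u = 0 := (h1 (u, p)).symm.trans (by rw [hw]; rfl)
    rw [h2, Prod.mk_eq_zero, Prod.mk_eq_zero] at hw
    obtain ⟨-, hw1, hw2⟩ := hw
    have : p = 0 := by
      ext e
      obtain ⟨u, c, rfl⟩ := hspan e
      have h6 := DFunLike.congr_fun hw1 u
      simp only [ContinuousLinearMap.comp_apply] at h6
      rw [map_add, map_smul, hw2, h6]
      simp
    rw [this]; rfl)
  have hKa : K (y₀, P₀) = (y₀, P₀.comp (fderiv ℝ i y₀), 0) := by simp only [K, hnull]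
  rw [hKa] at hh hha hhr
  have hj : ContDiffAt ℝ ∞ (fun w : F × (F →L[ℝ] ℝ) => (w.1, w.2, (0 : ℝ)))
      (y₀, P₀.comp (fderiv ℝ i y₀)) :=
    contDiffAt_fst.prodMk (contDiffAt_snd.prodMk contDiffAt_const)
  refine ⟨fun w => (h (w.1, w.2, 0)).2, ?_, by simp [hha], ?_⟩
  · exact (ContDiffAt.comp (g := h) (y₀, P₀.comp (fderiv ℝ i y₀)) hh hj).snd
  · filter_upwards [hj.continuousAt.eventually hhr] with w hw
    have e1 : (h (w.1, w.2, 0)).1 = w.1 := congrArg Prod.fst hw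
    have e2 : (h (w.1, w.2, 0)).2.comp (fderiv ℝ i (h (w.1, w.2, 0)).1) = w.2 :=
      congrArg (fun z => z.2.1) hw
    have e3 : coordHamiltonian Q (i (h (w.1, w.2, 0)).1, (h (w.1, w.2, 0)).2) = 0 :=
      congrArg (fun z => z.2.2) hw
    rw [e1] at e2 e3
    exact ⟨e2, e3⟩

/-- Nearby points of the phase space lie on integral curves starting above a transversal
hypersurface. -/
theorem exists_hitting_solution (hdim : Module.finrank ℝ F + 1 = Module.finrank ℝ E)
    (hi : ContDiffAt ℝ ∞ i y₀) {φ : (E × (E →L[ℝ] ℝ)) × ℝ → E × (E →L[ℝ] ℝ)}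
    {X : E × (E →L[ℝ] ℝ)} (hφ : ContDiffAt ℝ ∞ φ ((i y₀, P₀), 0))
    (hφ0 : ∀ᶠ z in 𝓝 (i y₀, P₀), φ (z, 0) = z)
    (hφd : HasDerivAt (fun s => φ ((i y₀, P₀), s)) X 0)
    (htrans : ∀ u, ∀ c : ℝ, fderiv ℝ i y₀ u + c • X.1 = 0 → u = 0 ∧ c = 0) :
    ∃ h : E × (E →L[ℝ] ℝ) → F × (E →L[ℝ] ℝ) × ℝ, ContDiffAt ℝ ∞ h (i y₀, P₀) ∧
      h (i y₀, P₀) = (y₀, P₀, 0) ∧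
      ∀ᶠ z in 𝓝 (i y₀, P₀), φ ((i (h z).1, (h z).2.1), (h z).2.2) = z := by
  let j : F × (E →L[ℝ] ℝ) × ℝ → (E × (E →L[ℝ] ℝ)) × ℝ := fun w => ((i w.1, w.2.1), w.2.2)
  have hd := (hi.differentiableAt (by simp)).hasFDerivAt
  have hj : ContDiffAt ℝ ∞ j (y₀, P₀, 0) :=
    ((ContDiffAt.comp (g := i) (y₀, P₀, (0 : ℝ)) hi contDiffAt_fst).prodMk
      contDiffAt_snd.fst).prodMk contDiffAt_snd.snd
  have hφD := (hφ.differentiableAt (by simp)).hasFDerivAt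
  have h1 : ∀ v, fderiv ℝ φ ((i y₀, P₀), 0) (v, 0) = v := by
    intro v
    have e1 : HasFDerivAt (fun z : E × (E →L[ℝ] ℝ) => (z, (0 : ℝ)))
        (ContinuousLinearMap.inl ℝ (E × (E →L[ℝ] ℝ)) ℝ) (i y₀, P₀) :=
      hasFDerivAt_prodMk_left _ _
    have e2 := (HasFDerivAt.comp (g := φ) (i y₀, P₀) hφD e1).unique
      ((hasFDerivAt_id (i y₀, P₀)).congr_of_eventuallyEq hφ0)
    exact DFunLike.congr_fun e2 v
  have h2 : fderiv ℝ φ ((i y₀, P₀), 0) (0, 1) = X := by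
    have e1 : HasDerivAt (fun s : ℝ => ((i y₀, P₀), s)) ((0, 1) : (E × (E →L[ℝ] ℝ)) × ℝ) 0 :=
      (hasDerivAt_const 0 _).prodMk (hasDerivAt_id 0)
    exact (hφD.comp_hasDerivAt 0 e1).unique hφd
  have hjD : HasFDerivAt j (((((fderiv ℝ i y₀).comp (ContinuousLinearMap.fst ℝ F _)).prod
      ((ContinuousLinearMap.fst ℝ (E →L[ℝ] ℝ) ℝ).comp (ContinuousLinearMap.snd ℝ F _))).prod
      ((ContinuousLinearMap.snd ℝ (E →L[ℝ] ℝ) ℝ).comp (ContinuousLinearMap.snd ℝ F _))))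
      (y₀, P₀, 0) := by
    refine HasFDerivAt.prodMk (HasFDerivAt.prodMk
      (HasFDerivAt.comp (g := i) (y₀, P₀, (0 : ℝ)) hd hasFDerivAt_fst) ?_) ?_
    · exact ((ContinuousLinearMap.fst ℝ (E →L[ℝ] ℝ) ℝ).comp
        (ContinuousLinearMap.snd ℝ F ((E →L[ℝ] ℝ) × ℝ))).hasFDerivAt
    · exact ((ContinuousLinearMap.snd ℝ (E →L[ℝ] ℝ) ℝ).comp
        (ContinuousLinearMap.snd ℝ F ((E →L[ℝ] ℝ) × ℝ))).hasFDerivAt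
  -- This map sends a starting point above the hypersurface and a time to the point reached. Its
  -- derivative `(u, p, c) ↦ (Di u, p) + c X` is injective by transversality.
  have hΘ : ContDiffAt ℝ ∞ (fun w => φ (j w)) (y₀, P₀, 0) :=
    ContDiffAt.comp (g := φ) (y₀, P₀, (0 : ℝ)) hφ hj
  have hΘD := (HasFDerivAt.comp (g := φ) (y₀, P₀, (0 : ℝ)) hφD hjD).fderiv
  have hΘD' : ∀ w, fderiv ℝ (fun w => φ (j w)) (y₀, P₀, 0) w
      = (fderiv ℝ i y₀ w.1, w.2.1) + w.2.2 • X := by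
    intro w
    have e1 : fderiv ℝ (fun w => φ (j w)) (y₀, P₀, 0) w
        = fderiv ℝ φ ((i y₀, P₀), 0) ((fderiv ℝ i y₀ w.1, w.2.1), w.2.2) :=
      DFunLike.congr_fun hΘD w
    have e2 : (((fderiv ℝ i y₀ w.1, w.2.1), w.2.2) : (E × (E →L[ℝ] ℝ)) × ℝ)
        = ((fderiv ℝ i y₀ w.1, w.2.1), 0) + w.2.2 • ((0, 1) : (E × (E →L[ℝ] ℝ)) × ℝ) := by
      simp
    rw [e1, e2, map_add, map_smul, h1, h2]
  have hΘ0 : φ (j (y₀, P₀, 0)) = (i y₀, P₀) := hφ0.self_of_nhds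
  obtain ⟨h, hh, hha, hhr⟩ := exists_contDiffAt_localInverse hΘ (by
      simp only [Module.finrank_prod, finrank_continuousDual, Module.finrank_self]; omega) (by
    rintro ⟨u, p, c⟩ hw
    rw [hΘD'] at hw
    obtain ⟨rfl, rfl⟩ := htrans u c (congrArg Prod.fst hw)
    have h3 := congrArg Prod.snd hw
    simp only [zero_smul, add_zero] at h3
    rw [h3]; rfl)
  rw [hΘ0] at hh hha hhr
  exact ⟨h, hh, hha, hhr⟩

end CoordinateSolutions

/-! ## Maps between manifolds in coordinates -/

section CoordinateMap

variable {E : Type*} [NormedAddCommGroup E] [NormedSpace ℝ E]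
  {M : Type*} [TopologicalSpace M] [ChartedSpace E M] [IsManifold 𝓘(ℝ, E) ∞ M]
  {F : Type*} [NormedAddCommGroup F] [NormedSpace ℝ F]
  {S : Type*} [TopologicalSpace S] [ChartedSpace F S] [IsManifold 𝓘(ℝ, F) ∞ S]

/-- The coordinate expression of `ι` near `x₀`. -/
noncomputable def coordMap (ι : S → M) (x₀ : S) (y : F) : E :=
  extChartAt 𝓘(ℝ, E) (ι x₀) (ι ((extChartAt 𝓘(ℝ, F) x₀).symm y))

variable {ι : S → M} {x₀ x : S}

theorem coordMap_extChartAt (hx : x ∈ (chartAt F x₀).source) :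
    coordMap (E := E) ι x₀ (extChartAt 𝓘(ℝ, F) x₀ x) = extChartAt 𝓘(ℝ, E) (ι x₀) (ι x) := by
  rw [coordMap, (extChartAt 𝓘(ℝ, F) x₀).left_inv (by simpa using hx)]

theorem contDiffAt_coordMap (hι : ContMDiff 𝓘(ℝ, F) 𝓘(ℝ, E) ∞ ι)
    (hx : x ∈ (chartAt F x₀).source) (hιx : ι x ∈ (chartAt E (ι x₀)).source) :
    ContDiffAt ℝ ∞ (coordMap (E := E) ι x₀) (extChartAt 𝓘(ℝ, F) x₀ x) := by
  rw [← contMDiffAt_iff_contDiffAt]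
  have hl : (extChartAt 𝓘(ℝ, F) x₀).symm (extChartAt 𝓘(ℝ, F) x₀ x) = x :=
    (extChartAt 𝓘(ℝ, F) x₀).left_inv (by simpa using hx)
  have h1 : ContMDiffAt 𝓘(ℝ, F) 𝓘(ℝ, F) ∞ (extChartAt 𝓘(ℝ, F) x₀).symm
      (extChartAt 𝓘(ℝ, F) x₀ x) :=
    (contMDiffOn_extChartAt_symm x₀).contMDiffAt ((isOpen_extChartAt_target x₀).mem_nhds
      ((extChartAt 𝓘(ℝ, F) x₀).map_source (by simpa using hx)))
  have h2 : ContMDiffAt 𝓘(ℝ, F) 𝓘(ℝ, E) ∞ ι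
      ((extChartAt 𝓘(ℝ, F) x₀).symm (extChartAt 𝓘(ℝ, F) x₀ x)) := hι _
  have h3 : ContMDiffAt 𝓘(ℝ, E) 𝓘(ℝ, E) ∞ (extChartAt 𝓘(ℝ, E) (ι x₀))
      (ι ((extChartAt 𝓘(ℝ, F) x₀).symm (extChartAt 𝓘(ℝ, F) x₀ x))) := by
    rw [hl]
    exact contMDiffAt_extChartAt' hιx
  exact ContMDiffAt.comp (g := extChartAt 𝓘(ℝ, E) (ι x₀)) _ h3 (ContMDiffAt.comp (g := ι) _ h2 h1)

theorem fderiv_coordMap (hι : ContMDiff 𝓘(ℝ, F) 𝓘(ℝ, E) ∞ ι)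
    (hx : x ∈ (chartAt F x₀).source) (hιx : ι x ∈ (chartAt E (ι x₀)).source)
    (u : TangentSpace 𝓘(ℝ, F) x) :
    fderiv ℝ (coordMap (E := E) ι x₀) (extChartAt 𝓘(ℝ, F) x₀ x) (chartDeriv x₀ x u)
      = chartDeriv (ι x₀) (ι x) (mfderiv 𝓘(ℝ, F) 𝓘(ℝ, E) ι x u) := by
  have h0 : HasFDerivAt (coordMap (E := E) ι x₀)
      (fderiv ℝ (coordMap (E := E) ι x₀) (extChartAt 𝓘(ℝ, F) x₀ x)) (extChartAt 𝓘(ℝ, F) x₀ x) :=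
    ((contDiffAt_coordMap hι hx hιx).differentiableAt (by simp)).hasFDerivAt
  have h1 := h0.hasMFDerivAt
  have h2 := HasMFDerivAt.comp x h1 (hasMFDerivAt_extChartAt_base hx)
  have h3 : HasMFDerivAt 𝓘(ℝ, F) 𝓘(ℝ, E) ι x (mfderiv 𝓘(ℝ, F) 𝓘(ℝ, E) ι x) :=
    ((hι x).mdifferentiableAt (by simp)).hasMFDerivAt
  have h4 := HasMFDerivAt.comp x (hasMFDerivAt_extChartAt_base (x₀ := ι x₀) hιx) h3
  have h5 := h2.congr_of_eventuallyEq (f₁ := extChartAt 𝓘(ℝ, E) (ι x₀) ∘ ι) (by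
    filter_upwards [(chartAt F x₀).open_source.mem_nhds hx] with x' hx'
    exact (coordMap_extChartAt hx').symm)
  exact DFunLike.congr_fun (hasMFDerivAt_unique h5 h4) u

theorem natChart_comp_fderiv_coordMap (hι : ContMDiff 𝓘(ℝ, F) 𝓘(ℝ, E) ∞ ι)
    {q : CotangentBundle F S} {p : TangentSpace 𝓘(ℝ, E) (ι q.proj) →L[ℝ] ℝ}
    (hq : q.proj ∈ (chartAt F x₀).source) (hr : ι q.proj ∈ (chartAt E (ι x₀)).source) :
    (∀ u, p (mfderiv 𝓘(ℝ, F) 𝓘(ℝ, E) ι q.proj u) = q.2 u) ↔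
      (natChart (ι x₀) (⟨ι q.proj, p⟩ : CotangentBundle E M)).2.comp
        (fderiv ℝ (coordMap (E := E) ι x₀) (natChart x₀ q).1) = (natChart x₀ q).2 := by
  have key : ∀ u : TangentSpace 𝓘(ℝ, F) q.proj,
      (natChart (ι x₀) (⟨ι q.proj, p⟩ : CotangentBundle E M)).2
        (fderiv ℝ (coordMap (E := E) ι x₀) (natChart x₀ q).1 (chartDeriv x₀ q.proj u))
      = p (mfderiv 𝓘(ℝ, F) 𝓘(ℝ, E) ι q.proj u) := by
    intro u
    rw [natChart_fst, fderiv_coordMap hι hq hr]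
    exact natChart_snd (q := (⟨ι q.proj, p⟩ : CotangentBundle E M)) hr _
  constructor
  · intro h
    ext e
    obtain ⟨u, rfl⟩ := LorentzMetric.exists_chartDeriv_eq hq e
    rw [ContinuousLinearMap.comp_apply, key, h, natChart_snd hq]
  · intro h u
    rw [← key, ← natChart_snd hq, ← h, ContinuousLinearMap.comp_apply]

end CoordinateMap

/-! ## Smoothness of null lifts and of the projection along null geodesics -/

section InducedMetricCoordinates

variable {E : Type*} [NormedAddCommGroup E] [NormedSpace ℝ E]
  {F : Type*} [NormedAddCommGroup F] [NormedSpace ℝ F]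

/-- The pull-back of a bilinear form by a linear map. -/
noncomputable def pullbackForm (B : E →L[ℝ] E →L[ℝ] ℝ) (A : F →L[ℝ] E) : F →L[ℝ] F →L[ℝ] ℝ :=
  (((ContinuousLinearMap.compL ℝ F E ℝ).flip A).comp B).comp A

theorem pullbackForm_apply (B : E →L[ℝ] E →L[ℝ] ℝ) (A : F →L[ℝ] E) (u v : F) :
    pullbackForm B A u v = B (A u) (A v) := rfl

theorem isInvertible_of_forall_pos [FiniteDimensional ℝ F] {B : F →L[ℝ] F →L[ℝ] ℝ}
    (hB : ∀ u, u ≠ 0 → 0 < B u u) : B.IsInvertible := by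
  have hinj : Function.Injective (B : F →ₗ[ℝ] F →L[ℝ] ℝ) := by
    rw [← LinearMap.ker_eq_bot, LinearMap.ker_eq_bot']
    intro v hv
    by_contra hne
    exact (hB v hne).ne' (DFunLike.congr_fun hv v)
  exact ⟨(LinearMap.linearEquivOfInjective (B : F →ₗ[ℝ] F →L[ℝ] ℝ)
    hinj finrank_continuousDual.symm).toContinuousLinearEquiv, by ext; rfl⟩

/-- The square of the length of a covector, in terms of a bilinear form on vectors. -/
noncomputable def dualNormSq (B : F →L[ℝ] F →L[ℝ] ℝ) (R : F →L[ℝ] ℝ) : ℝ := R (B.inverse R)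

theorem dualNormSq_smul (B : F →L[ℝ] F →L[ℝ] ℝ) (a : ℝ) (R : F →L[ℝ] ℝ) :
    dualNormSq B (a • R) = a ^ 2 * dualNormSq B R := by
  simp only [dualNormSq, map_smul, smul_apply, smul_eq_mul]
  ring

/-- Inversion is smooth at invertible forms, and positivity gives invertibility. This supplies the
smooth factor that normalizes covectors to unit length. -/
theorem contDiffAt_dualNormSq_pullbackForm [FiniteDimensional ℝ F] {V : Type*}
    [NormedAddCommGroup V] [NormedSpace ℝ V] {B : V → E →L[ℝ] E →L[ℝ] ℝ} {A : V → F →L[ℝ] E}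
    {R : V → F →L[ℝ] ℝ} {z : V} (hB : ContDiffAt ℝ ∞ B z) (hA : ContDiffAt ℝ ∞ A z)
    (hR : ContDiffAt ℝ ∞ R z) (hpos : ∀ u, u ≠ 0 → 0 < pullbackForm (B z) (A z) u u) :
    ContDiffAt ℝ ∞ (fun v => dualNormSq (pullbackForm (B v) (A v)) (R v)) z := by
  have : CompleteSpace F := FiniteDimensional.complete ℝ F
  have h1 : ContDiffAt ℝ ∞ (fun v => pullbackForm (B v) (A v)) z :=
    ((((ContinuousLinearMap.compL ℝ F E ℝ).flip.contDiff.contDiffAt.comp z hA)).clm_comp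
      hB).clm_comp hA
  obtain ⟨L, hL⟩ := isInvertible_of_forall_pos hpos
  have h2 := contDiffAt_map_inverse (𝕜 := ℝ) (n := ∞) L
  rw [hL] at h2
  have h3 : ContDiffAt ℝ ∞ (fun v => (pullbackForm (B v) (A v)).inverse) z :=
    ContDiffAt.comp (g := ContinuousLinearMap.inverse) z h2 h1
  exact hR.clm_apply (h3.clm_apply hR)

end InducedMetricCoordinates

/-! ### Transversality of null directions and smoothness of the null lift -/

section SmoothLift

variable {E : Type*} [NormedAddCommGroup E] [NormedSpace ℝ E] [FiniteDimensional ℝ E]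
  {M : Type*} [TopologicalSpace M] [ChartedSpace E M] [IsManifold 𝓘(ℝ, E) ∞ M] [T2Space M]
  {F : Type*} [NormedAddCommGroup F] [NormedSpace ℝ F] [FiniteDimensional ℝ F]
  {S : Type*} [TopologicalSpace S] [ChartedSpace F S] [IsManifold 𝓘(ℝ, F) ∞ S]

theorem exists_eq_totalSpace_mk {r : CotangentBundle E M} {x : M} (h : r.proj = x) :
    ∃ p, r = (⟨x, p⟩ : CotangentBundle E M) := by
  subst h
  exact ⟨r.2, rfl⟩

namespace SpacetimeStructure

variable {g : SpacetimeStructure E M} {ι : S → M}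
  (hι : ContMDiff 𝓘(ℝ, F) 𝓘(ℝ, E) ∞ ι)
  (hS : ∀ (x : S) (u : TangentSpace 𝓘(ℝ, F) x), u ≠ 0 → 0 < g.inducedMetric ι x u u)
  (hdim : Module.finrank ℝ F + 1 = Module.finrank ℝ E)

-- A nonzero tangent vector of the hypersurface has positive square, whereas `p^#` is nonzero with
-- square zero.
include hS in
theorem mfderiv_ne_sharp_of_mem_nullBundle {x : S} {p : TangentSpace 𝓘(ℝ, E) (ι x) →L[ℝ] ℝ}
    (hp : (⟨ι x, p⟩ : CotangentBundle E M) ∈ g.nullBundle) (u : TangentSpace 𝓘(ℝ, F) x) :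
    mfderiv 𝓘(ℝ, F) 𝓘(ℝ, E) ι x u ≠ g.sharp (ι x) p := by
  intro h
  obtain ⟨h0, -, h2⟩ := hp
  change p (g.sharp (ι x) p) = 0 at h0
  change g.val (ι x) (g.sharp (ι x) p) (g.timeField (ι x)) < 0 at h2
  have h3 : u = 0 := by
    by_contra hne
    have h4 := hS x u hne
    rw [inducedMetric, h, val_sharp_apply, h0] at h4
    exact lt_irrefl _ h4
  rw [← h, h3, map_zero, map_zero, zero_apply] at h2
  exact lt_irrefl _ h2

include hS in
theorem eq_zero_of_mfderiv_add_smul_sharp {x : S} {p : TangentSpace 𝓘(ℝ, E) (ι x) →L[ℝ] ℝ}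
    (hp : (⟨ι x, p⟩ : CotangentBundle E M) ∈ g.nullBundle) {u : TangentSpace 𝓘(ℝ, F) x} {c : ℝ}
    (h : mfderiv 𝓘(ℝ, F) 𝓘(ℝ, E) ι x u + c • g.sharp (ι x) p = 0) : u = 0 ∧ c = 0 := by
  have hc : c = 0 := by
    by_contra hc
    refine mfderiv_ne_sharp_of_mem_nullBundle hS hp (-(c⁻¹ • u)) ?_
    rw [map_neg, map_smul, eq_neg_of_add_eq_zero_left h, smul_neg, neg_neg, smul_smul,
      inv_mul_cancel₀ hc, one_smul]
  refine ⟨?_, hc⟩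
  rw [hc, zero_smul, add_zero] at h
  by_contra hne
  have h4 := hS x u hne
  rw [inducedMetric, h, map_zero] at h4
  exact lt_irrefl _ h4

-- The null direction has a nonzero normal component, so it can replace the unit normal as a
-- complement to the tangent space.
include hS hdim in
theorem exists_eq_mfderiv_add_smul_sharp {x : S} {p : TangentSpace 𝓘(ℝ, E) (ι x) →L[ℝ] ℝ}
    (hp : (⟨ι x, p⟩ : CotangentBundle E M) ∈ g.nullBundle) (e : TangentSpace 𝓘(ℝ, E) (ι x)) :
    ∃ (u : TangentSpace 𝓘(ℝ, F) x) (c : ℝ),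
      e = mfderiv 𝓘(ℝ, F) 𝓘(ℝ, E) ι x u + c • g.sharp (ι x) p := by
  obtain ⟨n, hn⟩ := exists_isUnitFutureConormal hS hdim x
  obtain ⟨u₀, c₀, h₀⟩ := IsUnitFutureConormal.exists_eq_add_smul hS hdim hn (g.sharp (ι x) p)
  obtain ⟨u, c, rfl⟩ := IsUnitFutureConormal.exists_eq_add_smul hS hdim hn e
  have hc₀ : c₀ ≠ 0 := by
    rintro rfl
    rw [zero_smul, add_zero] at h₀
    exact mfderiv_ne_sharp_of_mem_nullBundle hS hp u₀ h₀.symm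
  refine ⟨u - (c / c₀) • u₀, c / c₀, ?_⟩
  rw [h₀, map_sub, map_smul, smul_add, smul_smul, div_mul_cancel₀ _ hc₀]
  abel

variable {x₀ : S} {p₀ : TangentSpace 𝓘(ℝ, E) (ι x₀) →L[ℝ] ℝ}

theorem coordInverse_natChart_mk (x₀ : S) (p₀ : TangentSpace 𝓘(ℝ, E) (ι x₀) →L[ℝ] ℝ) :
    g.coordInverse (ι x₀) (coordMap (E := E) ι x₀ (extChartAt 𝓘(ℝ, F) x₀ x₀))
      (natChart (ι x₀) (⟨ι x₀, p₀⟩ : CotangentBundle E M)).2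
      = (chartDeriv (ι x₀) (ι x₀) (g.sharp (ι x₀) p₀) : E) := by
  rw [coordMap_extChartAt (mem_chart_source F x₀)]
  have h := g.chartDeriv_sharp (x₀ := ι x₀) (q := (⟨ι x₀, p₀⟩ : CotangentBundle E M))
    (mem_chart_source E _)
  rw [natChart_fst] at h
  exact h.symm

include hι hS hdim in
theorem coord_span (hp : (⟨ι x₀, p₀⟩ : CotangentBundle E M) ∈ g.nullBundle) (e : E) :
    ∃ (u : F) (c : ℝ),
      e = fderiv ℝ (coordMap (E := E) ι x₀) (extChartAt 𝓘(ℝ, F) x₀ x₀) u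
        + c • g.coordInverse (ι x₀) (coordMap (E := E) ι x₀ (extChartAt 𝓘(ℝ, F) x₀ x₀))
          (natChart (ι x₀) (⟨ι x₀, p₀⟩ : CotangentBundle E M)).2 := by
  obtain ⟨e, rfl⟩ := LorentzMetric.exists_chartDeriv_eq (mem_chart_source E (ι x₀)) e
  obtain ⟨u, c, rfl⟩ := exists_eq_mfderiv_add_smul_sharp hS hdim hp e
  refine ⟨(chartDeriv x₀ x₀ u : F), c, ?_⟩
  rw [coordInverse_natChart_mk, fderiv_coordMap hι (mem_chart_source F x₀)
    (mem_chart_source E (ι x₀)), map_add, map_smul]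

include hι hS in
theorem coord_transversal (hp : (⟨ι x₀, p₀⟩ : CotangentBundle E M) ∈ g.nullBundle) (u : F) (c : ℝ)
    (h : fderiv ℝ (coordMap (E := E) ι x₀) (extChartAt 𝓘(ℝ, F) x₀ x₀) u
        + c • g.coordInverse (ι x₀) (coordMap (E := E) ι x₀ (extChartAt 𝓘(ℝ, F) x₀ x₀))
          (natChart (ι x₀) (⟨ι x₀, p₀⟩ : CotangentBundle E M)).2 = 0) : u = 0 ∧ c = 0 := by
  obtain ⟨u, rfl⟩ := LorentzMetric.exists_chartDeriv_eq (mem_chart_source F x₀) u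
  rw [coordInverse_natChart_mk, fderiv_coordMap hι (mem_chart_source F x₀)
    (mem_chart_source E (ι x₀))] at h
  have h1 : mfderiv 𝓘(ℝ, F) 𝓘(ℝ, E) ι x₀ u + c • g.sharp (ι x₀) p₀ = 0 := by
    refine chartDeriv_injective (mem_chart_source E (ι x₀)) ?_
    rw [map_add, map_smul, map_zero]
    exact h
  obtain ⟨rfl, rfl⟩ := eq_zero_of_mfderiv_add_smul_sharp hS hp h1
  exact ⟨map_zero _, rfl⟩

include hι hS hdim in
/-- The null lift of unit covectors extends locally to a smooth map. -/
theorem exists_contMDiffAt_nullLift {q₀ : CotangentBundle F S} (hq₀ : q₀ ∈ g.cosphereBundle ι) :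
    ∃ Λ : CotangentBundle F S → CotangentBundle E M,
      ContMDiffAt (cotangentModel F) (cotangentModel E) ∞ Λ q₀ ∧
      ∀ᶠ q in 𝓝 q₀, q ∈ g.cosphereBundle ι → ∃ p, g.IsNullLift ι q p ∧
        (⟨ι q.proj, p⟩ : CotangentBundle E M) ∈ g.nullBundle ∧ Λ q = ⟨ι q.proj, p⟩ := by
  obtain ⟨x₀, Q₀⟩ := q₀
  obtain ⟨p₀, hp₀, hn₀⟩ : ∃ p₀ : TangentSpace 𝓘(ℝ, E) (ι x₀) →L[ℝ] ℝ,
      g.IsNullLift ι (⟨x₀, Q₀⟩ : CotangentBundle F S) p₀ ∧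
      (⟨ι x₀, p₀⟩ : CotangentBundle E M) ∈ g.nullBundle := exists_isNullLift hS hdim hq₀
  set q₀ : CotangentBundle F S := ⟨x₀, Q₀⟩ with hq₀_def
  have hxs : x₀ ∈ (chartAt F x₀).source := mem_chart_source F x₀
  have hms : ι x₀ ∈ (chartAt E (ι x₀)).source := mem_chart_source E _
  set i : F → E := coordMap (E := E) ι x₀ with hi_def
  set y₀ : F := extChartAt 𝓘(ℝ, F) x₀ x₀ with hy₀
  set P₀ : E →L[ℝ] ℝ := (natChart (ι x₀) (⟨ι x₀, p₀⟩ : CotangentBundle E M)).2 with hP₀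
  have hz₀ : natChart (ι x₀) (⟨ι x₀, p₀⟩ : CotangentBundle E M) = (i y₀, P₀) := by
    refine Prod.ext ?_ rfl
    rw [natChart_fst]
    exact (coordMap_extChartAt hxs).symm
  have hiy : i y₀ ∈ (extChartAt 𝓘(ℝ, E) (ι x₀)).target := by
    have h := natChart_fst_mem (x₀ := ι x₀) (q := (⟨ι x₀, p₀⟩ : CotangentBundle E M)) hms
    rwa [hz₀] at h
  have hw₀ : natChart x₀ q₀ = (y₀, P₀.comp (fderiv ℝ i y₀)) := by
    have h1 : (natChart x₀ q₀).1 = y₀ := natChart_fst _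
    have h2 := (natChart_comp_fderiv_coordMap (x₀ := x₀) hι (q := q₀) (p := p₀) hxs hms).1
      (IsNullLift.apply_mfderiv hp₀)
    rw [h1] at h2
    exact Prod.ext h1 h2.symm
  have hi : ContDiffAt ℝ ∞ i y₀ := contDiffAt_coordMap hι hxs hms
  have hQ : ContDiffAt ℝ ∞ (g.coordInverse (ι x₀)) (i y₀) :=
    g.contDiffOn_coordInverse.contDiffAt ((isOpen_extChartAt_target _).mem_nhds hiy)
  have hnull : coordHamiltonian (g.coordInverse (ι x₀)) (i y₀, P₀) = 0 := by
    rw [← hz₀, ← g.hamiltonian_eq (q := (⟨ι x₀, p₀⟩ : CotangentBundle E M)) hms]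
    exact (mem_nullBundle_iff.1 hn₀).1
  -- The extension exists for all covectors near `q₀`, not only for unit ones, and so gives a smooth
  -- map on an open set of `T*S`.
  obtain ⟨Λ, hΛ, hΛ0, hΛev⟩ := exists_null_extension hdim hi hQ (g.coordInverse_symm hiy)
    (coord_span hι hS hdim hn₀) hnull
  rw [← hw₀] at hΛ hΛ0 hΛev
  have hsm : ContMDiffAt (cotangentModel F) (cotangentModel E) ∞ (fun q : CotangentBundle F S =>
      ((natChart (ι x₀)).symm (i (natChart x₀ q).1, Λ (natChart x₀ q)) : CotangentBundle E M))
      q₀ := by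
    have h1 : ContDiffAt ℝ ∞ (fun w : F × (F →L[ℝ] ℝ) => (i w.1, Λ w)) (natChart x₀ q₀) := by
      refine ContDiffAt.prodMk ?_ hΛ
      refine ContDiffAt.comp (g := i) _ ?_ contDiffAt_fst
      rw [hw₀]; exact hi
    have h2 : ContMDiffAt 𝓘(ℝ, E × (E →L[ℝ] ℝ)) (cotangentModel E) ∞
        ((natChart (ι x₀)).symm : _ → CotangentBundle E M)
        (i (natChart x₀ q₀).1, Λ (natChart x₀ q₀)) :=
      contMDiffAt_natChart_symm (by rw [hw₀]; exact hiy)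
    exact ContMDiffAt.comp (g := ((natChart (ι x₀)).symm : _ → CotangentBundle E M)) q₀ h2
      (ContMDiffAt.comp (g := fun w : F × (F →L[ℝ] ℝ) => (i w.1, Λ w)) q₀ h1.contMDiffAt
        (contMDiffAt_natChart hxs))
  refine ⟨_, hsm, ?_⟩
  have hval : ((natChart (ι x₀)).symm (i (natChart x₀ q₀).1, Λ (natChart x₀ q₀)) :
      CotangentBundle E M) = ⟨ι x₀, p₀⟩ := by
    rw [hΛ0, hw₀, ← hz₀, natChart_left_inv hms]
  have hev1 := (contMDiffAt_natChart (x₀ := x₀) (q := q₀) hxs).continuousAt.eventually hΛev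
  have hev2 : ∀ᶠ q : CotangentBundle F S in 𝓝 q₀, ι q.proj ∈ (chartAt E (ι x₀)).source :=
    (hι.continuous.comp continuous_cotangent_proj).continuousAt.eventually_mem
      ((chartAt E (ι x₀)).open_source.mem_nhds hms)
  -- Being future pointing is an open condition; with nullity and the prescribed restriction it
  -- forces the extension to be the null lift.
  have hev3 : ∀ᶠ r : CotangentBundle E M in 𝓝 ⟨ι x₀, p₀⟩, r.2 (g.timeField r.proj) < 0 :=
    (g.continuousAt_apply_timeField _).eventually_lt continuousAt_const (mem_nullBundle_iff.1 hn₀).2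
  rw [← hval] at hev3
  filter_upwards [hev1, hev2, hsm.continuousAt.eventually hev3, eventually_mem_chart hxs]
    with q h1 h2 h3 h4 hq
  have hfst : i (natChart x₀ q).1 = extChartAt 𝓘(ℝ, E) (ι x₀) (ι q.proj) := by
    rw [natChart_fst]
    exact coordMap_extChartAt h4
  have hmem : i (natChart x₀ q).1 ∈ (extChartAt 𝓘(ℝ, E) (ι x₀)).target := by
    rw [hfst]
    exact (extChartAt 𝓘(ℝ, E) (ι x₀)).map_source (by simpa using h2)
  obtain ⟨p, hp⟩ := exists_eq_totalSpace_mk (r := ((natChart (ι x₀)).symm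
      (i (natChart x₀ q).1, Λ (natChart x₀ q)) : CotangentBundle E M)) (x := ι q.proj) (by
    rw [natChart_symm_proj hmem, hfst]
    exact (extChartAt 𝓘(ℝ, E) (ι x₀)).left_inv (by simpa using h2))
  have hnat : natChart (ι x₀) (⟨ι q.proj, p⟩ : CotangentBundle E M)
      = (i (natChart x₀ q).1, Λ (natChart x₀ q)) := by
    rw [← hp, natChart_right_inv hmem]
  have hmemN : (⟨ι q.proj, p⟩ : CotangentBundle E M) ∈ g.nullBundle := by
    rw [hp] at h3
    refine mem_nullBundle_iff.2 ⟨?_, h3⟩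
    rw [g.hamiltonian_eq (x₀ := ι x₀) h2, hnat]
    exact h1.2
  refine ⟨p, isNullLift_of_mem_nullBundle hS hdim hq hmemN ?_, hmemN, hp⟩
  rw [natChart_comp_fderiv_coordMap hι h4 h2, hnat]
  exact h1.1

end SpacetimeStructure

end SmoothLift

/-! ### Smooth projection to a hypersurface along null geodesics -/

section SmoothProjection

variable {E : Type*} [NormedAddCommGroup E] [NormedSpace ℝ E] [FiniteDimensional ℝ E]
  {M : Type*} [TopologicalSpace M] [ChartedSpace E M] [IsManifold 𝓘(ℝ, E) ∞ M] [T2Space M]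
  {F : Type*} [NormedAddCommGroup F] [NormedSpace ℝ F] [FiniteDimensional ℝ F]
  {S : Type*} [TopologicalSpace S] [ChartedSpace F S] [IsManifold 𝓘(ℝ, F) ∞ S]

namespace SpacetimeStructure

variable {g : SpacetimeStructure E M} {ι : S → M}
  (hι : ContMDiff 𝓘(ℝ, F) 𝓘(ℝ, E) ∞ ι)
  (hS : ∀ (x : S) (u : TangentSpace 𝓘(ℝ, F) x), u ≠ 0 → 0 < g.inducedMetric ι x u u)
  (hdim : Module.finrank ℝ F + 1 = Module.finrank ℝ E)

/-- The coordinate expression of the induced metric. -/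
noncomputable def coordInducedMetric (g : SpacetimeStructure E M) (ι : S → M) (x₀ : S) (y : F) :
    F →L[ℝ] F →L[ℝ] ℝ :=
  pullbackForm (g.coordMetric (ι x₀) (coordMap ι x₀ y)) (fderiv ℝ (coordMap (E := E) ι x₀) y)

variable {x₀ x : S}

include hι

theorem coordInducedMetric_apply (hx : x ∈ (chartAt F x₀).source)
    (hιx : ι x ∈ (chartAt E (ι x₀)).source) (u v : TangentSpace 𝓘(ℝ, F) x) :
    g.coordInducedMetric ι x₀ (extChartAt 𝓘(ℝ, F) x₀ x) (chartDeriv x₀ x u) (chartDeriv x₀ x v)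
      = g.inducedMetric ι x u v := by
  rw [coordInducedMetric, pullbackForm_apply, fderiv_coordMap hι hx hιx, fderiv_coordMap hι hx hιx,
    coordMap_extChartAt hx, g.coordMetric_apply hιx]
  rfl

include hS

theorem coordInducedMetric_pos (hx : x ∈ (chartAt F x₀).source)
    (hιx : ι x ∈ (chartAt E (ι x₀)).source) (u : F) (hu : u ≠ 0) :
    0 < g.coordInducedMetric ι x₀ (extChartAt 𝓘(ℝ, F) x₀ x) u u := by
  obtain ⟨u, rfl⟩ := LorentzMetric.exists_chartDeriv_eq hx u
  rw [coordInducedMetric_apply hι hx hιx]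
  refine hS x u ?_
  rintro rfl
  exact hu (map_zero _)

theorem dualNormSq_eq_one {Q : TangentSpace 𝓘(ℝ, F) x →L[ℝ] ℝ} (hx : x ∈ (chartAt F x₀).source)
    (hιx : ι x ∈ (chartAt E (ι x₀)).source)
    (hQ : (⟨x, Q⟩ : CotangentBundle F S) ∈ g.cosphereBundle ι) :
    dualNormSq (g.coordInducedMetric ι x₀ (extChartAt 𝓘(ℝ, F) x₀ x))
      (natChart x₀ (⟨x, Q⟩ : CotangentBundle F S)).2 = 1 := by
  obtain ⟨u, hu, huu⟩ := hQ
  have h1 : (natChart x₀ (⟨x, Q⟩ : CotangentBundle F S)).2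
      = g.coordInducedMetric ι x₀ (extChartAt 𝓘(ℝ, F) x₀ x) (chartDeriv x₀ x u) := by
    ext e
    obtain ⟨v, rfl⟩ := LorentzMetric.exists_chartDeriv_eq hx e
    rw [coordInducedMetric_apply hι hx hιx]
    exact (natChart_snd (q := (⟨x, Q⟩ : CotangentBundle F S)) hx v).trans (hu v)
  have h2 := (isInvertible_of_forall_pos
    (coordInducedMetric_pos hι hS hx hιx)).inverse_apply_self (chartDeriv x₀ x u : F)
  rw [dualNormSq, h1, h2, coordInducedMetric_apply hι hx hιx]
  exact huu

include hdim

/-- Null covectors near a hypersurface are transported by the geodesic flow to positive multiples of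
null lifts of unit covectors, which depend smoothly on the initial covector. -/
theorem exists_contMDiffAt_projection {p₀ : TangentSpace 𝓘(ℝ, E) (ι x₀) →L[ℝ] ℝ}
    (hn₀ : (⟨ι x₀, p₀⟩ : CotangentBundle E M) ∈ g.nullBundle) :
    ∃ (Γ : CotangentBundle E M → CotangentBundle F S) (τ : CotangentBundle E M → ℝ),
      ContMDiffAt (cotangentModel E) (cotangentModel F) ∞ Γ ⟨ι x₀, p₀⟩ ∧
      ContMDiffAt (cotangentModel E) 𝓘(ℝ, ℝ) ∞ τ ⟨ι x₀, p₀⟩ ∧ τ ⟨ι x₀, p₀⟩ = 0 ∧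
      ∀ᶠ r in 𝓝 (⟨ι x₀, p₀⟩ : CotangentBundle E M), r ∈ g.nullBundle →
        τ r ∈ g.geodesicDomain r ∧ Γ r ∈ g.cosphereBundle ι ∧
        ∃ a : ℝ, 0 < a ∧ ∃ p, g.IsNullLift ι (Γ r) p ∧
          g.geodesicFlow r (τ r) = ⟨ι (Γ r).proj, a • p⟩ := by
  have hxs : x₀ ∈ (chartAt F x₀).source := mem_chart_source F x₀
  have hms : ι x₀ ∈ (chartAt E (ι x₀)).source := mem_chart_source E _
  obtain ⟨U, ε, φ, hU, hzU, hε, hφ, hφ0, hφΩ, hφd, hφg⟩ :=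
    g.exists_local_geodesicFlow (⟨ι x₀, p₀⟩ : CotangentBundle E M)
  change natChart (ι x₀) (⟨ι x₀, p₀⟩ : CotangentBundle E M) ∈ U at hzU
  change ∀ z ∈ U, ∀ t ∈ Ioo (-ε) ε, (φ (z, t)).1 ∈ (extChartAt 𝓘(ℝ, E) (ι x₀)).target at hφΩ
  change ∀ z ∈ U, ∀ t ∈ Ioo (-ε) ε,
    HasDerivAt (fun s => φ (z, s)) (coordSpray (g.coordInverse (ι x₀)) (φ (z, t))) t at hφd
  change ∀ q : CotangentBundle E M, q.proj ∈ (chartAt E (ι x₀)).source → natChart (ι x₀) q ∈ U →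
    g.IsGeodesicFrom q (fun t => (natChart (ι x₀)).symm (φ (natChart (ι x₀) q, t)))
      (Ioo (-ε) ε) at hφg
  set i : F → E := coordMap (E := E) ι x₀ with hi_def
  set y₀ : F := extChartAt 𝓘(ℝ, F) x₀ x₀ with hy₀
  set P₀ : E →L[ℝ] ℝ := (natChart (ι x₀) (⟨ι x₀, p₀⟩ : CotangentBundle E M)).2 with hP₀
  have hz₀ : natChart (ι x₀) (⟨ι x₀, p₀⟩ : CotangentBundle E M) = (i y₀, P₀) := by
    refine Prod.ext ?_ rfl
    rw [natChart_fst]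
    exact (coordMap_extChartAt hxs).symm
  have hiy : i y₀ ∈ (extChartAt 𝓘(ℝ, E) (ι x₀)).target := by
    have h := natChart_fst_mem (x₀ := ι x₀) (q := (⟨ι x₀, p₀⟩ : CotangentBundle E M)) hms
    rwa [hz₀] at h
  have hyt : y₀ ∈ (extChartAt 𝓘(ℝ, F) x₀).target := mem_extChartAt_target x₀
  have hys : (extChartAt 𝓘(ℝ, F) x₀).symm y₀ = x₀ := extChartAt_to_inv x₀
  rw [hz₀] at hzU
  have hi : ContDiffAt ℝ ∞ i y₀ := contDiffAt_coordMap hι hxs hms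
  have h0ε : (0 : ℝ) ∈ Ioo (-ε) ε := ⟨by linarith, hε⟩
  have hφd0 := hφd _ hzU 0 h0ε
  rw [hφ0 _ hzU] at hφd0
  -- Here `h z = (y, p, t)` means that the flow line starting with covector `p` above the point `y`
  -- of the hypersurface reaches `z` at time `t`. The time from `z` to the hypersurface is therefore
  -- `-t`.
  obtain ⟨h, hh, hh0, hhev⟩ := exists_hitting_solution hdim hi
    (hφ.contDiffAt ((hU.prod isOpen_Ioo).mem_nhds ⟨hzU, h0ε⟩))
    ((hU.eventually_mem hzU).mono hφ0) hφd0 (coord_transversal hι hS hn₀)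
  rw [← hz₀] at hh hh0 hhev
  set z₀ := natChart (ι x₀) (⟨ι x₀, p₀⟩ : CotangentBundle E M) with hz₀_def
  have hκ : ContMDiffAt (cotangentModel E) 𝓘(ℝ, E × (E →L[ℝ] ℝ)) ∞ (natChart (ι x₀))
    (⟨ι x₀, p₀⟩ : CotangentBundle E M) := contMDiffAt_natChart hms
  -- `R` restricts the hitting covector to the hypersurface and `ν` is its squared length. If that
  -- covector is `a` times a null lift, then `ν = a²`, and `R / √ν` is the unit covector.
  let R : E × (E →L[ℝ] ℝ) → F →L[ℝ] ℝ := fun z => (h z).2.1.comp (fderiv ℝ i (h z).1)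
  let ν : E × (E →L[ℝ] ℝ) → ℝ := fun z => dualNormSq (g.coordInducedMetric ι x₀ (h z).1) (R z)
  have hdi : ContDiffAt ℝ ∞ (fun z => fderiv ℝ i (h z).1) z₀ := by
    refine ContDiffAt.comp (g := fderiv ℝ i) z₀ ?_ hh.fst
    rw [hh0]
    exact hi.fderiv_right (m := ∞) (by simp)
  have hR : ContDiffAt ℝ ∞ R z₀ := hh.snd.fst.clm_comp hdi
  have hih : ContDiffAt ℝ ∞ (fun z => i (h z).1) z₀ := by
    refine ContDiffAt.comp (g := i) z₀ ?_ hh.fst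
    rw [hh0]
    exact hi
  have hν : ContDiffAt ℝ ∞ ν z₀ := by
    refine contDiffAt_dualNormSq_pullbackForm (B := fun z => g.coordMetric (ι x₀) (i (h z).1))
      (A := fun z => fderiv ℝ i (h z).1) ?_ hdi hR ?_
    · refine ContDiffAt.comp (g := g.coordMetric (ι x₀)) z₀ ?_ hih
      rw [hh0]
      exact g.contDiffOn_coordMetric.contDiffAt ((isOpen_extChartAt_target _).mem_nhds hiy)
    · rw [hh0]
      exact coordInducedMetric_pos hι hS hxs hms
  -- the value of the coordinate functions in terms of the null covector
  have key : ∀ (x : S) (Q : TangentSpace 𝓘(ℝ, F) x →L[ℝ] ℝ) (a : ℝ)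
      (p : TangentSpace 𝓘(ℝ, E) (ι x) →L[ℝ] ℝ), x ∈ (chartAt F x₀).source →
      ι x ∈ (chartAt E (ι x₀)).source → (⟨x, Q⟩ : CotangentBundle F S) ∈ g.cosphereBundle ι →
      0 < a → g.IsNullLift ι (⟨x, Q⟩ : CotangentBundle F S) p → ∀ z, (h z).1 = extChartAt 𝓘(ℝ, F) x₀ x →
      (h z).2.1 = (natChart (ι x₀) (⟨ι x, a • p⟩ : CotangentBundle E M)).2 →
      ν z = a ^ 2 ∧ R z = a • (natChart x₀ (⟨x, Q⟩ : CotangentBundle F S)).2 := by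
    intro x Q a p hx hιx hQ ha hp z hz1 hz2
    have h1 := (natChart_comp_fderiv_coordMap (x₀ := x₀) hι
      (q := scaleCovector a (⟨x, Q⟩ : CotangentBundle F S)) (p := a • p) hx hιx).1 fun u =>
        congrArg (a • ·) (IsNullLift.apply_mfderiv hp u)
    rw [natChart_scaleCovector (q := (⟨x, Q⟩ : CotangentBundle F S)) hx] at h1
    simp only [natChart_fst] at h1
    have h2 : R z = a • (natChart x₀ (⟨x, Q⟩ : CotangentBundle F S)).2 := by
      rw [← h1]
      simp only [R, hz1, hz2]
      rfl
    refine ⟨?_, h2⟩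
    simp only [ν]
    rw [h2, hz1, dualNormSq_smul, dualNormSq_eq_one hι hS hx hιx hQ, mul_one]
  have hν0 : ν z₀ ≠ 0 := by
    obtain ⟨Q, a, p, hQ, ha, hp, hpp⟩ := exists_pos_smul_isNullLift hS hdim hn₀
    have h1 := (key x₀ Q a p hxs hms hQ ha hp z₀ (by rw [hh0]) (by rw [hh0, ← hpp])).1
    rw [h1]
    positivity
  have hν' : ContDiffAt ℝ ∞ (fun z => (√(ν z))⁻¹) z₀ :=
    (hν.sqrt hν0).inv (Real.sqrt_ne_zero'.2 (lt_of_le_of_ne (by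
      obtain ⟨Q, a, p, hQ, ha, hp, hpp⟩ := exists_pos_smul_isNullLift hS hdim hn₀
      rw [(key x₀ Q a p hxs hms hQ ha hp z₀ (by rw [hh0]) (by rw [hh0, ← hpp])).1]
      positivity) hν0.symm))
  have hΓc : ContDiffAt ℝ ∞ (fun z => ((h z).1, (√(ν z))⁻¹ • R z)) z₀ :=
    hh.fst.prodMk (hν'.smul hR)
  refine ⟨fun r => (natChart x₀).symm ((h (natChart (ι x₀) r)).1,
      (√(ν (natChart (ι x₀) r)))⁻¹ • R (natChart (ι x₀) r)),
    fun r => -(h (natChart (ι x₀) r)).2.2, ?_, ?_, ?_, ?_⟩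
  · have h2 : ContMDiffAt 𝓘(ℝ, F × (F →L[ℝ] ℝ)) (cotangentModel F) ∞
        ((natChart x₀).symm : _ → CotangentBundle F S) ((h z₀).1, (√(ν z₀))⁻¹ • R z₀) :=
      contMDiffAt_natChart_symm (by rw [hh0]; exact hyt)
    exact ContMDiffAt.comp (g := ((natChart x₀).symm : _ → CotangentBundle F S)) _ h2
      (ContMDiffAt.comp (g := fun z => ((h z).1, (√(ν z))⁻¹ • R z)) _ hΓc.contMDiffAt hκ)
  · exact ContMDiffAt.comp (g := fun z => -(h z).2.2) _ hh.snd.snd.neg.contMDiffAt hκ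
  · change -(h z₀).2.2 = 0
    rw [hh0, neg_zero]
  · have hc := hκ.continuousAt
    have hhc : ContinuousAt h z₀ := hh.continuousAt
    have ev1 : ∀ᶠ z in 𝓝 z₀, (h z).1 ∈ (extChartAt 𝓘(ℝ, F) x₀).target :=
      hhc.fst.eventually_mem ((isOpen_extChartAt_target x₀).mem_nhds (by rw [hh0]; exact hyt))
    have ev2 : ∀ᶠ z in 𝓝 z₀, ι ((extChartAt 𝓘(ℝ, F) x₀).symm (h z).1) ∈
        (chartAt E (ι x₀)).source := by
      have h1 : ContinuousAt (fun y => ι ((extChartAt 𝓘(ℝ, F) x₀).symm y)) y₀ :=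
        ContinuousAt.comp (g := ι) hι.continuous.continuousAt (continuousAt_extChartAt_symm x₀)
      have h2 : ∀ᶠ y in 𝓝 y₀, ι ((extChartAt 𝓘(ℝ, F) x₀).symm y) ∈ (chartAt E (ι x₀)).source :=
        h1.eventually_mem ((chartAt E (ι x₀)).open_source.mem_nhds (by rw [hys]; exact hms))
      have h3 := hhc.fst
      rw [ContinuousAt, hh0] at h3
      exact h3.eventually h2
    have ev3 : ∀ᶠ z in 𝓝 z₀, (i (h z).1, (h z).2.1) ∈ U :=
      (hih.continuousAt.prodMk hhc.snd.fst).eventually_mem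
        (hU.mem_nhds (by rw [hh0]; exact hzU))
    have ev4 : ∀ᶠ z in 𝓝 z₀, (h z).2.2 ∈ Ioo (-ε) ε :=
      hhc.snd.snd.eventually_mem (isOpen_Ioo.mem_nhds (by rw [hh0]; exact h0ε))
    filter_upwards [hc.eventually (hhev.and (ev1.and (ev2.and (ev3.and ev4)))),
      eventually_mem_chart hms] with r hr hrs hrn
    obtain ⟨h1, h2, h3, h4, h5⟩ := hr
    set z := natChart (ι x₀) r with hz
    set x := (extChartAt 𝓘(ℝ, F) x₀).symm (h z).1 with hx
    have hxx : x ∈ (chartAt F x₀).source := chart_symm_mem h2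
    have hyx : (h z).1 = extChartAt 𝓘(ℝ, F) x₀ x := ((extChartAt 𝓘(ℝ, F) x₀).right_inv h2).symm
    have hix : i (h z).1 = extChartAt 𝓘(ℝ, E) (ι x₀) (ι x) := by
      rw [hyx]; exact coordMap_extChartAt hxx
    have hit : i (h z).1 ∈ (extChartAt 𝓘(ℝ, E) (ι x₀)).target := by
      rw [hix]
      exact (extChartAt 𝓘(ℝ, E) (ι x₀)).map_source (by simpa using h3)
    obtain ⟨ps, hs⟩ := exists_eq_totalSpace_mk (r := ((natChart (ι x₀)).symm
        (i (h z).1, (h z).2.1) : CotangentBundle E M)) (x := ι x) (by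
      rw [natChart_symm_proj hit, hix]
      exact (extChartAt 𝓘(ℝ, E) (ι x₀)).left_inv (by simpa using h3))
    have hnat : natChart (ι x₀) (⟨ι x, ps⟩ : CotangentBundle E M) = (i (h z).1, (h z).2.1) := by
      rw [← hs, natChart_right_inv hit]
    have hgeo := hφg (⟨ι x, ps⟩ : CotangentBundle E M) h3 (by rw [hnat]; exact h4)
    have hflow : g.geodesicFlow (⟨ι x, ps⟩ : CotangentBundle E M) (h z).2.2 = r := by
      rw [hgeo.geodesicFlow_eq h5, hnat, h1, hz, natChart_left_inv hrs]
    obtain ⟨h6, h7⟩ := geodesicFlow_neg (hgeo.subset_geodesicDomain h5)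
    rw [hflow] at h6 h7
    -- The hitting covector lies on the orbit of the future null covector `r`, so it can be
    -- normalized.
    have hsn : (⟨ι x, ps⟩ : CotangentBundle E M) ∈ g.nullBundle := by
      rw [← h7]
      exact geodesicFlow_mem_nullBundle hrn h6
    obtain ⟨Q, a, p, hQ, ha, hp, rfl⟩ := exists_pos_smul_isNullLift hS hdim hsn
    obtain ⟨e1, e2⟩ := key x Q a p hxx h3 hQ ha hp z hyx (by rw [hnat])
    have hΓ : ((natChart x₀).symm ((h z).1, (√(ν z))⁻¹ • R z) : CotangentBundle F S) = ⟨x, Q⟩ := by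
      rw [e1, e2, Real.sqrt_sq ha.le, smul_smul, inv_mul_cancel₀ ha.ne', one_smul]
      have e3 : natChart x₀ (⟨x, Q⟩ : CotangentBundle F S)
          = ((h z).1, (natChart x₀ (⟨x, Q⟩ : CotangentBundle F S)).2) :=
        Prod.ext ((natChart_fst _).trans hyx.symm) rfl
      rw [← e3]
      exact natChart_left_inv hxx
    rw [hΓ]
    exact ⟨h6, hQ, a, ha, p, hp, h7⟩

end SpacetimeStructure

end SmoothProjection

/-! ### The canonical one-form and restriction to a hypersurface -/

section OneForm

variable {E : Type*} [NormedAddCommGroup E] [NormedSpace ℝ E]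
  {M : Type*} [TopologicalSpace M] [ChartedSpace E M] [IsManifold 𝓘(ℝ, E) ∞ M]
  {F : Type*} [NormedAddCommGroup F] [NormedSpace ℝ F]
  {S : Type*} [TopologicalSpace S] [ChartedSpace F S] [IsManifold 𝓘(ℝ, F) ∞ S]

theorem oneFormVelocity_eq_apply_mfderiv_proj {Z : ℝ → CotangentBundle E M} {s : ℝ}
    (hZ : MDifferentiableAt 𝓘(ℝ, ℝ) (cotangentModel E) Z s) :
    oneFormVelocity Z s
      = (Z s).2 (mfderiv 𝓘(ℝ, ℝ) 𝓘(ℝ, E) (fun t => (Z t).proj) s (1 : ℝ)) := by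
  have h1 : MDifferentiableAt (cotangentModel E) 𝓘(ℝ, E)
      (fun r : CotangentBundle E M => r.proj) (Z s) :=
    (Bundle.contMDiffAt_proj (n := ∞) _).mdifferentiableAt (by simp)
  have h2 := mfderiv_comp_apply s h1 hZ (1 : ℝ)
  exact (congrArg (Z s).2 h2).symm

/-- A curve of covectors of `M` along a map `ι : S → M`, and the restricted curve of covectors
of `S`. -/
theorem oneFormVelocity_eq_of_restrict {ι : S → M} {Z : ℝ → CotangentBundle E M}
    {b : ℝ → CotangentBundle F S} {a s : ℝ}
    (hι : MDifferentiableAt 𝓘(ℝ, F) 𝓘(ℝ, E) ι (b s).proj)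
    (hZ : MDifferentiableAt 𝓘(ℝ, ℝ) (cotangentModel E) Z s)
    (hb : MDifferentiableAt 𝓘(ℝ, ℝ) (cotangentModel F) b s)
    (hproj : ∀ᶠ t in 𝓝 s, (Z t).proj = ι (b t).proj)
    {p : TangentSpace 𝓘(ℝ, E) (ι (b s).proj) →L[ℝ] ℝ} (hp : Z s = ⟨ι (b s).proj, p⟩)
    (hres : ∀ u, p (mfderiv 𝓘(ℝ, F) 𝓘(ℝ, E) ι (b s).proj u) = a * (b s).2 u) :
    oneFormVelocity Z s = a * oneFormVelocity b s := by
  rw [oneFormVelocity_eq_apply_mfderiv_proj hZ, oneFormVelocity_eq_apply_mfderiv_proj hb, ← hres]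
  have h1 : MDifferentiableAt (cotangentModel F) 𝓘(ℝ, F)
      (fun r : CotangentBundle F S => r.proj) (b s) :=
    (Bundle.contMDiffAt_proj (n := ∞) _).mdifferentiableAt (by simp)
  have h2 : MDifferentiableAt 𝓘(ℝ, ℝ) 𝓘(ℝ, F) (fun t => (b t).proj) s := h1.comp s hb
  have h3 := mfderiv_comp_apply s (g := ι) (f := fun t => (b t).proj) hι h2 (1 : ℝ)
  have h4 : (fun t => (Z t).proj) =ᶠ[𝓝 s] ι ∘ fun t => (b t).proj := hproj
  have h5 := h4.mfderiv_eq (I := 𝓘(ℝ, ℝ)) (I' := 𝓘(ℝ, E))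
  -- The pairing is moved across an equality of points of `T*M` whose covector components have
  -- different types.
  have key : ∀ (r : CotangentBundle E M) (x : M) (p : TangentSpace 𝓘(ℝ, E) x →L[ℝ] ℝ),
      r = ⟨x, p⟩ → ∀ v : E, r.2 v = p v := by
    rintro r x p rfl v
    rfl
  refine (key _ _ _ hp _).trans (congrArg p ?_)
  rw [← h3]
  exact DFunLike.congr_fun h5 (1 : ℝ)

end OneForm

/-! ## Contact mappings -/

section ContactCurves

variable {F : Type*} [NormedAddCommGroup F] [NormedSpace ℝ F]
  {S : Type*} [TopologicalSpace S] [ChartedSpace F S] [IsManifold 𝓘(ℝ, F) ∞ S]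
  {S' : Type*} [TopologicalSpace S'] [ChartedSpace F S'] [IsManifold 𝓘(ℝ, F) ∞ S']

/-- A smooth curve, defined near `0`, in a subset of `T*S`. -/
structure IsCurveInAt (A : Set (CotangentBundle F S)) (c : ℝ → CotangentBundle F S)
    (q : CotangentBundle F S) : Prop where
  contMDiffAt : ContMDiffAt 𝓘(ℝ, ℝ) (cotangentModel F) ∞ c 0
  eventually_mem : ∀ᶠ t in 𝓝 0, c t ∈ A
  start : c 0 = q

theorem hasMFDerivAt_comp_curve {Φ : CotangentBundle F S → CotangentBundle F S'}
    {q : CotangentBundle F S} {c : ℝ → CotangentBundle F S}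
    {w : TangentSpace (cotangentModel F) q}
    (hΦ : MDifferentiableAt (cotangentModel F) (cotangentModel F) Φ q) (h0 : c 0 = q)
    (hc : HasMFDerivAt 𝓘(ℝ, ℝ) (cotangentModel F) c 0 ((1 : ℝ →L[ℝ] ℝ).smulRight w)) :
    HasMFDerivAt 𝓘(ℝ, ℝ) (cotangentModel F) (fun t => Φ (c t)) 0
      ((1 : ℝ →L[ℝ] ℝ).smulRight (mfderiv (cotangentModel F) (cotangentModel F) Φ q w)) := by
  subst h0
  have h1 := HasMFDerivAt.comp (0 : ℝ) hΦ.hasMFDerivAt hc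
  have h2 : (mfderiv (cotangentModel F) (cotangentModel F) Φ (c 0)).comp
      ((1 : ℝ →L[ℝ] ℝ).smulRight w) =
      (1 : ℝ →L[ℝ] ℝ).smulRight (mfderiv (cotangentModel F) (cotangentModel F) Φ (c 0) w) := by
    ext
    simp
  rw [← h2]
  exact h1

theorem canonicalOneForm_eq_oneFormVelocity {q : CotangentBundle F S}
    {c : ℝ → CotangentBundle F S} {w : TangentSpace (cotangentModel F) q} (h0 : c 0 = q)
    (hc : HasMFDerivAt 𝓘(ℝ, ℝ) (cotangentModel F) c 0 ((1 : ℝ →L[ℝ] ℝ).smulRight w)) :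
    canonicalOneForm q w = oneFormVelocity c 0 := by
  subst h0
  rw [oneFormVelocity, hc.mfderiv]
  exact congrArg (canonicalOneForm (c 0)) (one_smul ℝ w).symm

theorem velocity_unique {q : CotangentBundle F S} {c c' : ℝ → CotangentBundle F S}
    {w w' : TangentSpace (cotangentModel F) q} (h0 : c 0 = q)
    (hc : HasMFDerivAt 𝓘(ℝ, ℝ) (cotangentModel F) c 0 ((1 : ℝ →L[ℝ] ℝ).smulRight w))
    (hc' : HasMFDerivAt 𝓘(ℝ, ℝ) (cotangentModel F) c' 0 ((1 : ℝ →L[ℝ] ℝ).smulRight w'))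
    (h : c =ᶠ[𝓝 0] c') : w = w' := by
  subst h0
  have h1 := hasMFDerivAt_unique hc (hc'.congr_of_eventuallyEq h)
  have h2 := DFunLike.congr_fun h1 (1 : ℝ)
  exact (one_smul ℝ w).symm.trans (h2.trans (one_smul ℝ w'))

theorem IsCurveInAt.comp {A : Set (CotangentBundle F S)} {B : Set (CotangentBundle F S')}
    {Φ : CotangentBundle F S → CotangentBundle F S'} {q : CotangentBundle F S}
    {c : ℝ → CotangentBundle F S} (hc : IsCurveInAt A c q)
    (hΦ : ContMDiffAt (cotangentModel F) (cotangentModel F) ∞ Φ q)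
    (hAB : ∀ᶠ r in 𝓝 q, r ∈ A → Φ r ∈ B) : IsCurveInAt B (fun t => Φ (c t)) (Φ q) := by
  obtain ⟨h1, h2, rfl⟩ := hc
  refine ⟨ContMDiffAt.comp (g := Φ) (0 : ℝ) hΦ h1, ?_, rfl⟩
  filter_upwards [h2, h1.continuousAt.eventually hAB] with t h3 h4
  exact h4 h3

/-- Tangent vectors are velocities of curves, and `Φ` carries curves in `A` to curves in `B`. The
factor `k` may depend on the curve, since only the kernel of the one-form matters. -/
theorem mfderiv_mem_contactPlane {A : Set (CotangentBundle F S)} {B : Set (CotangentBundle F S')}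
    {Φ : CotangentBundle F S → CotangentBundle F S'} {q : CotangentBundle F S}
    (hΦ : ContMDiffAt (cotangentModel F) (cotangentModel F) ∞ Φ q)
    (hAB : ∀ᶠ r in 𝓝 q, r ∈ A → Φ r ∈ B)
    (hθ : ∀ c, IsCurveInAt A c q →
      ∃ k : ℝ, oneFormVelocity (fun t => Φ (c t)) 0 = k * oneFormVelocity c 0)
    {w : TangentSpace (cotangentModel F) q} (hw : w ∈ contactPlane A q) :
    mfderiv (cotangentModel F) (cotangentModel F) Φ q w ∈ contactPlane B (Φ q) := by
  obtain ⟨⟨c, hc1, hc2, hc3, hc4⟩, hw0⟩ := hw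
  have hc : IsCurveInAt A c q := ⟨hc1, hc2, hc3⟩
  obtain ⟨h1, h2, h3⟩ := hc.comp hΦ hAB
  have h4 := hasMFDerivAt_comp_curve (hΦ.mdifferentiableAt (by simp)) hc3 hc4
  refine ⟨⟨_, h1, h2, h3, h4⟩, ?_⟩
  obtain ⟨k, hk⟩ := hθ c hc
  rw [canonicalOneForm_eq_oneFormVelocity h3 h4, hk, ← canonicalOneForm_eq_oneFormVelocity hc3 hc4,
    hw0, mul_zero]

/-- The preimage of `w'` is its image under the differential of `Ψ`. As `Φ ∘ Ψ` is the identity only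
on `B`, the chain rule is applied along a curve in `B` with velocity `w'`. -/
theorem exists_mem_contactPlane_mfderiv_eq {A : Set (CotangentBundle F S)}
    {B : Set (CotangentBundle F S')} {Φ : CotangentBundle F S → CotangentBundle F S'}
    {Ψ : CotangentBundle F S' → CotangentBundle F S} {q : CotangentBundle F S}
    {q' : CotangentBundle F S'}
    (hΦ : ContMDiffAt (cotangentModel F) (cotangentModel F) ∞ Φ q)
    (hΨ : ContMDiffAt (cotangentModel F) (cotangentModel F) ∞ Ψ q')
    (hBA : ∀ᶠ r in 𝓝 q', r ∈ B → Ψ r ∈ A ∧ Φ (Ψ r) = r) (hqq' : Φ q = q') (hq : Ψ q' = q)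
    (hθ : ∀ c, IsCurveInAt B c q' →
      ∃ k : ℝ, oneFormVelocity (fun t => Ψ (c t)) 0 = k * oneFormVelocity c 0)
    {w' : TangentSpace (cotangentModel F) q'} (hw : w' ∈ contactPlane B q') :
    ∃ w ∈ contactPlane A q,
      (mfderiv (cotangentModel F) (cotangentModel F) Φ q w : TangentSpace (cotangentModel F) q')
        = w' := by
  subst hq
  refine ⟨_, mfderiv_mem_contactPlane hΨ (hBA.mono fun r hr hrB => (hr hrB).1) hθ hw, ?_⟩
  obtain ⟨⟨c, hc1, hc2, hc3, hc4⟩, -⟩ := hw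
  have h1 := hasMFDerivAt_comp_curve (hΨ.mdifferentiableAt (by simp)) hc3 hc4
  have h2 := hasMFDerivAt_comp_curve (hΦ.mdifferentiableAt (by simp))
    (show Ψ (c 0) = Ψ q' by rw [hc3]) h1
  refine (velocity_unique (q := q') hc3 hc4 h2 ?_).symm
  have h3 : Tendsto c (𝓝 0) (𝓝 q') := hc3 ▸ hc1.continuousAt
  filter_upwards [hc2, h3.eventually hBA] with t ht1 ht2
  exact (ht2 ht1).2.symm

/-- A bijection is a contact mapping if it and its inverse have smooth local extensions
that rescale the canonical one-form along curves. -/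
theorem isContactMapping_of_exists_extension {A : Set (CotangentBundle F S)}
    {B : Set (CotangentBundle F S')} (f : A ≃ B)
    (hf : ∀ q : A, ∃ Φ, IsSmoothExtensionAt f q Φ ∧ ∀ c, IsCurveInAt A c q →
      ∃ k : ℝ, oneFormVelocity (fun t => Φ (c t)) 0 = k * oneFormVelocity c 0)
    (hf' : ∀ q : B, ∃ Φ, IsSmoothExtensionAt f.symm q Φ ∧ ∀ c, IsCurveInAt B c q →
      ∃ k : ℝ, oneFormVelocity (fun t => Φ (c t)) 0 = k * oneFormVelocity c 0) :
    IsContactMapping f := by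
  refine ⟨fun q => (hf q).imp fun _ h => h.1, fun q => (hf' q).imp fun _ h => h.1, ?_⟩
  rintro q Φ ⟨hΦ, hΦf⟩
  -- The given extension `Φ` is arbitrary and only `Φ'` is known to rescale the one-form. The two
  -- agree on `A` near `q`, hence along every curve in `A` through `q`.
  obtain ⟨Φ', ⟨-, hΦf'⟩, hθ⟩ := hf q
  obtain ⟨Ψ, ⟨hΨ, hΨf⟩, hθ'⟩ := hf' (f q)
  have hq : Φ q = f q := hΦf.self_of_nhds q.2
  have hΨq : Ψ (f q) = q := by
    have h := hΨf.self_of_nhds (f q).2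
    simpa using h
  refine Subset.antisymm ?_ ?_
  · rintro _ ⟨w, hw, rfl⟩
    refine mfderiv_mem_contactPlane hΦ (hΦf.mono fun r hr hrA => ?_) (fun c hc => ?_) hw
    · rw [hr hrA]; exact (f ⟨r, hrA⟩).2
    · obtain ⟨k, hk⟩ := hθ c hc
      refine ⟨k, (oneFormVelocity_congr ?_).trans hk⟩
      have h3 : Tendsto c (𝓝 0) (𝓝 q) := hc.start ▸ hc.contMDiffAt.continuousAt
      filter_upwards [hc.eventually_mem, h3.eventually hΦf, h3.eventually hΦf'] with t h1 h2 h4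
      rw [h2 h1, h4 h1]
  · intro w' hw'
    have hBA : ∀ᶠ r in 𝓝 (f q : CotangentBundle F S'), r ∈ B → Ψ r ∈ A ∧ Φ (Ψ r) = r := by
      have h3 : Tendsto Ψ (𝓝 (f q : CotangentBundle F S')) (𝓝 q) := by
        have := hΨ.continuousAt
        rwa [ContinuousAt, hΨq] at this
      filter_upwards [hΨf, h3.eventually hΦf] with r h1 h2 hr
      have h4 : Ψ r ∈ A := by
        rw [h1 hr]; exact (f.symm ⟨r, hr⟩).2
      refine ⟨h4, ?_⟩
      rw [h2 h4]
      have h5 : (⟨Ψ r, h4⟩ : A) = f.symm ⟨r, hr⟩ := Subtype.ext (h1 hr)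
      rw [h5, Equiv.apply_symm_apply]
    rw [← hq] at hΨ hBA hΨq hθ'
    exact exists_mem_contactPlane_mfderiv_eq hΦ hΨ hBA rfl hΨq hθ' hw'

end ContactCurves

/-! ### The null geodesic correspondence as a contact mapping -/

section NullGeodesicContact

variable {E : Type*} [NormedAddCommGroup E] [NormedSpace ℝ E] [FiniteDimensional ℝ E]
  {M : Type*} [TopologicalSpace M] [ChartedSpace E M] [IsManifold 𝓘(ℝ, E) ∞ M] [T2Space M]
  {F : Type*} [NormedAddCommGroup F] [NormedSpace ℝ F] [FiniteDimensional ℝ F]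
  {S₁ : Type*} [TopologicalSpace S₁] [ChartedSpace F S₁] [IsManifold 𝓘(ℝ, F) ∞ S₁]
  {S₂ : Type*} [TopologicalSpace S₂] [ChartedSpace F S₂] [IsManifold 𝓘(ℝ, F) ∞ S₂]

namespace SpacetimeStructure

variable {g : SpacetimeStructure E M} {ι₁ : S₁ → M} {ι₂ : S₂ → M}

/-- The correspondence of unit covectors by null geodesics extends locally to a smooth map which
rescales the canonical one-form along curves. -/
theorem exists_extension_geodesicRelated
    (hdim : Module.finrank ℝ F + 1 = Module.finrank ℝ E) (h₁ : g.IsCauchySurface (F := F) ι₁)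
    (h₂ : g.IsCauchySurface (F := F) ι₂) {q₁ : CotangentBundle F S₁}
    (hq₁ : q₁ ∈ g.cosphereBundle ι₁) :
    ∃ Φ : CotangentBundle F S₁ → CotangentBundle F S₂,
      ContMDiffAt (cotangentModel F) (cotangentModel F) ∞ Φ q₁ ∧
      (∀ᶠ q in 𝓝 q₁, q ∈ g.cosphereBundle ι₁ →
        Φ q ∈ g.cosphereBundle ι₂ ∧ g.GeodesicRelated ι₁ ι₂ q (Φ q)) ∧
      ∀ c, IsCurveInAt (g.cosphereBundle ι₁) c q₁ →
        ∃ k : ℝ, oneFormVelocity (fun t => Φ (c t)) 0 = k * oneFormVelocity c 0 := by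
  obtain ⟨Λ, hΛ, hΛev⟩ := exists_contMDiffAt_nullLift h₁.contMDiff h₁.spacelike hdim hq₁
  obtain ⟨p₁, hp₁, hn₁, hΛ₁⟩ := hΛev.self_of_nhds hq₁
  rw [← hΛ₁] at hn₁
  -- The arrival time of the geodesic from `q₁` is frozen: nearby geodesics are flowed for the same
  -- time `t`, and a small correction `τ` then brings them to the second surface. Only this local
  -- correction needs a transversality argument.
  obtain ⟨t, ht, x₂, hx₂⟩ :=
    (h₂.existsUnique_meets _ _ (isInextendibleCausalCurveOn_geodesicFlow hn₁)).exists
  have hn₂ := geodesicFlow_mem_nullBundle hn₁ ht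
  obtain ⟨p, hp⟩ := exists_eq_totalSpace_mk hx₂.symm
  have hn₂' := hn₂
  rw [hp] at hn₂'
  obtain ⟨Γ, τ, hΓ, hτ, hτ0, hΓev⟩ :=
    exists_contMDiffAt_projection h₂.contMDiff h₂.spacelike hdim hn₂'
  rw [← hp] at hΓ hτ hτ0 hΓev
  have hreg := isFlowRegularAt ht
  have hreg0 := isFlowRegularAt (g.zero_mem_geodesicDomain (g.geodesicFlow (Λ q₁) t))
  have hG : ContMDiffAt (cotangentModel F) (cotangentModel E) ∞
      (fun q => g.geodesicFlow (Λ q) t) q₁ := by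
    have h1 : ContMDiffAt (cotangentModel F) ((cotangentModel E).prod 𝓘(ℝ, ℝ)) ∞
        (fun q => (Λ q, t)) q₁ := hΛ.prodMk contMDiffAt_const
    exact ContMDiffAt.comp (g := fun r : CotangentBundle E M × ℝ => g.geodesicFlow r.1 r.2)
      q₁ hreg.contMDiffAt h1
  have hev : ∀ᶠ q in 𝓝 q₁, q ∈ g.cosphereBundle ι₁ →
      ∃ (p : TangentSpace 𝓘(ℝ, E) (ι₁ q.proj) →L[ℝ] ℝ) (a : ℝ)
        (p' : TangentSpace 𝓘(ℝ, E) (ι₂ (Γ (g.geodesicFlow (Λ q) t)).proj) →L[ℝ] ℝ),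
        g.IsNullLift ι₁ q p ∧ Λ q = ⟨ι₁ q.proj, p⟩ ∧ Λ q ∈ g.nullBundle ∧
        t ∈ g.geodesicDomain (Λ q) ∧
        τ (g.geodesicFlow (Λ q) t) ∈ g.geodesicDomain (g.geodesicFlow (Λ q) t) ∧
        Γ (g.geodesicFlow (Λ q) t) ∈ g.cosphereBundle ι₂ ∧ 0 < a ∧
        g.IsNullLift ι₂ (Γ (g.geodesicFlow (Λ q) t)) p' ∧
        g.geodesicFlow (g.geodesicFlow (Λ q) t) (τ (g.geodesicFlow (Λ q) t))
          = ⟨ι₂ (Γ (g.geodesicFlow (Λ q) t)).proj, a • p'⟩ := by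
    have h1 : ∀ᶠ q in 𝓝 q₁, t ∈ g.geodesicDomain (Λ q) :=
      (hΛ.continuousAt.prodMk continuousAt_const).eventually hreg.eventually_mem
    filter_upwards [hΛev, h1, hG.continuousAt.eventually hΓev] with q h2 h3 h4 hq
    obtain ⟨p, hp, hpn, hpe⟩ := h2 hq
    rw [← hpe] at hpn
    obtain ⟨h5, h6, a, ha, p', hp', h7⟩ := h4 (geodesicFlow_mem_nullBundle hpn h3)
    exact ⟨p, a, p', hp, hpe, hpn, h3, h5, h6, ha, hp', h7⟩
  refine ⟨fun q => Γ (g.geodesicFlow (Λ q) t), ContMDiffAt.comp (g := Γ) q₁ hΓ hG, ?_, ?_⟩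
  · filter_upwards [hev] with q h hq
    obtain ⟨p, a, p', hp, hΛq, hn, htd, hτd, hc, ha, hp', hfl⟩ := h hq
    refine ⟨hc, geodesicRelated_iff.2 ⟨p, p', τ (g.geodesicFlow (Λ q) t) + t, a, hp, hp', ?_⟩⟩
    rw [← hΛq]
    obtain ⟨h1, h2⟩ := add_mem_geodesicDomain htd hτd
    exact ⟨hn, h1, ha, h2.trans hfl⟩
  · intro c hc
    obtain ⟨hc1, hc2, hc3⟩ := hc
    subst hc3
    have hcev : ∀ᶠ s in 𝓝 (0 : ℝ), c s ∈ g.cosphereBundle ι₁ ∧ _ :=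
      hc2.and (hc1.continuousAt.eventually hev)
    have hcd : MDifferentiableAt 𝓘(ℝ, ℝ) (cotangentModel F) c 0 := hc1.mdifferentiableAt (by simp)
    have hZd : MDifferentiableAt 𝓘(ℝ, ℝ) (cotangentModel E) (fun s => Λ (c s)) 0 :=
      (ContMDiffAt.comp (g := Λ) (0 : ℝ) hΛ hc1).mdifferentiableAt (by simp)
    have hWs : ContMDiffAt 𝓘(ℝ, ℝ) (cotangentModel E) ∞
        (fun s => g.geodesicFlow (Λ (c s)) t) 0 :=
      ContMDiffAt.comp (g := fun q => g.geodesicFlow (Λ q) t) (0 : ℝ) hG hc1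
    have hWd := hWs.mdifferentiableAt (n := ∞) (by simp)
    have hτd : DifferentiableAt ℝ (fun s => τ (g.geodesicFlow (Λ (c s)) t)) 0 :=
      ((ContMDiffAt.comp (g := τ) (0 : ℝ) hτ hWs).contDiffAt).differentiableAt (by simp)
    have hH : ∀ᶠ s in 𝓝 (0 : ℝ), g.hamiltonian (Λ (c s)) = 0 := by
      filter_upwards [hcev] with s ⟨hs, h⟩
      obtain ⟨-, -, -, -, -, hn, -⟩ := h hs
      exact (mem_nullBundle_iff.1 hn).1
    have hH' : ∀ᶠ s in 𝓝 (0 : ℝ), g.hamiltonian (g.geodesicFlow (Λ (c s)) t) = 0 := by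
      filter_upwards [hcev] with s ⟨hs, h⟩
      obtain ⟨-, -, -, -, -, hn, htd, -⟩ := h hs
      exact (hamiltonian_geodesicFlow htd).trans (mem_nullBundle_iff.1 hn).1
    -- Neither stage of the flow changes the value of the one-form. In the second stage the duration
    -- varies along the curve, which is harmless for null covectors.
    have e1 := hreg.oneFormVelocity_eq (fun s => Λ (c s)) (fun _ => t) rfl rfl hZd
      (differentiableAt_const t) hH
    have e2 := hreg0.oneFormVelocity_eq (fun s => g.geodesicFlow (Λ (c s)) t)
      (fun s => τ (g.geodesicFlow (Λ (c s)) t)) rfl hτ0 hWd hτd hH'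
    have hVd := hreg0.mdifferentiableAt (Z := fun s => g.geodesicFlow (Λ (c s)) t)
      (τ := fun s => τ (g.geodesicFlow (Λ (c s)) t)) rfl hτ0 hWd hτd
    have hbd : MDifferentiableAt 𝓘(ℝ, ℝ) (cotangentModel F)
        (fun s => Γ (g.geodesicFlow (Λ (c s)) t)) 0 :=
      (ContMDiffAt.comp (g := Γ) (0 : ℝ) hΓ hWs).mdifferentiableAt (by simp)
    obtain ⟨p, a, p', hp, hΛq, hn, -, -, -, ha, hp', hfl⟩ := hcev.self_of_nhds.2 hcev.self_of_nhds.1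
    have e3 : oneFormVelocity (fun s => Λ (c s)) 0 = 1 * oneFormVelocity c 0 := by
      refine oneFormVelocity_eq_of_restrict (ι := ι₁) ((h₁.contMDiff _).mdifferentiableAt (by simp))
        hZd hcd ?_ hΛq fun u => ?_
      · filter_upwards [hcev] with s ⟨hs, h⟩
        obtain ⟨p, a, p', _, h1, _⟩ := h hs
        rw [h1]
      · rw [one_mul]; exact IsNullLift.apply_mfderiv hp u
    -- On the first surface the lift restricts to the curve itself. On the second the transported
    -- covector restricts to `a` times the unit covector, and `a` becomes the conformal factor.
    have e4 : oneFormVelocity (fun s => g.geodesicFlow (g.geodesicFlow (Λ (c s)) t)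
        (τ (g.geodesicFlow (Λ (c s)) t))) 0
        = a * oneFormVelocity (fun s => Γ (g.geodesicFlow (Λ (c s)) t)) 0 := by
      refine oneFormVelocity_eq_of_restrict (ι := ι₂) ((h₂.contMDiff _).mdifferentiableAt (by simp))
        hVd hbd ?_ hfl fun u => ?_
      · filter_upwards [hcev] with s ⟨hs, h⟩
        obtain ⟨p, a, p', _, _, _, _, _, _, _, _, h1⟩ := h hs
        rw [h1]
      · exact congrArg (a * ·) (IsNullLift.apply_mfderiv hp' u)
    refine ⟨a⁻¹, ?_⟩
    rw [e2, e1, e3, one_mul] at e4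
    rw [e4, inv_mul_cancel_left₀ ha.ne']

theorem isContactMapping_of_geodesicRelated
    (hdim : Module.finrank ℝ F + 1 = Module.finrank ℝ E) (h₁ : g.IsCauchySurface (F := F) ι₁)
    (h₂ : g.IsCauchySurface (F := F) ι₂)
    (f : g.cosphereBundle (F := F) ι₁ ≃ g.cosphereBundle (F := F) ι₂)
    (hf : ∀ q₁ q₂, f q₁ = q₂ ↔ g.GeodesicRelated ι₁ ι₂ q₁.1 q₂.1) : IsContactMapping f := by
  refine isContactMapping_of_exists_extension f (fun q => ?_) (fun q => ?_)
  · obtain ⟨Φ, hΦ, hΦev, hθ⟩ := exists_extension_geodesicRelated hdim h₁ h₂ q.2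
    refine ⟨Φ, ⟨hΦ, hΦev.mono fun r h hr => ?_⟩, hθ⟩
    exact (congrArg Subtype.val ((hf ⟨r, hr⟩ ⟨Φ r, (h hr).1⟩).2 (h hr).2)).symm
  · obtain ⟨Φ, hΦ, hΦev, hθ⟩ := exists_extension_geodesicRelated hdim h₂ h₁ q.2
    refine ⟨Φ, ⟨hΦ, hΦev.mono fun r h hr => ?_⟩, hθ⟩
    have h1 := (hf ⟨Φ r, (h hr).1⟩ ⟨r, hr⟩).2 (h hr).2.symm
    rw [← h1, Equiv.symm_apply_apply]

end SpacetimeStructure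

end NullGeodesicContact

theorem mainTheorem5
    {M : Type*} [TopologicalSpace M] [T2Space M]
    [ChartedSpace (EuclideanSpace ℝ (Fin 4)) M]
    [IsManifold 𝓘(ℝ, EuclideanSpace ℝ (Fin 4)) ∞ M]
    (g : SpacetimeStructure (EuclideanSpace ℝ (Fin 4)) M)
    {S₁ : Type*} [TopologicalSpace S₁] [ChartedSpace (EuclideanSpace ℝ (Fin 3)) S₁]
    [IsManifold 𝓘(ℝ, EuclideanSpace ℝ (Fin 3)) ∞ S₁]
    {S₂ : Type*} [TopologicalSpace S₂] [ChartedSpace (EuclideanSpace ℝ (Fin 3)) S₂]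
    [IsManifold 𝓘(ℝ, EuclideanSpace ℝ (Fin 3)) ∞ S₂]
    (ι₁ : S₁ → M) (ι₂ : S₂ → M)
    (h₁ : g.IsCauchySurface (F := EuclideanSpace ℝ (Fin 3)) ι₁)
    (h₂ : g.IsCauchySurface (F := EuclideanSpace ℝ (Fin 3)) ι₂) :
    ∃ f : g.cosphereBundle (F := EuclideanSpace ℝ (Fin 3)) ι₁ ≃
        g.cosphereBundle (F := EuclideanSpace ℝ (Fin 3)) ι₂,
      (∀ (q₁ : g.cosphereBundle (F := EuclideanSpace ℝ (Fin 3)) ι₁)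
        (q₂ : g.cosphereBundle (F := EuclideanSpace ℝ (Fin 3)) ι₂),
        f q₁ = q₂ ↔ g.GeodesicRelated ι₁ ι₂ q₁.1 q₂.1) ∧
      IsContactMapping f := by
  have hdim : Module.finrank ℝ (EuclideanSpace ℝ (Fin 3)) + 1
      = Module.finrank ℝ (EuclideanSpace ℝ (Fin 4)) := by
    simp
  obtain ⟨f, hf⟩ := SpacetimeStructure.exists_equiv_geodesicRelated hdim h₁ h₂
  exact ⟨f, hf, SpacetimeStructure.isContactMapping_of_geodesicRelated hdim h₁ h₂ f hf⟩
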